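/- **Game.** A repeated game with partial monitoring has nonempty finite action sets $\mathcal I,\mathcal J$ of the two players, a finite signal set $\mathcal H$, a payoff function $r:\mathcal I\times\mathcal J\to\mathbb R^d$ (extended bilinearly to mixed actions) and a signaling map $H:\mathcal I\times\mathcal J\to\Delta(\mathcal H)$. At each round $t$ the players simultaneously choose $I_t$ and $J_t$ (the second player by an arbitrary, possibly randomized, strategy based on the whole past), and the first player observes only a signal $S_t$ drawn from $H(I_t,J_t)$. For $\mathbf q\in\Delta(\mathcal J)$ let $\widetilde H(\mathbf q)=\bigl(\sum_j q_jH(i,j)\bigr)_{i\in\mathcal I}\in\mathbb R^{\mathcal I\times\mathcal H}$, let $\mathcal F=\widetilde H(\Delta(\mathcal J))$, and for $\mathbf p\in\Delta(\mathcal I)$, $\sigma\in\mathcal F$ let $\overline m(\mathbf p,\sigma)=\{r(\mathbf p,\mathbf q'):\mathbf q'\in\Delta(\mathcal J),\ \widetilde H(\mathbf q')=\sigma\}$. Let $\mathcal C\subseteq\mathbb R^d$ be closed and convex and assume (APM) for all $\sigma\in\mathcal F$ there is $\mathbf p\in\Delta(\mathcal I)$ with $\overline m(\mathbf p,\sigma)\subseteq\mathcal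 C$. A (vector- or set-valued) map is *piecewise linear* on $X$ if $X$ is a finite union of polytopes on each of which the map commutes with convex combinations (Minkowski combinations for sets). **Lifting.** There exist a finite set $\mathcal B\subset\mathcal F$ and an injective piecewise linear map $\Phi:\mathcal F\to\Delta(\mathcal B)$ with $$\overline m(\mathbf p,\sigma)=\sum_{b\in\mathcal B}\Phi_b(\sigma)\,\overline m(\mathbf p,b)\quad\text{for all }\mathbf p\in\Delta(\mathcal I),\ \sigma\in\mathcal F .$$ Fix any such $(\mathcal B,\Phi)$ and assume that the game is *bi-piecewise linear*: $\overline m(\cdot,b)$ is piecewise linear on $\Delta(\mathcal I)$ for every $b\in\mathcal B$. Then there exist a finite set $\mathcal A\subset\Delta(\mathcal I)$ and a piecewise linear map $\Theta:\Delta(\mathcal I)\to\Delta(\mathcal A)$ with $\sum_a\Theta_a(\mathbf p)\,a=\mathbf p$ and $$\overline m(\mathbf p,b)=\sum_{a\in\mathcal A}\Theta_a(\mathbf p)\,\overline m(a,b)\quad\text{for all }\mathbf p\in\Delta(\mathcal I),\ b\in\mathcal B .$$ Fix any such $(\mathcal A,\Theta)$; these objects are computed from the game beforehand and are part of its description. For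 $\mu\in\Delta(\mathcal A\times\mathcal B)$ put $\overline{\overline m}(\mu)=\sum_{a,b}\mu_{a,b}\,\overline m(a,b)$, and let $\widetilde{\mathcal C}=\{\mu\in\Delta(\mathcal A\times\mathcal B):\overline{\overline m}(\mu)\subseteq\mathcal C\}$. **Inner strategy $\Psi$.** Let $\alpha=3/2$. After $(\theta_1,\mathbf y_1),\dots,(\theta_n,\mathbf y_n)\in\Delta(\mathcal A)\times\Delta(\mathcal B)$, $n\ge1$, put $\hat m_n=\bigl(\sum_{k\le n}k^\alpha\bigr)^{-1}\sum_{k\le n}k^\alpha\,\theta_k\otimes\mathbf y_k$, let $c_n$ be the Euclidean projection of $\hat m_n$ onto $\widetilde{\mathcal C}$, and choose as $\theta_{n+1}\in\Delta(\mathcal A)$ any minimizer of $\mathbf x\mapsto\max_{\mathbf y\in\Delta(\mathcal B)}\langle\hat m_n-c_n,\mathbf x\otimes\mathbf y\rangle$; $\theta_1$ is arbitrary. Such strategies $\Psi$ exist. **Time-adaptive block strategy.** Block $n=1,2,\dots$ consists of $L_n=\lceil n^{3/2}\rceil$ consecutive rounds; let $\gamma_n=n^{-1/2}$. In each round of block $n$,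 $I_t$ is drawn independently from $\mathbf p_n=(1-\gamma_n)\sum_{a}\theta_{n,a}\,a+\gamma_n\mathbf u$, with $\mathbf u$ uniform over $\mathcal I$. At the end of the block one computes $\widetilde\sigma_n=\Bigl(\frac1{L_n}\sum_{t\text{ in block }n}\frac{\mathbb I_{\{S_t=s\}}\mathbb I_{\{I_t=i\}}}{p_{i,n}}\Bigr)_{(i,s)}$, its Euclidean projection $\widehat\sigma_n$ onto $\mathcal F$, and $\theta_{n+1}=\Psi\bigl(\theta_1,\Phi(\widehat\sigma_1),\dots,\theta_n,\Phi(\widehat\sigma_n)\bigr)$. No horizon is needed. **Theorem.** There is a constant $K$ depending only on $\mathcal C$ and on the game (with its fixed lifting) such that, for every $\Psi$ as above, every strategy of the second player, every integer $T\ge1$ and every $\delta\in(0,1)$ with $\delta\le T/2$ (no restriction when $T\ge2$), with probability at least $1-\delta$, $$\inf_{c\in\mathcal C}\Bigl\|c-\frac1T\sum_{t=1}^Tr(I_t,J_t)\Bigr\|_2\le K\Bigl(T^{-1/5}\sqrt{\ln\tfrac T\delta}+T^{-2/5}\ln\tfrac T\delta\Bigr).$$ -/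

import Mathlib

open scoped Pointwise

noncomputable section

namespace PartialMonitoring

/-! ### Polytopes, piecewise linearity, projections -/

/-- A polytope: the convex hull of finitely many points. -/
def IsPolytope {E : Type*} [AddCommGroup E] [Module ℝ E] (P : Set E) : Prop :=
  ∃ V : Finset E, P = convexHull ℝ (V : Set E)

/-- `f` commutes with convex combinations on `P`. The values of `f` may be vectors, or sets of
vectors, in which case `a • f x + b • f y` is the Minkowski convex combination. -/
def IsLinearOn {E W : Type*} [AddCommGroup E] [Module ℝ E] [Add W] [SMul ℝ W]
    (f : E → W) (P : Set E) : Prop :=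
  ∀ x ∈ P, ∀ y ∈ P, ∀ a b : ℝ, 0 ≤ a → 0 ≤ b → a + b = 1 →
    f (a • x + b • y) = a • f x + b • f y

/-- `f` is piecewise linear on `X`: `X` is a finite union of polytopes on each of which `f` is
linear. -/
def PiecewiseLinearOn {E W : Type*} [AddCommGroup E] [Module ℝ E] [Add W] [SMul ℝ W]
    (f : E → W) (X : Set E) : Prop :=
  ∃ Ps : Set (Set E), Ps.Finite ∧ (∀ P ∈ Ps, IsPolytope P) ∧ ⋃₀ Ps = X ∧ ∀ P ∈ Ps, IsLinearOn f P

/-- The projection of `x` onto `K`: the point of `K` nearest to `x`. It exists and is unique for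
nonempty closed convex `K` in a Euclidean space. -/
def proj {E : Type*} [NormedAddCommGroup E] (K : Set E) (x : E) : E :=
  Classical.epsilon fun c => c ∈ K ∧ dist x c = Metric.infDist x K

/-! ### Games with partial monitoring -/

/-- A vector-valued game with partial monitoring: actions `I` of the first player, actions `J` of
the second player, signals `S`, payoffs in `ℝ^d`, and a probability distribution `H i j` over the
signals for each pair of actions. -/
structure Game (I J S : Type*) [Fintype S] (d : ℕ) where
  r : I → J → EuclideanSpace ℝ (Fin d)
  H : I → J → S → ℝ
  H_mem : ∀ i j, H i j ∈ stdSimplex ℝ S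

section

variable {I J S : Type*} [Fintype I] [Fintype J] [Fintype S] {d : ℕ}

namespace Game

/-- The bilinear extension of `r`. -/
def payoff (G : Game I J S d) (p : I → ℝ) (q : J → ℝ) : EuclideanSpace ℝ (Fin d) :=
  ∑ i, ∑ j, (p i * q j) • G.r i j

/-- The vector of signal distributions `(H(i, q))_i`, as a vector of `ℝ^(I × S)`. -/
def signal (G : Game I J S d) (q : J → ℝ) : EuclideanSpace ℝ (I × S) :=
  WithLp.toLp 2 fun x => ∑ j, q j * G.H x.1 j x.2

/-- The set `ℱ` of feasible vectors of signal distributions. -/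
def feasible (G : Game I J S d) : Set (EuclideanSpace ℝ (I × S)) :=
  G.signal '' stdSimplex ℝ J

/-- The set-valued payoff `m̄(p, σ)`: the payoffs of `p` against the mixed actions of the second
player that are compatible with `σ`. -/
def mbar (G : Game I J S d) (p : I → ℝ) (σ : EuclideanSpace ℝ (I × S)) :
    Set (EuclideanSpace ℝ (Fin d)) :=
  {v | ∃ q ∈ stdSimplex ℝ J, G.signal q = σ ∧ G.payoff p q = v}

/-- Condition (APM). -/
def APM (G : Game I J S d) (C : Set (EuclideanSpace ℝ (Fin d))) : Prop :=
  ∀ σ ∈ G.feasible, ∃ p ∈ stdSimplex ℝ I, G.mbar p σ ⊆ C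

/-- A finite set `ℬ ⊆ ℱ` with an injective piecewise linear map `Φ : ℱ → Δ(ℬ)` such that
`m̄(p, σ) = ∑_b Φ_b(σ) m̄(p, b)` (Minkowski sum) for all `p` and `σ`. -/
structure SignalLift (G : Game I J S d) where
  B : Finset (EuclideanSpace ℝ (I × S))
  B_subset : ∀ b ∈ B, b ∈ G.feasible
  Φ : EuclideanSpace ℝ (I × S) → B → ℝ
  Φ_mem : ∀ σ ∈ G.feasible, Φ σ ∈ stdSimplex ℝ B
  Φ_piecewiseLinear : PiecewiseLinearOn Φ G.feasible
  Φ_injOn : Set.InjOn Φ G.feasible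
  mbar_eq : ∀ σ ∈ G.feasible, ∀ p ∈ stdSimplex ℝ I,
    G.mbar p σ = ∑ b : B, Φ σ b • G.mbar p b

end Game

namespace Game.SignalLift

variable {G : Game I J S d}

/-- The game is bi-piecewise linear: `m̄(·, b)` is piecewise linear on `Δ(I)` for all `b ∈ ℬ`. -/
def BiPiecewiseLinear (D : G.SignalLift) : Prop :=
  ∀ b ∈ D.B, PiecewiseLinearOn (fun p => G.mbar p b) (stdSimplex ℝ I)

/-- A finite set `𝒜 ⊆ Δ(I)` with a piecewise linear map `Θ : Δ(I) → Δ(𝒜)` that decomposes every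
`p` as a convex combination of elements of `𝒜` (so that it is injective), such that
`m̄(p, b) = ∑_a Θ_a(p) m̄(a, b)` (Minkowski sum) for all `p` and all `b ∈ ℬ`. -/
structure ActionLift (D : G.SignalLift) where
  A : Finset (I → ℝ)
  A_subset : ∀ a ∈ A, a ∈ stdSimplex ℝ I
  Θ : (I → ℝ) → A → ℝ
  Θ_mem : ∀ p ∈ stdSimplex ℝ I, Θ p ∈ stdSimplex ℝ A
  Θ_piecewiseLinear : PiecewiseLinearOn Θ (stdSimplex ℝ I)
  Θ_decomp : ∀ p ∈ stdSimplex ℝ I, ∑ a : A, Θ p a • (a : I → ℝ) = p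
  mbar_eq : ∀ b ∈ D.B, ∀ p ∈ stdSimplex ℝ I,
    G.mbar p b = ∑ a : A, Θ p a • G.mbar a b

end Game.SignalLift

/-! ### The inner strategy: approachability with polynomially weighted averages -/

/-- The exponent `α = 3/2`. -/
def alpha : ℝ := 3 / 2

/-- The product distribution `x ⊗ y`. -/
def tensor {A B : Type*} [Fintype A] [Fintype B] (x : A → ℝ) (y : B → ℝ) :
    EuclideanSpace ℝ (A × B) :=
  WithLp.toLp 2 fun c => x c.1 * y c.2

/-- The polynomially weighted average `(∑_{k ≤ n} k^α)⁻¹ ∑_{k ≤ n} k^α x_k ⊗ y_k` of a history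
`(x_1, y_1), …, (x_n, y_n)` (listed from the oldest; the list index `k` stands for `k + 1`). -/
def polyAverage {A B : Type*} [Fintype A] [Fintype B] (h : List ((A → ℝ) × (B → ℝ))) :
    EuclideanSpace ℝ (A × B) :=
  (∑ k : Fin h.length, ((k : ℕ) + 1 : ℝ) ^ alpha)⁻¹ •
    ∑ k : Fin h.length, ((k : ℕ) + 1 : ℝ) ^ alpha • tensor (h.get k).1 (h.get k).2

variable {G : Game I J S d} {D : G.SignalLift}

namespace Game.SignalLift.ActionLift

/-- The linear extension to `Δ(𝒜 × ℬ)` of the restriction of `m̄` to `𝒜 × ℬ`. -/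
def mlift (A : D.ActionLift) (μ : EuclideanSpace ℝ (A.A × D.B)) :
    Set (EuclideanSpace ℝ (Fin d)) :=
  ∑ c : A.A × D.B, μ c • G.mbar c.1 c.2

/-- The lifted target set: the joint distributions over `𝒜 × ℬ` whose set-valued payoff is
included in `C`. -/
def liftTarget (A : D.ActionLift) (C : Set (EuclideanSpace ℝ (Fin d))) :
    Set (EuclideanSpace ℝ (A.A × D.B)) :=
  {μ | (fun c => μ c) ∈ stdSimplex ℝ (A.A × D.B) ∧ A.mlift μ ⊆ C}

/-- A strategy `Ψ` for the robust approachability of `C` in the lifted game, with respect to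
polynomially weighted averages: the first choice `next []` is arbitrary; after a nonempty history
with weighted average `m`, it plays a solution `x` of the minimax problem
`min_x max_y ⟪m - c, x ⊗ y⟫`, where `c` is the projection of `m` onto the lifted target set. -/
structure InnerStrategy (A : D.ActionLift) (C : Set (EuclideanSpace ℝ (Fin d))) where
  next : List ((A.A → ℝ) × (D.B → ℝ)) → A.A → ℝ
  next_mem : ∀ h, next h ∈ stdSimplex ℝ A.A
  minimax : ∀ h : List ((A.A → ℝ) × (D.B → ℝ)), h ≠ [] →
    (∀ z ∈ h, z.1 ∈ stdSimplex ℝ A.A ∧ z.2 ∈ stdSimplex ℝ D.B) →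
    IsMinOn
      (fun x : A.A → ℝ => ⨆ y : stdSimplex ℝ D.B,
        inner ℝ (polyAverage h - proj (A.liftTarget C) (polyAverage h)) (tensor x y.1))
      (stdSimplex ℝ A.A) (next h)

end Game.SignalLift.ActionLift

/-! ### The time-adaptive block strategy

Rounds and blocks are numbered from `0`: round `t` and block `n` are the `(t+1)`-st round and the
`(n+1)`-st block. -/

/-- The length of block `n`: `(n+1)^α`, rounded up to an integer. -/
def blockLen (n : ℕ) : ℕ := ⌈((n : ℝ) + 1) ^ alpha⌉₊

/-- The exploration rate `(n+1)^(-α/3)` in block `n`. -/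
def explore (n : ℕ) : ℝ := ((n : ℝ) + 1) ^ (-(alpha / 3))

/-- The first round of block `n`. -/
def blockStart (n : ℕ) : ℕ := ∑ k ∈ Finset.range n, blockLen k

/-- The block that contains round `t`. -/
def blockIndex (t : ℕ) : ℕ := Nat.findGreatest (fun n => blockStart n ≤ t) t

open Classical in
/-- The estimated vector of signal distributions formed at the end of block `n`, when `p` was
played in this block and the actions and signals of the successive rounds are given by `obs`. -/
def estimate (n : ℕ) (p : I → ℝ) (obs : ℕ → I × S) : EuclideanSpace ℝ (I × S) :=
  WithLp.toLp 2 fun x =>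
    (1 / (blockLen n : ℝ)) * ∑ t ∈ Finset.Ico (blockStart n) (blockStart (n + 1)),
      if obs t = x then 1 / p x.1 else 0

namespace Game.SignalLift.ActionLift

variable {A : D.ActionLift} {C : Set (EuclideanSpace ℝ (Fin d))}

/-- The mixed action played in block `n` when the inner strategy chose `θ ∈ Δ(𝒜)`:
`(1 - γ_n) ∑_a θ_a a + γ_n u`, with `u` uniform over `I`. -/
def blockAction (A : D.ActionLift) (n : ℕ) (θ : A.A → ℝ) : I → ℝ := fun i =>
  (1 - explore n) * (∑ a : A.A, θ a * (a : I → ℝ) i) + explore n * (1 / (Fintype.card I : ℝ))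

/-- The history `(θ_k, Φ(σ̂_k))`, `k < n`, that is fed to the inner strategy after `n` blocks. -/
def InnerStrategy.blockHistory (Ψ : A.InnerStrategy C) (obs : ℕ → I × S) :
    ℕ → List ((A.A → ℝ) × (D.B → ℝ))
  | 0 => []
  | n + 1 =>
    let h := Ψ.blockHistory obs n
    h ++ [(Ψ.next h,
      D.Φ (proj G.feasible (estimate n (A.blockAction n (Ψ.next h)) obs)))]

/-- The mixed action of the first player in round `t`. It depends on `obs` only through the blocks
completed before the one containing `t`. -/
def InnerStrategy.play (Ψ : A.InnerStrategy C) (t : ℕ) (obs : ℕ → I × S) : I → ℝ :=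
  A.blockAction (blockIndex t) (Ψ.next (Ψ.blockHistory obs (blockIndex t)))

end Game.SignalLift.ActionLift

/-- The random actions `act t`, `opp t` and signals `sig t` are generated by the repeated game when
the first player uses `p t (past observations)` as mixed action in round `t`: given the past
`(act u, opp u, sig u)`, `u < t`, and the action `opp t` of the second player, `act t` has law
`p t (past observations)` and then `sig t` has law `H (act t) (opp t)`. The second player uses an
arbitrary strategy: `opp t` may depend on the whole past in any way, with randomization. -/
structure IsPlay {Ω : Type*} [MeasurableSpace Ω] (μ : MeasureTheory.Measure Ω) (G : Game I J S d)
    (p : ℕ → (ℕ → I × S) → I → ℝ)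
    (act : ℕ → Ω → I) (opp : ℕ → Ω → J) (sig : ℕ → Ω → S) : Prop where
  measurable_act : ∀ t i, MeasurableSet {ω | act t ω = i}
  measurable_opp : ∀ t j, MeasurableSet {ω | opp t ω = j}
  measurable_sig : ∀ t s, MeasurableSet {ω | sig t ω = s}
  law : ∀ (t : ℕ) (i : ℕ → I) (j : ℕ → J) (s : ℕ → S),
    μ.real {ω | ∀ u ≤ t, act u ω = i u ∧ opp u ω = j u ∧ sig u ω = s u} =
      μ.real {ω | (∀ u < t, act u ω = i u ∧ opp u ω = j u ∧ sig u ω = s u) ∧ opp t ω = j t} *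
        p t (fun u => (i u, s u)) (i t) * G.H (i t) (j t) (s t)

end

end PartialMonitoring

end

/-!
The proof reduces partial monitoring to full monitoring of a finite lifted game, in which Blackwell's
approachability applies.

*Liftings.* Over the feasible signals `ℱ`, the mixed actions of the second player that generate a
given vector `σ` form a fiber of a linear map restricted to a simplex. Such fibers depend on `σ` in a
piecewise linear way (`piecewiseLinearOn_fiber`): the extreme points of a fiber are given by finitely
many linear sections of the map, and on each cell of the arrangement defined by the coordinates of
these sections the fiber is the convex hull of a fixed family of them, in the interior of the cell by
extremality and up to the boundary by continuity. Finitely many polytopes are unions of cells of a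
hyperplane arrangement; decomposing each point over the vertices of its own cell, with weights of
least Euclidean norm, is well defined and piecewise linear, since least-norm solutions of linear
systems over a simplex are (`exists_piecewiseLinear_decomposition`). Applied to the pieces of the
fiber map, respectively to the pieces of the maps `m̄(·, b)`, this gives both liftings.

*Lifted game.* By (APM), applied to `σ = ∑ b, y b • b`, for each `y ∈ Δ(ℬ)` some `x ∈ Δ(𝒜)` makes
`x ⊗ y` belong to the lifted target set (`exists_tensor_mem_liftTarget`). The minimax theorem turns
this into Blackwell's condition, and the classical recursion on squared distances, run with weights
`k ^ (3 / 2)`, bounds the total weight times the distance of the weighted average to the lifted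
target by a constant times `N ^ 2` after `N` blocks (`totalWeight_mul_infDist_le`).

*Along a path.* The weights agree with the block lengths up to rounding, so the sum of payoffs over
the complete blocks is close to the corresponding sum of lifted payoffs. The errors are the
deviations of payoffs and signals from their conditional laws, the exploration, the incomplete block,
and the error on `Φ(σ̂)`; the last is controlled by the error on `σ̂` because a piecewise linear map on
a convex set is Lipschitz (`PiecewiseLinearOn.exists_norm_sub_le`). This is `exists_mul_infDist_le`.

*Probability.* Integrating an exponential supermartingale against the law of the play gives
Bernstein's inequality whatever the strategy of the second player
(`IsMartingaleDifference.bernstein`). Exploration at rate `n ^ (-1 / 2)` bounds the conditional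
variances of the importance-weighted estimates in block `n` by `|I| n ^ (1 / 2)`, so that all errors
are of order `N ^ 2` up to logarithms, while `T` is of order `N ^ (5 / 2)`. Dividing by `T` gives the
rate `T ^ (-1 / 5)`.
-/

open scoped Pointwise

noncomputable section

namespace PartialMonitoring

/-! ### Polyhedra and polytopes -/

section Polyhedra

open Set Filter Topology

/-- A polyhedron: the set of solutions of finitely many affine inequalities. -/
def IsPolyhedron {E : Type*} [AddCommGroup E] [Module ℝ E] (P : Set E) : Prop :=
  ∃ κ : Set (E →ᵃ[ℝ] ℝ), κ.Finite ∧ P = {x | ∀ f ∈ κ, 0 ≤ f x}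

section Algebra

variable {E F : Type*} [AddCommGroup E] [Module ℝ E] [AddCommGroup F] [Module ℝ F]

theorem IsPolyhedron.inter {P Q : Set E} (hP : IsPolyhedron P) (hQ : IsPolyhedron Q) :
    IsPolyhedron (P ∩ Q) := by
  obtain ⟨κ, hκ, rfl⟩ := hP
  obtain ⟨κ', hκ', rfl⟩ := hQ
  refine ⟨κ ∪ κ', hκ.union hκ', ?_⟩
  ext x
  simp only [mem_inter_iff, mem_ofPred_eq, mem_union, or_imp, forall_and]

theorem isPolyhedron_halfSpace (f : E →ᵃ[ℝ] ℝ) : IsPolyhedron {x | 0 ≤ f x} :=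
  ⟨{f}, finite_singleton f, by simp⟩

theorem isPolyhedron_iInter {ι : Type*} [Finite ι] {P : ι → Set E}
    (h : ∀ i, IsPolyhedron (P i)) : IsPolyhedron (⋂ i, P i) := by
  choose κ hκ hP using h
  refine ⟨⋃ i, κ i, finite_iUnion hκ, ?_⟩
  ext x
  simp only [hP, mem_iInter, mem_ofPred_eq, mem_iUnion, forall_exists_index]
  exact forall_comm

theorem isPolyhedron_setOf_forall {ι : Type*} [Finite ι] {p : ι → E → Prop}
    (h : ∀ i, IsPolyhedron {x | p i x}) : IsPolyhedron {x | ∀ i, p i x} := by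
  rw [Set.ofPred_forall]
  exact isPolyhedron_iInter h

theorem isPolyhedron_univ : IsPolyhedron (univ : Set E) :=
  ⟨∅, finite_empty, by simp⟩

theorem isPolyhedron_setOf_imp {q : Prop} {p : E → Prop} (h : IsPolyhedron {x | p x}) :
    IsPolyhedron {x | q → p x} := by
  by_cases hq : q
  · simpa [hq] using h
  · simpa [hq] using isPolyhedron_univ (E := E)

theorem IsPolyhedron.preimage {P : Set F} (hP : IsPolyhedron P) (g : E →ᵃ[ℝ] F) :
    IsPolyhedron (g ⁻¹' P) := by
  obtain ⟨κ, hκ, rfl⟩ := hP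
  refine ⟨(fun f => f.comp g) '' κ, hκ.image _, ?_⟩
  ext x
  simp

theorem isPolyhedron_eq_zero (f : E →ᵃ[ℝ] ℝ) : IsPolyhedron {x | f x = 0} := by
  have : {x | f x = 0} = {x | 0 ≤ f x} ∩ {x | 0 ≤ (-f) x} := by
    ext x
    simp only [mem_ofPred_eq, mem_inter_iff, AffineMap.coe_neg, Pi.neg_apply, Left.nonneg_neg_iff]
    exact ⟨fun h => ⟨h.ge, h.le⟩, fun h => le_antisymm h.2 h.1⟩
  rw [this]
  exact (isPolyhedron_halfSpace f).inter (isPolyhedron_halfSpace (-f))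

theorem isPolyhedron_singleton [FiniteDimensional ℝ F] (w : F) : IsPolyhedron ({w} : Set F) := by
  have : ({w} : Set F) = {x | ∀ i, ((Module.finBasis ℝ F).coord i).toAffineMap x -
      (AffineMap.const ℝ F ((Module.finBasis ℝ F).coord i w)) x = 0} := by
    ext x
    simp only [mem_singleton_iff, mem_ofPred_eq, LinearMap.coe_toAffineMap, AffineMap.const_apply,
      sub_eq_zero]
    exact ⟨fun h => by simp [h], fun h => (Module.finBasis ℝ F).ext_elem h⟩
  rw [this]
  exact isPolyhedron_setOf_forall fun i => isPolyhedron_eq_zero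
    (((Module.finBasis ℝ F).coord i).toAffineMap -
      (AffineMap.const ℝ F ((Module.finBasis ℝ F).coord i w)))

theorem isPolyhedron_stdSimplex (ι : Type*) [Fintype ι] :
    IsPolyhedron (stdSimplex ℝ ι) := by
  have : stdSimplex ℝ ι = {x | ∀ i, 0 ≤ (LinearMap.proj (R := ℝ) (φ := fun _ : ι => ℝ) i).toAffineMap x} ∩
      (∑ i, LinearMap.proj (R := ℝ) (φ := fun _ : ι => ℝ) i).toAffineMap ⁻¹' {1} := by
    ext x
    simp [stdSimplex]
  rw [this]
  exact (isPolyhedron_setOf_forall fun i => isPolyhedron_halfSpace _).inter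
    ((isPolyhedron_singleton 1).preimage _)

/-- An extreme point of a polyhedron is determined by the inequalities that are tight at it. -/
theorem IsPolyhedron.finite_extremePoints {P : Set E} (hP : IsPolyhedron P) :
    (P.extremePoints ℝ).Finite := by
  obtain ⟨κ, hκ, rfl⟩ := hP
  have := hκ.to_subtype
  refine Set.Finite.of_finite_image (f := fun x => {k : κ | k.1 x = 0}) (toFinite _) ?_
  intro x hx y hy hxy
  have hxy' : ∀ k : κ, k.1 x = 0 ↔ k.1 y = 0 := fun k => by
    have := Set.ext_iff.1 hxy k
    simpa using this
  have hline : ∀ (k : κ) (t : ℝ), k.1 (x + t • (y - x)) = k.1 x + t * (k.1 y - k.1 x) := by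
    intro k t
    have h1 : x + t • (y - x) = AffineMap.lineMap x y t := by
      rw [AffineMap.lineMap_apply, vsub_eq_sub, vadd_eq_add, add_comm]
    rw [h1, AffineMap.apply_lineMap, AffineMap.lineMap_apply]
    simp [add_comm]
  have hx0 : ∀ k : κ, 0 ≤ k.1 x := fun k => hx.1 k.1 k.2
  have key : ∀ᶠ t : ℝ in 𝓝 0, ∀ k : κ, 0 ≤ k.1 (x + t • (y - x)) := by
    rw [eventually_all]
    intro k
    simp only [hline]
    rcases (hx0 k).eq_or_lt with h | h
    · refine Eventually.of_forall fun t => ?_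
      rw [← h, (hxy' k).1 h.symm]
      simp
    · have hc : Tendsto (fun t : ℝ => k.1 x + t * (k.1 y - k.1 x)) (𝓝 0) (𝓝 (k.1 x)) := by
        have : Continuous (fun t : ℝ => k.1 x + t * (k.1 y - k.1 x)) := by fun_prop
        simpa using this.tendsto 0
      exact (hc.eventually (lt_mem_nhds h)).mono fun t ht => le_of_lt ht
  obtain ⟨ε, hε, hball⟩ := Metric.eventually_nhds_iff.1 key
  have h1 := hball (y := ε / 2) (by rw [Real.dist_eq, sub_zero, abs_of_pos] <;> linarith)
  have h2 := hball (y := -(ε / 2)) (by rw [Real.dist_eq, sub_zero, abs_neg, abs_of_pos] <;> linarith)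
  have h3 := (mem_extremePoints.1 hx).2 _ (fun f hf => h2 ⟨f, hf⟩) _ (fun f hf => h1 ⟨f, hf⟩)
    ⟨1 / 2, 1 / 2, by norm_num, by norm_num, by norm_num, by module⟩
  have h4 : (ε / 2) • (y - x) = 0 := by
    have := h3.2
    simpa using this
  rcases smul_eq_zero.1 h4 with h | h
  · linarith
  · exact (sub_eq_zero.1 h).symm

theorem IsPolytope.image {P : Set E} (hP : IsPolytope P) (f : E →ₗ[ℝ] F) :
    IsPolytope (f '' P) := by
  classical
  obtain ⟨V, rfl⟩ := hP
  exact ⟨V.image f, by rw [LinearMap.image_convexHull, Finset.coe_image]⟩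

theorem IsPolytope.convex {P : Set E} (hP : IsPolytope P) : Convex ℝ P := by
  obtain ⟨V, rfl⟩ := hP
  exact convex_convexHull ℝ _

theorem IsPolyhedron.convex {P : Set E} (hP : IsPolyhedron P) : Convex ℝ P := by
  obtain ⟨κ, -, rfl⟩ := hP
  have : {x | ∀ f ∈ κ, 0 ≤ f x} = ⋂ f ∈ κ, f ⁻¹' Ici (0 : ℝ) := by
    ext x; simp
  rw [this]
  exact convex_iInter₂ fun f _ => (convex_Ici 0).affine_preimage f

end Algebra

section Topology

variable {E : Type*} [NormedAddCommGroup E] [NormedSpace ℝ E]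

theorem IsPolytope.isCompact {P : Set E} (hP : IsPolytope P) : IsCompact P := by
  obtain ⟨V, rfl⟩ := hP
  exact V.finite_toSet.isCompact_convexHull (𝕜 := ℝ)

theorem subset_convexHull_of_extremePoints_subset {P V : Set E} (hP : IsCompact P)
    (hc : Convex ℝ P) (hV : V.Finite) (h : P.extremePoints ℝ ⊆ V) : P ⊆ convexHull ℝ V := by
  rw [← closure_convexHull_extremePoints hP hc]
  exact closure_minimal (convexHull_mono h) (hV.isCompact_convexHull (𝕜 := ℝ)).isClosed

variable [FiniteDimensional ℝ E]

theorem IsPolyhedron.isClosed {P : Set E} (hP : IsPolyhedron P) : IsClosed P := by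
  obtain ⟨κ, -, rfl⟩ := hP
  have : {x | ∀ f ∈ κ, 0 ≤ f x} = ⋂ f ∈ κ, f ⁻¹' Ici (0 : ℝ) := by
    ext x; simp
  rw [this]
  exact isClosed_biInter fun f _ => isClosed_Ici.preimage f.continuous_of_finiteDimensional

/-- A bounded polyhedron is a polytope. -/
theorem IsPolyhedron.isPolytope {P : Set E} (hP : IsPolyhedron P) (hb : Bornology.IsBounded P) :
    IsPolytope P := by
  have hK : IsCompact P := Metric.isCompact_of_isClosed_isBounded hP.isClosed hb
  refine ⟨hP.finite_extremePoints.toFinset, ?_⟩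
  rw [Finite.coe_toFinset]
  exact (subset_convexHull_of_extremePoints_subset hK hP.convex hP.finite_extremePoints
    subset_rfl).antisymm (convexHull_min extremePoints_subset hP.convex)

end Topology

end Polyhedra

/-! ### Fibers of a linear map over the nonnegative orthant -/

section Fibers

open Set Filter Topology

/-- A linear map `M` has a generalised inverse that inverts `M` exactly on a given subspace that
meets the kernel trivially. -/
theorem exists_generalizedInverse {W E : Type*} [AddCommGroup W] [Module ℝ W] [AddCommGroup E]
    [Module ℝ E] (M : W →ₗ[ℝ] E) (U : Submodule ℝ W) :
    ∃ L : E →ₗ[ℝ] W, (∀ q, M (L (M q)) = M q) ∧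
      ((∀ v ∈ U, M v = 0 → v = 0) → ∀ u ∈ U, L (M u) = u) := by
  obtain ⟨r, hr⟩ := M.rangeRestrict.exists_rightInverse_of_surjective M.range_rangeRestrict
  obtain ⟨L₀, hL₀⟩ := LinearMap.exists_extend r
  have h0 : ∀ q, M (L₀ (M q)) = M q := fun q => by
    have h1 : L₀ (M q) = r (M.rangeRestrict q) := LinearMap.congr_fun hL₀ (M.rangeRestrict q)
    have h2 := LinearMap.congr_fun hr (M.rangeRestrict q)
    rw [h1]
    simpa using congrArg Subtype.val h2
  by_cases hU : ∀ v ∈ U, M v = 0 → v = 0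
  · obtain ⟨g, hg⟩ := (M.domRestrict U).exists_leftInverse_of_injective (by
      rw [LinearMap.ker_eq_bot']
      intro v hv
      exact Subtype.ext (hU v v.2 hv))
    have hg' : ∀ u ∈ U, (g (M u) : W) = u := fun u hu =>
      congrArg Subtype.val (LinearMap.congr_fun hg ⟨u, hu⟩)
    refine ⟨U.subtype ∘ₗ g + L₀ ∘ₗ (LinearMap.id - M ∘ₗ U.subtype ∘ₗ g), fun q => ?_,
      fun _ u hu => ?_⟩
    · have h1 : M q - M (g (M q) : W) = M (q - (g (M q) : W)) := (map_sub _ _ _).symm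
      simp only [LinearMap.add_apply, LinearMap.comp_apply, LinearMap.sub_apply, LinearMap.id_apply,
        Submodule.subtype_apply, map_add]
      rw [h1, h0, map_sub]
      abel
    · simp only [LinearMap.add_apply, LinearMap.comp_apply, LinearMap.sub_apply,
        LinearMap.id_apply, Submodule.subtype_apply, hg' u hu, sub_self, map_zero, add_zero]
  · exact ⟨L₀, h0, fun h => absurd h hU⟩

variable {J : Type*} {E : Type*}

/-- The nonnegative solutions of `M q = w`. -/
def fiber [AddCommGroup E] [Module ℝ E] (M : (J → ℝ) →ₗ[ℝ] E) (w : E) : Set (J → ℝ) :=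
  {q | (∀ j, 0 ≤ q j) ∧ M q = w}

/-- A family of generalised inverses of `M`, one for each possible support, that finds every
nonnegative vector whose support carries no element of the kernel. -/
theorem exists_sections [AddCommGroup E] [Module ℝ E] (M : (J → ℝ) →ₗ[ℝ] E) :
    ∃ L : Set J → E →ₗ[ℝ] (J → ℝ), (∀ T q, M (L T (M q)) = M q) ∧
      ∀ q : J → ℝ, (∀ v : J → ℝ, (∀ j, q j = 0 → v j = 0) → M v = 0 → v = 0) →
        ∃ T, L T (M q) = q := by
  have h := fun T : Set J => exists_generalizedInverse M
    ({ carrier := {v | ∀ j, j ∉ T → v j = 0}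
       add_mem' := fun {a b} ha hb j hj => by simp [ha j hj, hb j hj]
       zero_mem' := fun j _ => rfl
       smul_mem' := fun c v hv j hj => by simp [hv j hj] } : Submodule ℝ (J → ℝ))
  choose L hL1 hL2 using h
  refine ⟨L, hL1, fun q hq => ⟨{j | q j ≠ 0}, hL2 _ (fun v hv => hq v fun j hj => ?_) q ?_⟩⟩
  · exact hv j (by simpa using hj)
  · intro j hj
    simpa using hj

variable [Fintype J]

/-- The support of an extreme point of a fiber carries no element of the kernel. -/
theorem eq_zero_of_mem_extremePoints_fiber [AddCommGroup E] [Module ℝ E] {M : (J → ℝ) →ₗ[ℝ] E}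
    {w : E} {q : J → ℝ} (hq : q ∈ (fiber M w).extremePoints ℝ) {v : J → ℝ}
    (hv : ∀ j, q j = 0 → v j = 0) (hMv : M v = 0) : v = 0 := by
  have key : ∀ᶠ t : ℝ in 𝓝 0, ∀ j, 0 ≤ q j + t * v j := by
    rw [eventually_all]
    intro j
    rcases (hq.1.1 j).eq_or_lt with h | h
    · exact Eventually.of_forall fun t => by rw [hv j h.symm, ← h]; simp
    · have hc : Tendsto (fun t : ℝ => q j + t * v j) (𝓝 0) (𝓝 (q j)) := by
        have : Continuous (fun t : ℝ => q j + t * v j) := by fun_prop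
        simpa using this.tendsto 0
      exact (hc.eventually (lt_mem_nhds h)).mono fun t ht => le_of_lt ht
  obtain ⟨ε, hε, hball⟩ := Metric.eventually_nhds_iff.1 key
  have hmem : ∀ t : ℝ, |t| < ε → q + t • v ∈ fiber M w := fun t ht =>
    ⟨fun j => by simpa using hball (y := t) (by rwa [Real.dist_eq, sub_zero]) j, by
      rw [map_add, map_smul, hMv, smul_zero, add_zero, hq.1.2]⟩
  have h3 := (mem_extremePoints.1 hq).2 _ (hmem (-(ε / 2)) (by rw [abs_neg, abs_of_pos] <;> linarith))
    _ (hmem (ε / 2) (by rw [abs_of_pos] <;> linarith))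
    ⟨1 / 2, 1 / 2, by norm_num, by norm_num, by norm_num, by module⟩
  have h4 : (ε / 2) • v = 0 := by simpa using h3.2
  exact (smul_eq_zero.1 h4).resolve_left (by positivity)

omit [Fintype J] in
theorem convex_fiber [AddCommGroup E] [Module ℝ E] (M : (J → ℝ) →ₗ[ℝ] E) (w : E) :
    Convex ℝ (fiber M w) := by
  intro x hx y hy a b ha hb hab
  refine ⟨fun j => ?_, ?_⟩
  · have := mul_nonneg ha (hx.1 j)
    have := mul_nonneg hb (hy.1 j)
    simp only [Pi.add_apply, Pi.smul_apply, smul_eq_mul]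
    linarith
  · rw [map_add, map_smul, map_smul, hx.2, hy.2, ← add_smul, hab, one_smul]

/-- When the kernel of `M` consists of vectors of sum zero, the fibers of `M` over the image of the
simplex stay in the simplex, so the constraint `∑ j, q j = 1` need not be imposed. -/
theorem fiber_eq_of_mem [AddCommGroup E] [Module ℝ E] {M : (J → ℝ) →ₗ[ℝ] E}
    (hs : ∀ v, M v = 0 → ∑ j, v j = 0) {w : E} (hw : w ∈ M '' stdSimplex ℝ J) :
    fiber M w = {q | q ∈ stdSimplex ℝ J ∧ M q = w} := by
  obtain ⟨q₀, hq₀, rfl⟩ := hw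
  ext q
  refine ⟨fun h => ⟨⟨h.1, ?_⟩, h.2⟩, fun h => ⟨h.1.1, h.2⟩⟩
  have := hs (q - q₀) (by rw [map_sub, h.2, sub_self])
  simp only [Pi.sub_apply, Finset.sum_sub_distrib, hq₀.2] at this
  linarith

section

variable [NormedAddCommGroup E] [NormedSpace ℝ E]

theorem isCompact_fiber {M : (J → ℝ) →ₗ[ℝ] E} (hs : ∀ v, M v = 0 → ∑ j, v j = 0) (w : E) :
    IsCompact (fiber M w) := by
  rcases (fiber M w).eq_empty_or_nonempty with h | ⟨q₀, hq₀⟩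
  · rw [h]; exact isCompact_empty
  refine (isCompact_Icc (a := (0 : J → ℝ)) (b := fun _ => ∑ j, q₀ j)).of_isClosed_subset ?_ ?_
  · have : fiber M w = (⋂ j, {q | 0 ≤ q j}) ∩ M ⁻¹' {w} := by
      ext q; simp [fiber]
    rw [this]
    exact (isClosed_iInter fun j => isClosed_le continuous_const (continuous_apply j)).inter
      (isClosed_singleton.preimage M.continuous_of_finiteDimensional)
  · intro q hq
    refine ⟨hq.1, fun j => ?_⟩
    have := hs (q - q₀) (by rw [map_sub, hq.2, hq₀.2, sub_self])
    simp only [Pi.sub_apply, Finset.sum_sub_distrib] at this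
    have h2 := Finset.single_le_sum (f := q) (fun i _ => hq.1 i) (Finset.mem_univ j)
    linarith

/-- One of the sections selects an extreme point of a nonempty fiber. -/
theorem exists_section_mem_fiber {M : (J → ℝ) →ₗ[ℝ] E} (hs : ∀ v, M v = 0 → ∑ j, v j = 0)
    {L : Set J → E →ₗ[ℝ] (J → ℝ)}
    (hL : ∀ q : J → ℝ, (∀ v : J → ℝ, (∀ j, q j = 0 → v j = 0) → M v = 0 → v = 0) →
        ∃ T, L T (M q) = q) {w : E} (hw : (fiber M w).Nonempty) :
    ∃ T, L T w ∈ fiber M w := by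
  obtain ⟨q, hq⟩ := (isCompact_fiber hs w).extremePoints_nonempty hw
  obtain ⟨T, hT⟩ := hL q fun v hv hMv => eq_zero_of_mem_extremePoints_fiber hq hv hMv
  refine ⟨T, ?_⟩
  rw [hq.1.2] at hT
  rw [hT]
  exact hq.1

/-- A fiber is the convex hull of the values of the sections that are nonnegative at its base
point: these include all its extreme points. -/
theorem fiber_subset_convexHull_sections {M : (J → ℝ) →ₗ[ℝ] E}
    (hs : ∀ v, M v = 0 → ∑ j, v j = 0) {L : Set J → E →ₗ[ℝ] (J → ℝ)}
    (hL : ∀ q : J → ℝ, (∀ v : J → ℝ, (∀ j, q j = 0 → v j = 0) → M v = 0 → v = 0) →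
        ∃ T, L T (M q) = q) (w : E) :
    fiber M w ⊆ convexHull ℝ ((fun T => L T w) '' {T | ∀ j, 0 ≤ L T w j}) := by
  refine subset_convexHull_of_extremePoints_subset (isCompact_fiber hs w) (convex_fiber M w)
    (toFinite _) fun q hq => ?_
  obtain ⟨T, hT⟩ := hL q fun v hv hMv => eq_zero_of_mem_extremePoints_fiber hq hv hMv
  rw [hq.1.2] at hT
  exact ⟨T, by rw [mem_ofPred_eq, hT]; exact hq.1.1, hT⟩

end

/-- Finitely many nonzero linear forms are simultaneously nonzero at some point of the simplex
arbitrarily close to a given point `q`, with signs compatible with those at `q`. -/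
theorem exists_mem_stdSimplex_generic {κ : Type*} [Finite κ] (φ : κ → (J → ℝ) →ₗ[ℝ] ℝ)
    {q : J → ℝ} (hq : q ∈ stdSimplex ℝ J) :
    ∃ q' ∈ stdSimplex ℝ J, ∀ k, (φ k = 0 ∨ φ k q' ≠ 0) ∧ 0 ≤ φ k q * φ k q' := by
  obtain ⟨q₁, hq₁⟩ : ∃ q₁ : J → ℝ, ∀ k : {k // φ k ≠ 0}, φ k q₁ ≠ 0 :=
    Module.Dual.exists_forall_ne_zero_of_forall_exists (K := ℝ) (fun k : {k // φ k ≠ 0} => φ k.1) fun k => by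
      by_contra! h
      exact k.2 (LinearMap.ext h)
  have hlim : ∀ a b c : ℝ, Tendsto (fun ε : ℝ => a + ε * (b + ε * c)) (𝓝[>] 0) (𝓝 a) := by
    intro a b c
    have : Continuous (fun ε : ℝ => a + ε * (b + ε * c)) := by fun_prop
    simpa using (this.tendsto 0).mono_left nhdsWithin_le_nhds
  have hlim' : ∀ b c : ℝ, Tendsto (fun ε : ℝ => b + ε * c) (𝓝[>] 0) (𝓝 b) := by
    intro b c
    have : Continuous (fun ε : ℝ => b + ε * c) := by fun_prop
    simpa using (this.tendsto 0).mono_left nhdsWithin_le_nhds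
  have hpos : ∀ᶠ ε : ℝ in 𝓝[>] 0, ε ∈ Ioi (0 : ℝ) := self_mem_nhdsWithin
  -- along the curve `q + ε u + ε² q₁`, with `u` the all-one vector, each form is a polynomial in `ε`
  have h1 : ∀ᶠ ε : ℝ in 𝓝[>] 0, ∀ k, (φ k = 0 ∨ φ k q + ε * (φ k 1 + ε * φ k q₁) ≠ 0) ∧
      0 ≤ φ k q * (φ k q + ε * (φ k 1 + ε * φ k q₁)) := by
    rw [eventually_all]
    intro k
    refine Eventually.and ?_ ?_
    · by_cases hk : φ k = 0
      · exact Eventually.of_forall fun _ => Or.inl hk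
      have hc := hq₁ ⟨k, hk⟩
      by_cases ha : φ k q = 0
      · by_cases hb : φ k 1 = 0
        · filter_upwards [hpos] with ε hε
          right
          rw [ha, hb, zero_add, zero_add]
          exact mul_ne_zero (ne_of_gt hε) (mul_ne_zero (ne_of_gt hε) hc)
        · filter_upwards [hpos, (hlim' (φ k 1) (φ k q₁)).eventually_ne hb] with ε hε h
          right
          rw [ha, zero_add]
          exact mul_ne_zero (ne_of_gt hε) h
      · exact ((hlim (φ k q) (φ k 1) (φ k q₁)).eventually_ne ha).mono fun ε h => Or.inr h
    · by_cases ha : φ k q = 0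
      · simp [ha]
      · have := (hlim (φ k q) (φ k 1) (φ k q₁)).const_mul (φ k q)
        exact (this.eventually (lt_mem_nhds (mul_self_pos.2 ha))).mono fun _ h => le_of_lt h
  have h2 : ∀ᶠ ε : ℝ in 𝓝[>] 0, ∀ j, 0 < q j + ε * (1 + ε * q₁ j) := by
    rw [eventually_all]
    intro j
    filter_upwards [hpos, (hlim' 1 (q₁ j)).eventually (lt_mem_nhds one_pos)] with ε hε h
    have := mul_pos (mem_Ioi.1 hε) h
    linarith [hq.1 j]
  obtain ⟨ε, hφ, hj⟩ := (h1.and h2).exists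
  have hne : Nonempty J := by
    by_contra h
    rw [not_nonempty_iff] at h
    simpa using hq.2
  set x : J → ℝ := q + ε • ((1 : J → ℝ) + ε • q₁) with hx
  have hxj : ∀ j, 0 < x j := fun j => by simpa [hx, mul_add] using hj j
  have hxφ : ∀ k, φ k x = φ k q + ε * (φ k 1 + ε * φ k q₁) := fun k => by simp [hx, mul_add]
  have hsum : 0 < ∑ j, x j := Finset.sum_pos (fun j _ => hxj j) Finset.univ_nonempty
  refine ⟨(∑ j, x j)⁻¹ • x, ⟨fun j => ?_, ?_⟩, fun k => ?_⟩
  · exact mul_nonneg (inv_nonneg.2 hsum.le) (hxj j).le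
  · simp only [Pi.smul_apply, smul_eq_mul, ← Finset.mul_sum]
    exact inv_mul_cancel₀ hsum.ne'
  · rw [map_smul, smul_eq_mul, hxφ]
    refine ⟨(hφ k).1.imp_right fun h => mul_ne_zero (inv_ne_zero hsum.ne') h, ?_⟩
    rw [mul_left_comm]
    exact mul_nonneg (inv_nonneg.2 hsum.le) (hφ k).2

/-- If `q + ε d` is in the convex hull of the points `g i + ε h i` for all small positive `ε`, then
`q` is in the convex hull of the points `g i`. -/
theorem mem_convexHull_of_perturbation {W ι : Type*} [NormedAddCommGroup W] [NormedSpace ℝ W]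
    [Finite ι] (g h : ι → W) (s : Set ι) (q d : W)
    (H : ∀ ε : ℝ, 0 < ε → ε ≤ 1 → q + ε • d ∈ convexHull ℝ ((fun i => g i + ε • h i) '' s)) :
    q ∈ convexHull ℝ (g '' s) := by
  have hcl : IsClosed (convexHull ℝ (g '' s)) := ((toFinite (g '' s)).isCompact_convexHull ℝ).isClosed
  obtain ⟨C, hC⟩ := ((toFinite (h '' s)).isCompact_convexHull (𝕜 := ℝ)).isBounded.exists_norm_le
  rw [← hcl.closure_eq, Metric.mem_closure_iff]
  intro η hη
  have hD : 0 < ‖d‖ + |C| + 1 := by positivity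
  set ε := min 1 (η / (‖d‖ + |C| + 1) / 2) with hε
  have hε0 : 0 < ε := lt_min one_pos (by positivity)
  have hmem := H ε hε0 (min_le_left _ _)
  have hsub : convexHull ℝ ((fun i => g i + ε • h i) '' s) ⊆
      convexHull ℝ (g '' s) + ε • convexHull ℝ (h '' s) := by
    refine convexHull_min ?_ ((convex_convexHull ℝ _).add ((convex_convexHull ℝ _).smul ε))
    rintro _ ⟨i, hi, rfl⟩
    exact Set.add_mem_add (subset_convexHull ℝ _ ⟨i, hi, rfl⟩)
      (Set.smul_mem_smul_set (subset_convexHull ℝ _ ⟨i, hi, rfl⟩))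
  obtain ⟨y, hy, _, ⟨z, hz, rfl⟩, hyz⟩ := hsub hmem
  refine ⟨y, hy, ?_⟩
  have h1 : q - y = ε • (z - d) := by
    rw [smul_sub]
    have : y + ε • z = q + ε • d := hyz
    rw [eq_sub_iff_add_eq, sub_add_eq_add_sub, sub_eq_iff_eq_add, ← this, add_comm]
  rw [dist_eq_norm, h1, norm_smul, Real.norm_eq_abs, abs_of_pos hε0]
  have h2 : ‖z - d‖ ≤ ‖d‖ + |C| + 1 := by
    have := norm_sub_le z d
    have := hC z hz
    have := le_abs_self C
    linarith
  calc ε * ‖z - d‖ ≤ (η / (‖d‖ + |C| + 1) / 2) * (‖d‖ + |C| + 1) := by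
        gcongr
        exact min_le_right _ _
    _ = η / 2 := by field_simp
    _ < η := by linarith

/-- The fibers of a linear map on the simplex depend on the base point in a piecewise linear way.
The pieces are the images of the cells cut out of the simplex by the coordinates of all sections;
in the interior of a cell a fiber is the hull of a fixed set of sections, and this extends to the
whole cell by continuity. -/
theorem piecewiseLinearOn_fiber [NormedAddCommGroup E] [NormedSpace ℝ E]
    (M : (J → ℝ) →ₗ[ℝ] E) (hs : ∀ v, M v = 0 → ∑ j, v j = 0) :
    PiecewiseLinearOn (fiber M) (M '' stdSimplex ℝ J) := by
  obtain ⟨L, hL1, hL2⟩ := exists_sections M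
  let φ : Set J × J → (J → ℝ) →ₗ[ℝ] ℝ := fun k => LinearMap.proj k.2 ∘ₗ L k.1 ∘ₗ M
  have hφ : ∀ T j q, φ (T, j) q = L T (M q) j := fun T j q => rfl
  let sgn : Set (Set J × J) → (J → ℝ) → Prop := fun s q =>
    ∀ k, (k ∈ s → 0 ≤ φ k q) ∧ (k ∉ s → φ k q ≤ 0)
  let cell : Set (Set J × J) → Set (J → ℝ) := fun s => {q | q ∈ stdSimplex ℝ J ∧ sgn s q}
  have hcell : ∀ s, IsPolytope (cell s) := by
    intro s
    refine IsPolyhedron.isPolytope ?_ ((bounded_stdSimplex J).subset fun q hq => hq.1)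
    refine (isPolyhedron_stdSimplex J).inter (isPolyhedron_setOf_forall fun k => ?_)
    refine IsPolyhedron.inter (isPolyhedron_setOf_imp ?_) (isPolyhedron_setOf_imp ?_)
    · exact isPolyhedron_halfSpace (φ k).toAffineMap
    · simpa using isPolyhedron_halfSpace (-(φ k)).toAffineMap
  let good : Set (Set (Set J × J)) := {s | ∃ q' ∈ cell s, ∀ k, φ k = 0 ∨ φ k q' ≠ 0}
  refine ⟨(fun s => M '' cell s) '' good, toFinite _, ?_, ?_, ?_⟩
  · rintro _ ⟨s, -, rfl⟩
    exact (hcell s).image M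
  · refine Subset.antisymm ?_ ?_
    · rintro w ⟨_, ⟨s, -, rfl⟩, q, hq, rfl⟩
      exact ⟨q, hq.1, rfl⟩
    · rintro _ ⟨q, hq, rfl⟩
      obtain ⟨q', hq', h⟩ := exists_mem_stdSimplex_generic φ hq
      refine ⟨_, ⟨{k | 0 < φ k q' ∨ (φ k q' = 0)}, ⟨q', ⟨hq', fun k => ⟨?_, ?_⟩⟩, fun k => (h k).1⟩, rfl⟩,
        q, ⟨hq, fun k => ⟨?_, ?_⟩⟩, rfl⟩
      · rintro (h | h)
        exacts [h.le, h.ge]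
      · intro h
        simp only [mem_ofPred_eq, not_or, not_lt] at h
        exact h.1
      · rintro (h1 | h1)
        · exact nonneg_of_mul_nonneg_left (h k).2 h1
        · rcases (h k).1 with h2 | h2
          · simp [h2]
          · exact absurd h1 h2
      · intro h1
        simp only [mem_ofPred_eq, not_or, not_lt] at h1
        have := lt_of_le_of_ne h1.1 h1.2
        exact nonpos_of_mul_nonneg_left (h k).2 this
  · rintro _ ⟨s, ⟨q', hq', hgen⟩, rfl⟩ _ ⟨q₁, hq₁, rfl⟩ _ ⟨q₂, hq₂, rfl⟩ a b ha hb hab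
    refine Subset.antisymm ?_ ?_
    · intro q hq
      have hM : a • M q₁ + b • M q₂ = M (a • q₁ + b • q₂) := by simp
      rw [hM] at hq
      have hq₁₂ : a • q₁ + b • q₂ ∈ cell s := (hcell s).convex hq₁ hq₂ ha hb hab
      let 𝒞 : Set (Set J) := {T | ∀ j, φ (T, j) = 0 ∨ (T, j) ∈ s}
      have h𝒞 : ∀ T ∈ 𝒞, ∀ x ∈ cell s, L T (M x) ∈ fiber M (M x) := by
        intro T hT x hx
        refine ⟨fun j => ?_, hL1 T x⟩
        rcases hT j with h | h
        · rw [← hφ, h, LinearMap.zero_apply]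
        · exact (hx.2 (T, j)).1 h
      have hhull : q ∈ convexHull ℝ ((fun T => L T (M q)) '' 𝒞) := by
        refine mem_convexHull_of_perturbation (fun T => L T (M q)) (fun T => L T (M q') - L T (M q))
          𝒞 q (q' - q) fun ε hε hε1 => ?_
        have hqε : q + ε • (q' - q) ∈ fiber M (M (q + ε • (q' - q))) := by
          refine ⟨fun j => ?_, rfl⟩
          have h1 := mul_nonneg (sub_nonneg.2 hε1) (hq.1 j)
          have h2 := mul_nonneg hε.le (hq'.1.1 j)
          simp only [Pi.add_apply, Pi.smul_apply, Pi.sub_apply, smul_eq_mul]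
          linarith
        have heq : ∀ T, L T (M (q + ε • (q' - q))) = L T (M q) + ε • (L T (M q') - L T (M q)) := by
          intro T; simp
        refine convexHull_mono ?_ (fiber_subset_convexHull_sections hs hL2 _ hqε)
        rintro _ ⟨T, hT, rfl⟩
        refine ⟨T, fun j => ?_, (heq T).symm⟩
        by_contra! hj
        have h1 := hT j
        rw [heq] at h1
        simp only [Pi.add_apply, Pi.smul_apply, Pi.sub_apply, smul_eq_mul] at h1
        have h2 : L T (M q') j < 0 := by
          have h3 := (hgen (T, j)).resolve_left hj.1
          have h4 := (hq'.2 (T, j)).2 hj.2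
          exact lt_of_le_of_ne h4 h3
        have h5 : L T (M q) j ≤ 0 := by
          rw [hq.2]
          exact (hq₁₂.2 (T, j)).2 hj.2
        nlinarith [mul_nonneg (sub_nonneg.2 hε1) (neg_nonneg.2 h5)]
      refine convexHull_min ?_ (((convex_fiber M (M q₁)).smul a).add
        ((convex_fiber M (M q₂)).smul b)) hhull
      rintro _ ⟨T, hT, rfl⟩
      refine ⟨a • L T (M q₁), Set.smul_mem_smul_set (h𝒞 T hT _ hq₁), b • L T (M q₂),
        Set.smul_mem_smul_set (h𝒞 T hT _ hq₂), ?_⟩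
      simp only [hq.2]
      simp
    · rintro _ ⟨_, ⟨x, hx, rfl⟩, _, ⟨y, hy, rfl⟩, rfl⟩
      refine ⟨fun j => ?_, ?_⟩
      · have := mul_nonneg ha (hx.1 j)
        have := mul_nonneg hb (hy.1 j)
        simp only [Pi.add_apply, Pi.smul_apply, smul_eq_mul]
        linarith
      · simp [hx.2, hy.2]

end Fibers

/-! ### Least-norm selections -/

section Selection

open Set Filter Topology

variable {ι : Type*} [Fintype ι]

/-- The point of `R` of least Euclidean norm. -/
def minNorm (R : Set (ι → ℝ)) : ι → ℝ :=
  Classical.epsilon fun q => q ∈ R ∧ ∀ q' ∈ R, ∑ i, q i ^ 2 ≤ ∑ i, q' i ^ 2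

theorem sum_sq_eq (q q' : ι → ℝ) :
    ∑ i, q' i ^ 2 = ∑ i, q i ^ 2 + 2 * ∑ i, q i * (q' i - q i) + ∑ i, (q' i - q i) ^ 2 := by
  rw [Finset.mul_sum, ← Finset.sum_add_distrib, ← Finset.sum_add_distrib]
  exact Finset.sum_congr rfl fun i _ => by ring

/-- The variational inequality characterises the point of least norm. -/
theorem minNorm_eq {R : Set (ι → ℝ)} {q : ι → ℝ} (hq : q ∈ R)
    (h : ∀ q' ∈ R, 0 ≤ ∑ i, q i * (q' i - q i)) : minNorm R = q := by
  have hmin : ∀ q' ∈ R, ∑ i, q i ^ 2 ≤ ∑ i, q' i ^ 2 := fun q' hq' => by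
    rw [sum_sq_eq q q']
    have := h q' hq'
    have : 0 ≤ ∑ i, (q' i - q i) ^ 2 := Finset.sum_nonneg fun i _ => sq_nonneg _
    linarith
  obtain ⟨h1, h2⟩ : minNorm R ∈ R ∧ ∀ q' ∈ R, ∑ i, minNorm R i ^ 2 ≤ ∑ i, q' i ^ 2 :=
    Classical.epsilon_spec (p := fun q => q ∈ R ∧ ∀ q' ∈ R, ∑ i, q i ^ 2 ≤ ∑ i, q' i ^ 2)
      ⟨q, hq, hmin⟩
  have h3 := h2 q hq
  rw [sum_sq_eq q (minNorm R)] at h3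
  have h4 := h _ h1
  have h5 : ∑ i, (minNorm R i - q i) ^ 2 = 0 :=
    le_antisymm (by linarith) (Finset.sum_nonneg fun i _ => sq_nonneg _)
  rw [Finset.sum_eq_zero_iff_of_nonneg fun i _ => sq_nonneg _] at h5
  ext i
  have := h5 i (Finset.mem_univ i)
  rw [sq_eq_zero_iff] at this
  linarith

/-- The first-order condition at the point of least norm of a convex compact set. -/
theorem exists_variational {R : Set (ι → ℝ)} (hR : IsCompact R) (hc : Convex ℝ R)
    (hne : R.Nonempty) : ∃ q ∈ R, ∀ q' ∈ R, 0 ≤ ∑ i, q i * (q' i - q i) := by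
  obtain ⟨q, hq, hmin⟩ := hR.exists_isMinOn (f := fun q : ι → ℝ => ∑ i, q i ^ 2) hne
    (Continuous.continuousOn (by fun_prop))
  refine ⟨q, hq, fun q' hq' => ?_⟩
  by_contra! ha
  set a := ∑ i, q i * (q' i - q i) with hadef
  set D := ∑ i, (q' i - q i) ^ 2 with hD
  have hD0 : 0 ≤ D := Finset.sum_nonneg fun i _ => sq_nonneg _
  set t := min 1 (-a / (D + 1)) with ht
  have ht0 : 0 < t := lt_min one_pos (div_pos (by linarith) (by linarith))
  have htD : t * D ≤ -a := by
    have h1 : t * (D + 1) ≤ -a := by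
      calc t * (D + 1) ≤ (-a / (D + 1)) * (D + 1) := by
            gcongr
            exact min_le_right _ _
        _ = -a := by field_simp
    linarith
  have hmem : q + t • (q' - q) ∈ R := by
    have := hc hq hq' (sub_nonneg.2 (min_le_left 1 (-a / (D + 1)))) ht0.le (by ring)
    convert this using 1
    module
  have h1 : ∑ i, q i ^ 2 ≤ ∑ i, (q + t • (q' - q)) i ^ 2 := hmin hmem
  rw [sum_sq_eq q (q + t • (q' - q))] at h1
  have h2 : ∑ i, q i * ((q + t • (q' - q)) i - q i) = t * a := by
    rw [hadef, Finset.mul_sum]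
    exact Finset.sum_congr rfl fun i _ => by simp; ring
  have h3 : ∑ i, ((q + t • (q' - q)) i - q i) ^ 2 = t ^ 2 * D := by
    rw [hD, Finset.mul_sum]
    exact Finset.sum_congr rfl fun i _ => by simp; ring
  rw [h2, h3] at h1
  have h4 : t * (t * D) ≤ t * (-a) := mul_le_mul_of_nonneg_left htD ht0.le
  have h5 : t * a < 0 := mul_neg_of_pos_of_neg ht0 ha
  nlinarith

variable {E : Type*} [NormedAddCommGroup E] [NormedSpace ℝ E]

/-- The points of the simplex carried by `S` that `M` maps to `w`. -/
def faceFiber (M : (ι → ℝ) →ₗ[ℝ] E) (S : Set ι) (w : E) : Set (ι → ℝ) :=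
  {q | q ∈ stdSimplex ℝ ι ∧ (∀ i, i ∉ S → q i = 0) ∧ M q = w}

theorem convex_faceFiber (M : (ι → ℝ) →ₗ[ℝ] E) (S : Set ι) (w : E) :
    Convex ℝ (faceFiber M S w) := by
  intro x hx y hy a b ha hb hab
  refine ⟨convex_stdSimplex ℝ ι hx.1 hy.1 ha hb hab, fun i hi => ?_, ?_⟩
  · simp [hx.2.1 i hi, hy.2.1 i hi]
  · rw [map_add, map_smul, map_smul, hx.2.2, hy.2.2, ← add_smul, hab, one_smul]

theorem isCompact_faceFiber (M : (ι → ℝ) →ₗ[ℝ] E) (S : Set ι) (w : E) :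
    IsCompact (faceFiber M S w) := by
  have : faceFiber M S w = stdSimplex ℝ ι ∩ ((⋂ i, ⋂ (_ : i ∉ S), {q | q i = 0}) ∩ M ⁻¹' {w}) := by
    ext q; simp [faceFiber]; tauto
  rw [this]
  refine (isCompact_stdSimplex ℝ ι).inter_right (IsClosed.inter ?_ ?_)
  · exact isClosed_iInter fun i => isClosed_iInter fun _ =>
      isClosed_eq (continuous_apply i) continuous_const
  · exact isClosed_singleton.preimage M.continuous_of_finiteDimensional

omit [Fintype ι] in
theorem isPolyhedron_coord_eq_zero (i : ι) : IsPolyhedron {v : ι → ℝ | v i = 0} :=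
  isPolyhedron_eq_zero (LinearMap.proj (R := ℝ) (φ := fun _ : ι => ℝ) i).toAffineMap

omit [Fintype ι] in
theorem isPolyhedron_coord_nonneg (i : ι) : IsPolyhedron {v : ι → ℝ | 0 ≤ v i} :=
  isPolyhedron_halfSpace (LinearMap.proj (R := ℝ) (φ := fun _ : ι => ℝ) i).toAffineMap

/-- The least-norm preimage in a face of the simplex is a piecewise linear function of the base
point. There is one piece for each set `T` of coordinates: the image of the points `q` carried by
`T` that satisfy the optimality condition `0 ≤ ⟪q, v⟫` for the finitely many vertices `v` of the
truncated cone of feasible directions. -/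
theorem piecewiseLinearOn_minNorm [FiniteDimensional ℝ E] (M : (ι → ℝ) →ₗ[ℝ] E) (S : Set ι) :
    PiecewiseLinearOn (fun w => minNorm (faceFiber M S w))
      (M '' {q | q ∈ stdSimplex ℝ ι ∧ ∀ i, i ∉ S → q i = 0}) := by
  let N : Set ι → Set (ι → ℝ) := fun T =>
    {v | v ∈ Icc (-1 : ι → ℝ) 1 ∧ ((∀ i, i ∉ S → v i = 0) ∧ (∀ i, i ∉ T → 0 ≤ v i)) ∧
      M v = 0 ∧ ∑ i, v i = 0}
  have hN : ∀ T, IsPolytope (N T) := by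
    intro T
    refine IsPolyhedron.isPolytope ?_ ((Metric.isBounded_Icc _ _).subset fun v hv => hv.1)
    refine IsPolyhedron.inter ?_ (IsPolyhedron.inter (IsPolyhedron.inter
      (isPolyhedron_setOf_forall fun i => isPolyhedron_setOf_imp (isPolyhedron_coord_eq_zero i))
      (isPolyhedron_setOf_forall fun i => isPolyhedron_setOf_imp (isPolyhedron_coord_nonneg i)))
      (IsPolyhedron.inter ?_ ?_))
    · have : Icc (-1 : ι → ℝ) 1 = {v | ∀ i, 0 ≤ (AffineMap.const ℝ (ι → ℝ) (1 : ℝ) +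
          (LinearMap.proj (R := ℝ) (φ := fun _ : ι => ℝ) i).toAffineMap) v} ∩
          {v | ∀ i, 0 ≤ (AffineMap.const ℝ (ι → ℝ) (1 : ℝ) -
          (LinearMap.proj (R := ℝ) (φ := fun _ : ι => ℝ) i).toAffineMap) v} := by
        ext v
        simp [Pi.le_def, neg_le_iff_add_nonneg']
      rw [this]
      exact (isPolyhedron_setOf_forall fun i => isPolyhedron_halfSpace _).inter
        (isPolyhedron_setOf_forall fun i => isPolyhedron_halfSpace _)
    · exact (isPolyhedron_singleton (0 : E)).preimage M.toAffineMap
    · have := (isPolyhedron_singleton (0 : ℝ)).preimage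
        (∑ i, LinearMap.proj (R := ℝ) (φ := fun _ : ι => ℝ) i).toAffineMap
      have h : {v : ι → ℝ | ∑ i, v i = 0} =
          (∑ i, LinearMap.proj (R := ℝ) (φ := fun _ : ι => ℝ) i).toAffineMap ⁻¹' {0} := by
        ext v
        simp
      rw [← h] at this
      exact this
  choose V hV using hN
  let Λ : Set ι → Set (ι → ℝ) := fun T =>
    {q | q ∈ stdSimplex ℝ ι ∧ ((∀ i, i ∉ S → q i = 0) ∧ (∀ i, i ∉ T → q i = 0)) ∧
      ∀ v : V T, 0 ≤ ∑ i, q i * v.1 i}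
  have hΛ : ∀ T, IsPolytope (Λ T) := by
    intro T
    refine IsPolyhedron.isPolytope ?_ ((bounded_stdSimplex ι).subset fun v hv => hv.1)
    refine (isPolyhedron_stdSimplex ι).inter (IsPolyhedron.inter (IsPolyhedron.inter
      (isPolyhedron_setOf_forall fun i => isPolyhedron_setOf_imp (isPolyhedron_coord_eq_zero i))
      (isPolyhedron_setOf_forall fun i => isPolyhedron_setOf_imp (isPolyhedron_coord_eq_zero i)))
      (isPolyhedron_setOf_forall fun v => ?_))
    have := isPolyhedron_halfSpace
      (∑ i, v.1 i • LinearMap.proj (R := ℝ) (φ := fun _ : ι => ℝ) i).toAffineMap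
    have h : {q : ι → ℝ | 0 ≤ ∑ i, q i * v.1 i} = {q | 0 ≤
        (∑ i, v.1 i • LinearMap.proj (R := ℝ) (φ := fun _ : ι => ℝ) i).toAffineMap q} := by
      ext q
      simp [mul_comm]
    exact h ▸ this
  have hopt : ∀ T, ∀ q ∈ Λ T, ∀ q' ∈ faceFiber M S (M q), 0 ≤ ∑ i, q i * (q' i - q i) := by
    intro T q hq q' hq'
    have hmem : q' - q ∈ N T := by
      refine ⟨⟨fun i => ?_, fun i => ?_⟩, ⟨fun i hi => ?_, fun i hi => ?_⟩, ?_, ?_⟩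
      · have := (mem_Icc_of_mem_stdSimplex hq.1 i).2
        have := (mem_Icc_of_mem_stdSimplex hq'.1 i).1
        simp only [Pi.sub_apply, Pi.neg_apply, Pi.one_apply]
        linarith
      · have := (mem_Icc_of_mem_stdSimplex hq.1 i).1
        have := (mem_Icc_of_mem_stdSimplex hq'.1 i).2
        simp only [Pi.sub_apply, Pi.one_apply]
        linarith
      · simp [hq.2.1.1 i hi, hq'.2.1 i hi]
      · simp [hq.2.1.2 i hi, hq'.1.1 i]
      · rw [map_sub, hq'.2.2, sub_self]
      · simp [Finset.sum_sub_distrib, hq.1.2, hq'.1.2]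
    rw [hV T] at hmem
    have hconv : Convex ℝ {v : ι → ℝ | 0 ≤ ∑ i, q i * v i} := by
      intro x hx y hy a b ha hb hab
      have h1 : ∑ i, q i * (a • x + b • y) i = a * ∑ i, q i * x i + b * ∑ i, q i * y i := by
        rw [Finset.mul_sum, Finset.mul_sum, ← Finset.sum_add_distrib]
        exact Finset.sum_congr rfl fun i _ => by simp; ring
      rw [mem_ofPred_eq, h1]
      exact add_nonneg (mul_nonneg ha hx) (mul_nonneg hb hy)
    exact convexHull_min (fun v hv => hq.2.2 ⟨v, hv⟩) hconv hmem
  have hval : ∀ T, ∀ q ∈ Λ T, minNorm (faceFiber M S (M q)) = q := fun T q hq =>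
    minNorm_eq ⟨hq.1, hq.2.1.1, rfl⟩ (hopt T q hq)
  refine ⟨range fun T => M '' Λ T, toFinite _, ?_, ?_, ?_⟩
  · rintro _ ⟨T, rfl⟩
    exact (hΛ T).image M
  · refine Subset.antisymm ?_ ?_
    · rintro _ ⟨_, ⟨T, rfl⟩, q, hq, rfl⟩
      exact ⟨q, ⟨hq.1, hq.2.1.1⟩, rfl⟩
    · rintro _ ⟨q₀, hq₀, rfl⟩
      obtain ⟨q, hq, hvar⟩ := exists_variational (isCompact_faceFiber M S (M q₀))
        (convex_faceFiber M S (M q₀)) ⟨q₀, hq₀.1, hq₀.2, rfl⟩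
      refine ⟨_, ⟨{i | q i ≠ 0}, rfl⟩, q, ⟨hq.1, ⟨hq.2.1, fun i hi => by simpa using hi⟩, ?_⟩, hq.2.2⟩
      rintro ⟨v, hv⟩
      have hvN : v ∈ N {i | q i ≠ 0} := by
        rw [hV]
        exact subset_convexHull ℝ _ hv
      have key : ∀ᶠ t : ℝ in 𝓝[>] 0, ∀ i, 0 ≤ q i + t * v i := by
        rw [eventually_all]
        intro i
        rcases (hq.1.1 i).eq_or_lt with h | h
        · filter_upwards [self_mem_nhdsWithin] with t ht
          rw [← h, zero_add]
          exact mul_nonneg (le_of_lt ht) (hvN.2.1.2 i (by simp [← h]))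
        · have hc : Tendsto (fun t : ℝ => q i + t * v i) (𝓝[>] 0) (𝓝 (q i)) := by
            have : Continuous (fun t : ℝ => q i + t * v i) := by fun_prop
            simpa using (this.tendsto 0).mono_left nhdsWithin_le_nhds
          exact (hc.eventually (lt_mem_nhds h)).mono fun t ht => le_of_lt ht
      obtain ⟨t, ht, ht0⟩ := (key.and self_mem_nhdsWithin).exists
      have h1 := hvar (q + t • v) ⟨⟨fun i => by simpa using ht i, ?_⟩, fun i hi => ?_, ?_⟩
      · have h2 : ∑ i, q i * ((q + t • v) i - q i) = t * ∑ i, q i * v i := by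
          rw [Finset.mul_sum]
          exact Finset.sum_congr rfl fun i _ => by simp; ring
        rw [h2] at h1
        exact nonneg_of_mul_nonneg_right h1 ht0
      · simp [Finset.sum_add_distrib, ← Finset.mul_sum, hq.1.2, hvN.2.2.2]
      · simp [hq.2.1 i hi, hvN.2.1.1 i hi]
      · rw [map_add, map_smul, hvN.2.2.1, smul_zero, add_zero, hq.2.2]
  · rintro _ ⟨T, rfl⟩ _ ⟨q₁, hq₁, rfl⟩ _ ⟨q₂, hq₂, rfl⟩ a b ha hb hab
    have h1 : a • M q₁ + b • M q₂ = M (a • q₁ + b • q₂) := by simp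
    simp only [h1, hval T q₁ hq₁, hval T q₂ hq₂,
      hval T _ ((hΛ T).convex hq₁ hq₂ ha hb hab)]

end Selection

/-! ### Polyhedral subdivisions and decompositions over their vertices -/

section Subdivision

open Set

variable {E : Type*}

theorem convexHull_eq_image_stdSimplex [AddCommGroup E] [Module ℝ E] (V : Finset E) :
    convexHull ℝ (V : Set E) =
      Fintype.linearCombination ℝ (fun v : V => (v : E)) '' stdSimplex ℝ V := by
  classical
  ext x
  rw [Finset.mem_convexHull']
  constructor
  · rintro ⟨w, h0, h1, h2⟩
    refine ⟨fun v => w v, ⟨fun v => h0 v v.2, ?_⟩, ?_⟩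
    · rw [← h1]
      exact Finset.sum_coe_sort V w
    · rw [Fintype.linearCombination_apply, ← h2, ← Finset.sum_coe_sort V]
  · rintro ⟨q, hq, rfl⟩
    refine ⟨fun x => if h : x ∈ V then q ⟨x, h⟩ else 0, fun y hy => ?_, ?_, ?_⟩
    · simpa [hy] using hq.1 ⟨y, hy⟩
    · rw [← hq.2, ← Finset.sum_coe_sort V]
      simp
    · rw [Fintype.linearCombination_apply, ← Finset.sum_coe_sort V]
      simp

variable [NormedAddCommGroup E] [NormedSpace ℝ E] [FiniteDimensional ℝ E]

/-- A polytope is a finite union of sets defined by finitely many affine inequalities. -/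
theorem IsPolytope.exists_eq_union {P : Set E} (hP : IsPolytope P) :
    ∃ 𝒬 : Set (Set (E →ᵃ[ℝ] ℝ)), 𝒬.Finite ∧ (∀ κ ∈ 𝒬, κ.Finite) ∧
      ∀ x, x ∈ P ↔ ∃ κ ∈ 𝒬, ∀ f ∈ κ, 0 ≤ f x := by
  classical
  obtain ⟨V, rfl⟩ := hP
  let M : (V → ℝ) →ₗ[ℝ] E × ℝ := (Fintype.linearCombination ℝ (fun v : V => (v : E))).prod
    (∑ v, LinearMap.proj v)
  have hM : ∀ q, M q = (Fintype.linearCombination ℝ (fun v : V => (v : E)) q, ∑ v, q v) := by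
    intro q
    simp [M]
  have hs : ∀ q, M q = 0 → ∑ v, q v = 0 := fun q hq => by
    rw [hM] at hq
    exact congrArg Prod.snd hq
  obtain ⟨L, -, hL⟩ := exists_sections M
  have hpoly : ∀ T, IsPolyhedron {x : E | L T (x, 1) ∈ fiber M (x, 1)} := by
    intro T
    have h1 : IsPolyhedron {y : E × ℝ | (∀ v, 0 ≤ L T y v) ∧ M (L T y) - y = 0} :=
      (isPolyhedron_setOf_forall fun v => isPolyhedron_halfSpace
        (LinearMap.proj v ∘ₗ L T).toAffineMap).inter
        ((isPolyhedron_singleton (0 : E × ℝ)).preimage (M ∘ₗ L T - LinearMap.id).toAffineMap)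
    have h2 := h1.preimage ((AffineMap.id ℝ E).prod (AffineMap.const ℝ E (1 : ℝ)))
    convert h2 using 1
    ext x
    simp [fiber, sub_eq_zero]
  choose κ hκ hκeq using hpoly
  refine ⟨range κ, toFinite _, ?_, fun x => ?_⟩
  · rintro _ ⟨T, rfl⟩
    exact hκ T
  have hiff : (∃ κ' ∈ range κ, ∀ f ∈ κ', 0 ≤ f x) ↔ ∃ T, L T (x, 1) ∈ fiber M (x, 1) := by
    simp only [mem_range, exists_exists_eq_and]
    refine exists_congr fun T => ?_
    exact (Set.ext_iff.1 (hκeq T) x).symm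
  rw [hiff, convexHull_eq_image_stdSimplex]
  constructor
  · rintro ⟨q, hq, rfl⟩
    exact exists_section_mem_fiber hs hL ⟨q, hq.1, by rw [hM, hq.2]⟩
  · rintro ⟨T, h0, h1⟩
    rw [hM, Prod.mk.injEq] at h1
    exact ⟨_, ⟨h0, h1.2⟩, h1.1⟩

/-- Given finitely many polytopes, the points of a polytope `X` can be decomposed as convex
combinations of finitely many points in a piecewise linear way, such that every point is decomposed
over elements of each given polytope it belongs to.

The given polytopes are unions of cells of a hyperplane arrangement; the finite set consists of the
vertices of the cells of this arrangement, and a point is decomposed over the vertices of its own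
cell with weights of least Euclidean norm. -/
theorem exists_piecewiseLinear_decomposition {X : Set E} (hX : IsPolytope X) {𝒟 : Set (Set E)}
    (h𝒟 : 𝒟.Finite) (h𝒟' : ∀ P ∈ 𝒟, IsPolytope P) :
    ∃ (B : Finset E) (Φ : E → B → ℝ), (∀ b ∈ B, b ∈ X) ∧ (∀ x ∈ X, Φ x ∈ stdSimplex ℝ B) ∧
      PiecewiseLinearOn Φ X ∧ (∀ x ∈ X, ∑ b : B, Φ x b • (b : E) = x) ∧
      ∀ P ∈ 𝒟, ∀ x ∈ X, x ∈ P → ∀ b, Φ x b ≠ 0 → (b : E) ∈ P := by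
  classical
  -- the affine forms of the arrangement
  obtain ⟨𝓗, h𝓗, hmem⟩ : ∃ 𝓗 : Set (E →ᵃ[ℝ] ℝ), 𝓗.Finite ∧ ∀ P ∈ insert X 𝒟, ∀ x ∈ P, ∀ y,
      (∀ f ∈ 𝓗, 0 ≤ f x → 0 ≤ f y) → y ∈ P := by
    have h : ∀ P : ↥(insert X 𝒟), IsPolytope P.1 := by
      rintro ⟨P, rfl | hP⟩
      exacts [hX, h𝒟' P hP]
    choose 𝒬 h1 h2 h3 using fun P => (h P).exists_eq_union
    have := (h𝒟.insert X).to_subtype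
    refine ⟨⋃ P, ⋃₀ 𝒬 P, finite_iUnion fun P => (h1 P).sUnion (h2 P), ?_⟩
    intro P hP x hx y hxy
    obtain ⟨κ, hκ, hκx⟩ := (h3 ⟨P, hP⟩ x).1 hx
    exact (h3 ⟨P, hP⟩ y).2 ⟨κ, hκ, fun f hf => hxy f (mem_iUnion.2 ⟨⟨P, hP⟩, κ, hκ, hf⟩) (hκx f hf)⟩
  have := h𝓗.to_subtype
  let cell : Set 𝓗 → Set E := fun s =>
    {x | x ∈ X ∧ ∀ h : 𝓗, (h ∈ s → 0 ≤ h.1 x) ∧ (h ∉ s → h.1 x ≤ 0)}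
  have hcell : ∀ s, IsPolytope (cell s) := by
    intro s
    obtain ⟨V, hV⟩ := id hX
    rw [convexHull_eq_image_stdSimplex] at hV
    set M := Fintype.linearCombination ℝ (fun v : V => (v : E))
    have h1 : IsPolytope {q | q ∈ stdSimplex ℝ V ∧
        ∀ h : 𝓗, (h ∈ s → 0 ≤ h.1 (M q)) ∧ (h ∉ s → h.1 (M q) ≤ 0)} := by
      refine IsPolyhedron.isPolytope ?_ ((bounded_stdSimplex V).subset fun v hv => hv.1)
      refine (isPolyhedron_stdSimplex V).inter (isPolyhedron_setOf_forall fun h =>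
        IsPolyhedron.inter (isPolyhedron_setOf_imp ?_) (isPolyhedron_setOf_imp ?_))
      · exact isPolyhedron_halfSpace (h.1.comp M.toAffineMap)
      · simpa using isPolyhedron_halfSpace (-(h.1.comp M.toAffineMap))
    convert h1.image M using 1
    ext x
    constructor
    · rintro ⟨hx, hs⟩
      rw [hV] at hx
      obtain ⟨q, hq, rfl⟩ := hx
      exact ⟨q, ⟨hq, hs⟩, rfl⟩
    · rintro ⟨q, ⟨hq, hs⟩, rfl⟩
      exact ⟨hV ▸ ⟨q, hq, rfl⟩, hs⟩
  have hcover : ∀ x ∈ X, ∃ s, x ∈ cell s := fun x hx =>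
    ⟨{h | 0 ≤ h.1 x}, hx, fun h => ⟨id, fun h' => (not_le.1 h').le⟩⟩
  choose V hV using hcell
  have : Fintype (Set 𝓗) := Fintype.ofFinite _
  let B : Finset E := Finset.univ.biUnion V
  have hVB : ∀ s, ∀ v ∈ V s, v ∈ B := fun s v hv =>
    Finset.mem_biUnion.2 ⟨s, Finset.mem_univ s, hv⟩
  have hVcell : ∀ s, ∀ v ∈ V s, v ∈ cell s := fun s v hv => by
    rw [hV]
    exact subset_convexHull ℝ _ hv
  have hBX : ∀ b ∈ B, b ∈ X := fun b hb => by
    obtain ⟨s, -, hs⟩ := Finset.mem_biUnion.1 hb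
    exact (hVcell s b hs).1
  let M : (B → ℝ) →ₗ[ℝ] E := Fintype.linearCombination ℝ (fun b : B => (b : E))
  have hMapply : ∀ q, M q = ∑ b : B, q b • (b : E) := fun q => rfl
  -- the elements of `B` that belong to the cell of `x`
  let S : E → Set B := fun x => {b | ∀ f ∈ 𝓗, (0 ≤ f x → 0 ≤ f b) ∧ (f x ≤ 0 → f b ≤ 0)}
  have hface : ∀ s, ∀ x ∈ cell s, faceFiber M (S x) x = faceFiber M {b | (b : E) ∈ cell s} x := by
    intro s x hx
    ext q
    refine and_congr_right fun hq => and_congr_left fun hMq => ⟨fun h b hb => h b fun hb' => hb ?_,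
      fun h b hb => by_contra fun hqb => hb fun f hf => ?_⟩
    · exact ⟨hBX b b.2, fun h => ⟨fun hh => (hb' h h.2).1 ((hx.2 h).1 hh),
        fun hh => (hb' h h.2).2 ((hx.2 h).2 hh)⟩⟩
    · have hcellb : ∀ b, q b ≠ 0 → (b : E) ∈ cell s := fun b hb => by_contra fun h' => hb (h b h')
      -- an affine form of constant sign on the cell that vanishes at `x` vanishes at `b`
      have hfx : ∑ b : B, q b * f b = f x := by
        rw [← hMq, hMapply]
        have := Finset.univ.map_affineCombination (fun b : B => (b : E)) q hq.2 f
        rw [Finset.affineCombination_eq_linear_combination _ _ _ hq.2,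
          Finset.affineCombination_eq_linear_combination _ _ _ hq.2] at this
        rw [this]
        rfl
      have hsgn : f x = 0 → f b = 0 := by
        intro h0
        rw [h0] at hfx
        by_cases hfs : (⟨f, hf⟩ : 𝓗) ∈ s
        · have hnn : ∀ b ∈ Finset.univ, 0 ≤ q b * f (b : E) := fun b _ => by
            by_cases hb0 : q b = 0
            · simp [hb0]
            · exact mul_nonneg (hq.1 b) (((hcellb b hb0).2 ⟨f, hf⟩).1 hfs)
          have := (Finset.sum_eq_zero_iff_of_nonneg hnn).1 hfx b (Finset.mem_univ b)
          exact (mul_eq_zero.1 this).resolve_left hqb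
        · have hnn : ∀ b ∈ Finset.univ, q b * f (b : E) ≤ 0 := fun b _ => by
            by_cases hb0 : q b = 0
            · simp [hb0]
            · exact mul_nonpos_of_nonneg_of_nonpos (hq.1 b) (((hcellb b hb0).2 ⟨f, hf⟩).2 hfs)
          have := (Finset.sum_eq_zero_iff_of_nonpos hnn).1 hfx b (Finset.mem_univ b)
          exact (mul_eq_zero.1 this).resolve_left hqb
      have hb1 := (hcellb b hqb).2 ⟨f, hf⟩
      have hx1 := hx.2 ⟨f, hf⟩
      by_cases hfs : (⟨f, hf⟩ : 𝓗) ∈ s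
      · exact ⟨fun _ => hb1.1 hfs, fun h' => (hsgn (le_antisymm h' (hx1.1 hfs))).le⟩
      · exact ⟨fun h' => (hsgn (le_antisymm (hx1.2 hfs) h')).ge, fun _ => hb1.2 hfs⟩
  have himage : ∀ s, cell s = M '' {q | q ∈ stdSimplex ℝ B ∧ ∀ b, b ∉ {b : B | (b : E) ∈ cell s} →
      q b = 0} := by
    intro s
    refine Subset.antisymm ?_ ?_
    · intro x hx
      rw [hV, Finset.mem_convexHull'] at hx
      obtain ⟨w, h0, h1, h2⟩ := hx
      have hsub : V s ⊆ B := hVB s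
      refine ⟨fun b => if (b : E) ∈ V s then w b else 0, ⟨⟨fun b => ?_, ?_⟩, fun b hb => ?_⟩, ?_⟩
      · dsimp only
        split_ifs with hb
        exacts [h0 _ hb, le_rfl]
      · rw [Finset.sum_coe_sort B (fun b => if b ∈ V s then w b else 0), ← h1,
          Finset.sum_ite_mem, Finset.inter_eq_right.2 hsub]
      · exact if_neg fun hb' => hb (hVcell s _ hb')
      · rw [hMapply, ← h2]
        simp only [ite_smul, zero_smul]
        rw [Finset.sum_coe_sort B (fun b => if b ∈ V s then w b • b else 0),
          Finset.sum_ite_mem, Finset.inter_eq_right.2 hsub]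
    · rintro _ ⟨q, ⟨hq, hsupp⟩, rfl⟩
      have hconv : Convex ℝ (cell s) := by
        rw [hV]
        exact convex_convexHull ℝ _
      rw [hMapply, ← Finset.sum_filter_of_ne (p := fun b : B => (b : E) ∈ cell s)]
      · refine hconv.sum_mem (fun b _ => hq.1 b) ?_ fun b hb => (Finset.mem_filter.1 hb).2
        rw [Finset.sum_filter_of_ne, hq.2]
        exact fun b _ hb => by_contra fun h => hb (hsupp b h)
      · exact fun b _ hb => by_contra fun h => hb (by rw [hsupp b h, zero_smul])
  have hΦmem : ∀ x ∈ X, minNorm (faceFiber M (S x) x) ∈ faceFiber M (S x) x := by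
    intro x hx
    obtain ⟨s, hs⟩ := hcover x hx
    have hne : (faceFiber M (S x) x).Nonempty := by
      rw [hface s x hs]
      obtain ⟨q, hq, rfl⟩ := (himage s) ▸ hs
      exact ⟨q, hq.1, hq.2, rfl⟩
    obtain ⟨q, hq, hvar⟩ := exists_variational (isCompact_faceFiber M (S x) x)
      (convex_faceFiber M (S x) x) hne
    rw [minNorm_eq hq hvar]
    exact hq
  refine ⟨B, fun x => minNorm (faceFiber M (S x) x), hBX, fun x hx => (hΦmem x hx).1, ?_,
    fun x hx => (hΦmem x hx).2.2, fun P hP x hx hxP b hb => ?_⟩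
  · choose Ps h1 h2 h3 h4 using fun s => piecewiseLinearOn_minNorm M {b : B | (b : E) ∈ cell s}
    have h3' : ∀ s, ⋃₀ Ps s = cell s := fun s => (h3 s).trans (himage s).symm
    refine ⟨⋃ s, Ps s, finite_iUnion h1, fun P hP => ?_, ?_, fun P hP => ?_⟩
    · obtain ⟨s, hs⟩ := mem_iUnion.1 hP
      exact h2 s P hs
    · rw [sUnion_iUnion]
      simp only [h3']
      exact Subset.antisymm (iUnion_subset fun s x hx => hx.1)
        fun x hx => mem_iUnion.2 (hcover x hx)
    · obtain ⟨s, hs⟩ := mem_iUnion.1 hP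
      have hsub : P ⊆ cell s := fun x hx => h3' s ▸ ⟨P, hs, hx⟩
      intro x hx y hy a b ha hb hab
      simp only [hface s x (hsub hx), hface s y (hsub hy),
        hface s _ (hsub ((h2 s P hs).convex hx hy ha hb hab))]
      exact h4 s P hs x hx y hy a b ha hb hab
  · refine hmem P (mem_insert_of_mem X hP) x hxP b fun f hf hfx => ?_
    by_contra hfb
    exact hb ((hΦmem x hx).2.1 b fun hbS => hfb ((hbS f hf).1 hfx))

end Subdivision

/-! ### Existence of the liftings -/

section Lifts

open Set

/-- Linearity extends from two points to finite convex combinations. The weights are positive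
because the values of `f` may be sets, for which `0 • f x = 0` needs `f x` to be nonempty. -/
theorem IsLinearOn.map_sum {E W ι : Type*} [AddCommGroup E] [Module ℝ E] [AddCommMonoid W]
    [DistribMulAction ℝ W] {f : E → W} {P : Set E} (hf : IsLinearOn f P) (hP : Convex ℝ P)
    (s : Finset ι) (w : ι → ℝ) (z : ι → E) (hw : ∀ i ∈ s, 0 < w i) (h1 : ∑ i ∈ s, w i = 1)
    (hz : ∀ i ∈ s, z i ∈ P) : f (∑ i ∈ s, w i • z i) = ∑ i ∈ s, w i • f (z i) := by
  classical
  induction s using Finset.induction_on generalizing w with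
  | empty => simp at h1
  | insert i t hi ih =>
    rcases t.eq_empty_or_nonempty with rfl | hne
    · simp only [Finset.sum_insert hi, Finset.sum_empty, add_zero] at h1 ⊢
      rw [h1, one_smul, one_smul]
    · have hwt : ∀ j ∈ t, 0 < w j := fun j hj => hw j (Finset.mem_insert_of_mem hj)
      have hr : 0 < ∑ j ∈ t, w j := Finset.sum_pos hwt hne
      set r := ∑ j ∈ t, w j with hrdef
      have hr1 : ∑ j ∈ t, r⁻¹ * w j = 1 := by
        rw [← Finset.mul_sum, ← hrdef, inv_mul_cancel₀ hr.ne']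
      have hzt : ∀ j ∈ t, z j ∈ P := fun j hj => hz j (Finset.mem_insert_of_mem hj)
      have hpos : ∀ j ∈ t, 0 < r⁻¹ * w j := fun j hj => mul_pos (inv_pos.2 hr) (hwt j hj)
      have ih' := ih (fun j => r⁻¹ * w j) hpos hr1 hzt
      have hmem : ∑ j ∈ t, (r⁻¹ * w j) • z j ∈ P :=
        hP.sum_mem (fun j hj => (hpos j hj).le) hr1 hzt
      rw [Finset.sum_insert hi] at h1
      have hlin := hf (z i) (hz i (Finset.mem_insert_self i t)) _ hmem (w i) r
        (hw i (Finset.mem_insert_self i t)).le hr.le h1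
      rw [ih', Finset.smul_sum, Finset.smul_sum] at hlin
      simp only [smul_smul, mul_inv_cancel_left₀ hr.ne'] at hlin
      rw [Finset.sum_insert hi, Finset.sum_insert hi, hlin]

theorem IsLinearOn.map_sum_of_mem_stdSimplex {E W ι : Type*} [Fintype ι] [AddCommGroup E]
    [Module ℝ E] [AddCommMonoid W] [DistribMulAction ℝ W] {f : E → W} {P : Set E}
    (hf : IsLinearOn f P) (hP : Convex ℝ P) {w : ι → ℝ} (hw : w ∈ stdSimplex ℝ ι) (z : ι → E)
    (hz : ∀ i, w i ≠ 0 → z i ∈ P) (h0 : ∀ i, (0 : ℝ) • f (z i) = 0) :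
    f (∑ i, w i • z i) = ∑ i, w i • f (z i) := by
  classical
  have h1 : ∑ i, w i • z i = ∑ i with w i ≠ 0, w i • z i := by
    rw [Finset.sum_filter_of_ne]
    exact fun i _ hi h => hi (by rw [h, zero_smul])
  have h2 : ∑ i, w i • f (z i) = ∑ i with w i ≠ 0, w i • f (z i) := by
    rw [Finset.sum_filter_of_ne]
    exact fun i _ hi h => hi (by rw [h, h0])
  rw [h1, h2]
  refine hf.map_sum hP _ w z (fun i hi => ?_) ?_ fun i hi => hz i (Finset.mem_filter.1 hi).2
  · exact lt_of_le_of_ne (hw.1 i) (Ne.symm (Finset.mem_filter.1 hi).2)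
  · rw [Finset.sum_filter_of_ne, hw.2]
    exact fun i _ hi => hi

variable {I J S : Type*} [Fintype I] [Fintype J] [Fintype S] {d : ℕ} (G : Game I J S d)

namespace Game

/-- The linear extension of `G.signal` to all of `ℝ^J`. -/
def signalLin : (J → ℝ) →ₗ[ℝ] EuclideanSpace ℝ (I × S) where
  toFun := G.signal
  map_add' q q' := by
    ext x
    simp [signal, add_mul, Finset.sum_add_distrib]
  map_smul' c q := by
    ext x
    simp [signal, Finset.mul_sum, mul_assoc]

omit [Fintype I] in
@[simp] theorem signalLin_apply (q : J → ℝ) : G.signalLin q = G.signal q := rfl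

/-- For a fixed mixed action `p`, the payoff as a linear map of the action of the second player. -/
def payoffLin (p : I → ℝ) : (J → ℝ) →ₗ[ℝ] EuclideanSpace ℝ (Fin d) where
  toFun := G.payoff p
  map_add' q q' := by
    simp [payoff, mul_add, add_smul, Finset.sum_add_distrib]
  map_smul' c q := by
    simp only [payoff, Pi.smul_apply, smul_eq_mul, RingHom.id_apply, Finset.smul_sum, smul_smul]
    exact Finset.sum_congr rfl fun i _ => Finset.sum_congr rfl fun j _ => by rw [mul_left_comm]

@[simp] theorem payoffLin_apply (p : I → ℝ) (q : J → ℝ) : G.payoffLin p q = G.payoff p q := rfl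

/-- For a fixed action `q` of the second player, the payoff as a linear map. -/
def payoffLinLeft (q : J → ℝ) : (I → ℝ) →ₗ[ℝ] EuclideanSpace ℝ (Fin d) where
  toFun p := G.payoff p q
  map_add' p p' := by
    simp [payoff, add_mul, add_smul, Finset.sum_add_distrib]
  map_smul' c p := by
    simp only [payoff, Pi.smul_apply, smul_eq_mul, RingHom.id_apply, Finset.smul_sum, smul_smul]
    exact Finset.sum_congr rfl fun i _ => Finset.sum_congr rfl fun j _ => by rw [mul_assoc]

@[simp] theorem payoffLinLeft_apply (p : I → ℝ) (q : J → ℝ) :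
    G.payoffLinLeft q p = G.payoff p q := rfl

omit [Fintype I] in
theorem signalLin_image : G.signalLin '' stdSimplex ℝ J = G.feasible := rfl

omit [Fintype I] in
theorem sum_eq_zero_of_signalLin_eq_zero [Nonempty I] (v : J → ℝ) (hv : G.signalLin v = 0) :
    ∑ j, v j = 0 := by
  obtain ⟨i⟩ := ‹Nonempty I›
  have h : ∑ s, G.signalLin v (i, s) = ∑ j, v j := by
    simp only [signalLin_apply, signal]
    rw [Finset.sum_comm]
    refine Finset.sum_congr rfl fun j _ => ?_
    rw [← Finset.mul_sum, (G.H_mem i j).2, mul_one]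
  rw [← h, hv]
  simp

theorem mbar_eq_image [Nonempty I] (p : I → ℝ) {σ : EuclideanSpace ℝ (I × S)}
    (hσ : σ ∈ G.feasible) : G.mbar p σ = G.payoffLin p '' fiber G.signalLin σ := by
  rw [fiber_eq_of_mem G.sum_eq_zero_of_signalLin_eq_zero (G.signalLin_image ▸ hσ)]
  ext v
  simp [mbar, and_assoc]

theorem mbar_nonempty (p : I → ℝ) {σ : EuclideanSpace ℝ (I × S)} (hσ : σ ∈ G.feasible) :
    (G.mbar p σ).Nonempty := by
  obtain ⟨q, hq, rfl⟩ := hσ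
  exact ⟨_, q, hq, rfl, rfl⟩

theorem convex_mbar (p : I → ℝ) (σ : EuclideanSpace ℝ (I × S)) : Convex ℝ (G.mbar p σ) := by
  rintro _ ⟨q, hq, hσ, rfl⟩ _ ⟨q', hq', hσ', rfl⟩ a b ha hb hab
  refine ⟨a • q + b • q', convex_stdSimplex ℝ J hq hq' ha hb hab, ?_, ?_⟩
  · have := G.signalLin.map_add (a • q) (b • q')
    rw [map_smul, map_smul] at this
    simp only [signalLin_apply, hσ, hσ'] at this
    rw [this, ← add_smul, hab, one_smul]
  · have := (G.payoffLin p).map_add (a • q) (b • q')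
    rw [map_smul, map_smul] at this
    exact this

theorem isPolytope_stdSimplex (ι : Type*) [Fintype ι] : IsPolytope (stdSimplex ℝ ι) :=
  (isPolyhedron_stdSimplex ι).isPolytope (bounded_stdSimplex ι)

omit [Fintype I] in
theorem isPolytope_feasible : IsPolytope G.feasible :=
  (isPolytope_stdSimplex J).image G.signalLin

/-- The piecewise linear structure of the fibers of the signaling map lifts the signals. -/
theorem nonempty_signalLift [Nonempty I] : Nonempty G.SignalLift := by
  obtain ⟨Ps, hfin, hpoly, hcov, hlin⟩ :=
    piecewiseLinearOn_fiber G.signalLin G.sum_eq_zero_of_signalLin_eq_zero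
  obtain ⟨B, Φ, hB, hΦ, hPL, hdec, hsupp⟩ :=
    exists_piecewiseLinear_decomposition G.isPolytope_feasible hfin hpoly
  refine ⟨⟨B, hB, Φ, hΦ, hPL, fun σ hσ τ hτ h => ?_, fun σ hσ p _ => ?_⟩⟩
  · rw [← hdec σ hσ, ← hdec τ hτ, h]
  · obtain ⟨P, hP, hσP⟩ : σ ∈ ⋃₀ Ps := hcov ▸ hσ
    have h := (hlin P hP).map_sum_of_mem_stdSimplex (hpoly P hP).convex (hΦ σ hσ)
      (fun b : B => (b : EuclideanSpace ℝ (I × S))) (hsupp P hP σ hσ hσP) fun b => by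
        obtain ⟨q, hq, hb⟩ := hB b b.2
        exact Set.zero_smul_set ⟨q, hq.1, hb⟩
    rw [hdec σ hσ] at h
    rw [G.mbar_eq_image p hσ, h, Set.image_finsetSum]
    refine Finset.sum_congr rfl fun b _ => ?_
    rw [G.mbar_eq_image p (hB b b.2)]
    exact Set.image_smul_comm _ _ _ fun q => map_smul (G.payoffLin p) _ q

end Game

theorem Game.SignalLift.BiPiecewiseLinear.nonempty_actionLift {G : Game I J S d} {D : G.SignalLift}
    (hD : D.BiPiecewiseLinear) : Nonempty D.ActionLift := by
  choose Ps hfin hpoly hcov hlin using fun b : D.B => hD b b.2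
  obtain ⟨A, Θ, hA, hΘ, hPL, hdec, hsupp⟩ :=
    exists_piecewiseLinear_decomposition (Game.isPolytope_stdSimplex I) (finite_iUnion hfin)
      (fun P hP => by
        obtain ⟨b, hb⟩ := mem_iUnion.1 hP
        exact hpoly b P hb)
  refine ⟨⟨A, hA, Θ, hΘ, hPL, hdec, fun b hb p hp => ?_⟩⟩
  obtain ⟨P, hP, hpP⟩ : p ∈ ⋃₀ Ps ⟨b, hb⟩ := hcov ⟨b, hb⟩ ▸ hp
  have h := (hlin ⟨b, hb⟩ P hP).map_sum_of_mem_stdSimplex (hpoly _ P hP).convex (hΘ p hp)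
    (fun a : A => (a : I → ℝ)) (hsupp P (mem_iUnion.2 ⟨_, hP⟩) p hp hpP)
    fun a => Set.zero_smul_set (G.mbar_nonempty a (D.B_subset b hb))
  rw [hdec p hp] at h
  exact h

end Lifts

/-! ### Approachability of the lifted target set -/

section Approachability

open Set

/-- The minimax theorem for matrix games, in the form of an alternative. -/
theorem exists_forall_le_of_forall_exists_le {A B : Type*} [Fintype A] [Fintype B]
    (hA : (stdSimplex ℝ A).Nonempty) (z : A × B → ℝ) (v : ℝ)
    (h : ∀ y ∈ stdSimplex ℝ B, ∃ x ∈ stdSimplex ℝ A, ∑ c : A × B, z c * (x c.1 * y c.2) ≤ v) :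
    ∃ x ∈ stdSimplex ℝ A, ∀ y ∈ stdSimplex ℝ B, ∑ c : A × B, z c * (x c.1 * y c.2) ≤ v := by
  classical
  let Z : (A → ℝ) →ₗ[ℝ] (B → ℝ) := LinearMap.pi fun b => ∑ a, z (a, b) • LinearMap.proj a
  have hZ : ∀ x b, Z x b = ∑ a, z (a, b) * x a := fun x b => by simp [Z]
  have hsum : ∀ (x : A → ℝ) (y : B → ℝ), ∑ c : A × B, z c * (x c.1 * y c.2) = ∑ b, y b * Z x b := by
    intro x y
    rw [Fintype.sum_prod_type_right]
    refine Finset.sum_congr rfl fun b _ => ?_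
    rw [hZ, Finset.mul_sum]
    exact Finset.sum_congr rfl fun a _ => by ring
  simp only [hsum] at h ⊢
  suffices hx : ∃ x ∈ stdSimplex ℝ A, ∀ b, Z x b ≤ v by
    obtain ⟨x, hx, hb⟩ := hx
    refine ⟨x, hx, fun y hy => ?_⟩
    calc ∑ b, y b * Z x b ≤ ∑ b, y b * v :=
          Finset.sum_le_sum fun b _ => mul_le_mul_of_nonneg_left (hb b) (hy.1 b)
      _ = v := by rw [← Finset.sum_mul, hy.2, one_mul]
  by_contra! hno
  have hdisj : Disjoint (Z '' stdSimplex ℝ A) (Iic (fun _ : B => v)) := by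
    rw [Set.disjoint_left]
    rintro _ ⟨x, hx, rfl⟩ hle
    obtain ⟨b, hb⟩ := hno x hx
    exact absurd (hle b) (not_le.2 hb)
  obtain ⟨f, s, t, hs, hst, ht⟩ := geometric_hahn_banach_compact_closed
    ((convex_stdSimplex ℝ A).linear_image Z)
    ((isCompact_stdSimplex ℝ A).image Z.continuous_of_finiteDimensional) (convex_Iic _)
    isClosed_Iic hdisj
  have hf : ∀ u : B → ℝ, f u = ∑ b, u b * f (Pi.single b 1) := by
    intro u
    conv_lhs => rw [pi_eq_sum_univ' u]
    simp
  set g : B → ℝ := fun b => -f (Pi.single b 1) with hg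
  have hfg : ∀ u : B → ℝ, f u = -∑ b, g b * u b := by
    intro u
    rw [hf, ← Finset.sum_neg_distrib]
    exact Finset.sum_congr rfl fun b _ => by simp [hg, mul_comm]
  have hg0 : ∀ b, 0 ≤ g b := by
    intro b
    by_contra! hneg
    -- move far into the orthant along the negative of the `b`-th axis
    set M := (f (fun _ => v) - t) / (-g b) with hM
    have h0 : t < f (fun _ => v) := ht _ (mem_Iic.2 le_rfl)
    have hMpos : 0 ≤ M := div_nonneg (by linarith) (by linarith)
    have h1 := ht ((fun _ => v) - M • Pi.single b 1) (by
      intro b'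
      have : 0 ≤ (M • Pi.single b (1 : ℝ) : B → ℝ) b' := by
        simp only [Pi.smul_apply, smul_eq_mul]
        refine mul_nonneg hMpos ?_
        rw [Pi.single_apply]
        split_ifs <;> norm_num
      simp only [Pi.sub_apply]
      linarith)
    rw [map_sub, map_smul, smul_eq_mul] at h1
    have h2 : M * f (Pi.single b 1) = f (fun _ => v) - t := by
      have h3 : f (Pi.single b 1) = -g b := by simp [hg]
      have h4 : -g b ≠ 0 := by linarith
      rw [h3, hM, div_mul_cancel₀ _ h4]
    linarith
  have hgpos : 0 < ∑ b, g b := by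
    refine lt_of_le_of_ne (Finset.sum_nonneg fun b _ => hg0 b) fun h0 => ?_
    have hall : ∀ b, g b = 0 := fun b =>
      (Finset.sum_eq_zero_iff_of_nonneg fun b _ => hg0 b).1 h0.symm b (Finset.mem_univ b)
    have hf0 : ∀ u, f u = 0 := fun u => by rw [hfg]; simp [hall]
    obtain ⟨x, hx⟩ := hA
    have h1 := hs _ ⟨x, hx, rfl⟩
    have h2 := ht (fun _ => v) (mem_Iic.2 le_rfl)
    rw [hf0] at h1 h2
    linarith
  obtain ⟨x, hx, hle⟩ := h (fun b => (∑ b, g b)⁻¹ * g b)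
    ⟨fun b => mul_nonneg (inv_nonneg.2 hgpos.le) (hg0 b), by
      rw [← Finset.mul_sum, inv_mul_cancel₀ hgpos.ne']⟩
  have h1 := hs _ ⟨x, hx, rfl⟩
  have h2 := ht (fun _ => v) (mem_Iic.2 le_rfl)
  rw [hfg] at h1 h2
  rw [← Finset.sum_mul] at h2
  simp only [mul_assoc, ← Finset.mul_sum] at hle
  rw [inv_mul_le_iff₀ hgpos] at hle
  linarith

theorem tensor_mem_stdSimplex {A B : Type*} [Fintype A] [Fintype B] {x : A → ℝ} {y : B → ℝ}
    (hx : x ∈ stdSimplex ℝ A) (hy : y ∈ stdSimplex ℝ B) :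
    (fun c => tensor x y c) ∈ stdSimplex ℝ (A × B) := by
  refine ⟨fun c => mul_nonneg (hx.1 _) (hy.1 _), ?_⟩
  simp only [tensor, Fintype.sum_prod_type, ← Finset.mul_sum, hy.2, mul_one, hx.2]

theorem inner_tensor {A B : Type*} [Fintype A] [Fintype B] (z : EuclideanSpace ℝ (A × B))
    (x : A → ℝ) (y : B → ℝ) : inner ℝ z (tensor x y) = ∑ c : A × B, z c * (x c.1 * y c.2) := by
  rw [PiLp.inner_apply]
  exact Finset.sum_congr rfl fun c _ => by simp [tensor, mul_comm]

theorem norm_sub_le_two_of_mem_stdSimplex {ι : Type*} [Fintype ι] {x y : EuclideanSpace ℝ ι}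
    (hx : (fun i => x i) ∈ stdSimplex ℝ ι) (hy : (fun i => y i) ∈ stdSimplex ℝ ι) :
    ‖x - y‖ ≤ 2 := by
  have h : ∀ x : EuclideanSpace ℝ ι, (fun i => x i) ∈ stdSimplex ℝ ι → ‖x‖ ≤ 1 := by
    intro x hx
    rw [EuclideanSpace.norm_eq, Real.sqrt_le_one, ← hx.2]
    refine Finset.sum_le_sum fun i _ => ?_
    have h1 := mem_Icc_of_mem_stdSimplex hx i
    rw [Real.norm_eq_abs, sq_abs]
    nlinarith [h1.1, h1.2]
  have := norm_sub_le x y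
  linarith [h x hx, h y hy]

theorem proj_spec {E : Type*} [NormedAddCommGroup E] [ProperSpace E] {K : Set E} (hK : IsClosed K)
    (hne : K.Nonempty) (x : E) : proj K x ∈ K ∧ dist x (proj K x) = Metric.infDist x K := by
  obtain ⟨c, hc, h⟩ := hK.exists_infDist_eq_dist hne x
  exact Classical.epsilon_spec (p := fun c => c ∈ K ∧ dist x c = Metric.infDist x K) ⟨c, hc, h.symm⟩

/-- The projection onto a convex set defines a separating half-space. -/
theorem inner_proj_le {E : Type*} [NormedAddCommGroup E] [InnerProductSpace ℝ E] [ProperSpace E]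
    {K : Set E} (hK : IsClosed K) (hne : K.Nonempty) (hc : Convex ℝ K) (x : E) {w : E}
    (hw : w ∈ K) : inner ℝ (x - proj K x) w ≤ inner ℝ (x - proj K x) (proj K x) := by
  obtain ⟨h1, h2⟩ := proj_spec hK hne x
  have h3 := (norm_eq_iInf_iff_real_inner_le_zero hc (u := x) h1).1 (by
    rw [← dist_eq_norm, h2, Metric.infDist_eq_iInf]
    simp only [dist_eq_norm]) w hw
  rw [inner_sub_right] at h3
  linarith

variable {I J S : Type*} [Fintype I] [Fintype J] [Fintype S] {d : ℕ} {G : Game I J S d}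
  {D : G.SignalLift}

namespace Game.SignalLift.ActionLift

variable (A : D.ActionLift) (C : Set (EuclideanSpace ℝ (Fin d)))

theorem mem_mlift {μ : EuclideanSpace ℝ (A.A × D.B)} {v : EuclideanSpace ℝ (Fin d)} :
    v ∈ A.mlift μ ↔ ∃ u : A.A × D.B → EuclideanSpace ℝ (Fin d),
      (∀ c, u c ∈ G.mbar c.1 c.2) ∧ ∑ c, μ c • u c = v := by
  rw [mlift, Set.mem_fintype_sum]
  constructor
  · rintro ⟨g, hg, rfl⟩
    choose u hu hug using hg
    exact ⟨u, hu, Finset.sum_congr rfl fun c _ => hug c⟩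
  · rintro ⟨u, hu, rfl⟩
    exact ⟨fun c => μ c • u c, fun c => Set.smul_mem_smul_set (hu c), rfl⟩

theorem mem_liftTarget {μ : EuclideanSpace ℝ (A.A × D.B)} :
    μ ∈ A.liftTarget C ↔ (fun c => μ c) ∈ stdSimplex ℝ (A.A × D.B) ∧
      ∀ u : A.A × D.B → EuclideanSpace ℝ (Fin d), (∀ c, u c ∈ G.mbar c.1 c.2) →
        ∑ c, μ c • u c ∈ C := by
  refine and_congr_right fun _ => ⟨fun h u hu => h ((A.mem_mlift).2 ⟨u, hu, rfl⟩), fun h v hv => ?_⟩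
  obtain ⟨u, hu, rfl⟩ := (A.mem_mlift).1 hv
  exact h u hu

variable {C}

theorem convex_liftTarget (hC : Convex ℝ C) : Convex ℝ (A.liftTarget C) := by
  intro μ hμ ν hν a b ha hb hab
  rw [mem_liftTarget] at hμ hν ⊢
  refine ⟨convex_stdSimplex ℝ _ hμ.1 hν.1 ha hb hab, fun u hu => ?_⟩
  convert hC (hμ.2 u hu) (hν.2 u hu) ha hb hab using 1
  simp [add_smul, Finset.sum_add_distrib, Finset.smul_sum, smul_smul]

theorem isClosed_liftTarget (hC : IsClosed C) : IsClosed (A.liftTarget C) := by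
  have h : A.liftTarget C = {μ | (fun c => μ c) ∈ stdSimplex ℝ (A.A × D.B)} ∩
      ⋂ u : A.A × D.B → EuclideanSpace ℝ (Fin d), ⋂ (_ : ∀ c, u c ∈ G.mbar c.1 c.2),
        {μ | ∑ c, μ c • u c ∈ C} := by
    ext μ
    rw [mem_liftTarget]
    simp
  rw [h]
  refine IsClosed.inter ?_ (isClosed_iInter fun u => isClosed_iInter fun _ => ?_)
  · exact (isClosed_stdSimplex ℝ (A.A × D.B)).preimage (by fun_prop)
  · exact hC.preimage (by fun_prop)

/-- Against every mixture of lifted signals the first player can answer with a lifted action that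
puts the pair in the lifted target set. -/
theorem exists_tensor_mem_liftTarget (hAPM : G.APM C) {y : D.B → ℝ} (hy : y ∈ stdSimplex ℝ D.B) :
    ∃ x ∈ stdSimplex ℝ A.A, tensor x y ∈ A.liftTarget C := by
  have hσ : ∑ b : D.B, y b • (b : EuclideanSpace ℝ (I × S)) ∈ G.feasible :=
    G.isPolytope_feasible.convex.sum_mem (fun b _ => hy.1 b) hy.2 fun b _ => D.B_subset b b.2
  obtain ⟨p, hp, hpC⟩ := hAPM _ hσ
  refine ⟨A.Θ p, A.Θ_mem p hp, ?_⟩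
  rw [mem_liftTarget]
  refine ⟨tensor_mem_stdSimplex (A.Θ_mem p hp) hy, fun u hu => hpC ?_⟩
  have hb : ∀ b : D.B, ∃ q ∈ stdSimplex ℝ J, G.signal q = b ∧
      G.payoff p q = ∑ a : A.A, A.Θ p a • u (a, b) := by
    intro b
    have : ∑ a : A.A, A.Θ p a • u (a, b) ∈ G.mbar p b := by
      rw [A.mbar_eq b b.2 p hp, Set.mem_fintype_sum]
      exact ⟨_, fun a => Set.smul_mem_smul_set (hu (a, b)), rfl⟩
    exact this
  choose q hq hqb hqp using hb
  refine ⟨∑ b, y b • q b, (convex_stdSimplex ℝ J).sum_mem (fun b _ => hy.1 b) hy.2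
    fun b _ => hq b, ?_, ?_⟩
  · have := map_sum G.signalLin (fun b => y b • q b) Finset.univ
    simp only [map_smul, signalLin_apply, hqb] at this
    exact this
  · have := map_sum (G.payoffLin p) (fun b => y b • q b) Finset.univ
    simp only [map_smul, payoffLin_apply, hqp] at this
    rw [this, Fintype.sum_prod_type_right]
    refine Finset.sum_congr rfl fun b _ => ?_
    rw [Finset.smul_sum]
    exact Finset.sum_congr rfl fun a _ => by simp [tensor, smul_smul, mul_comm]

theorem nonempty_B [Nonempty J] (D : G.SignalLift) : (stdSimplex ℝ D.B).Nonempty := by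
  classical
  obtain ⟨j⟩ := ‹Nonempty J›
  exact ⟨_, D.Φ_mem _ ⟨_, single_mem_stdSimplex ℝ j, rfl⟩⟩

theorem nonempty_A [Nonempty I] : (stdSimplex ℝ A.A).Nonempty := by
  classical
  obtain ⟨i⟩ := ‹Nonempty I›
  exact ⟨_, A.Θ_mem _ (single_mem_stdSimplex ℝ i)⟩

theorem liftTarget_nonempty [Nonempty J] (hAPM : G.APM C) : (A.liftTarget C).Nonempty := by
  obtain ⟨y, hy⟩ := nonempty_B D
  obtain ⟨x, -, h⟩ := A.exists_tensor_mem_liftTarget hAPM hy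
  exact ⟨_, h⟩

/-- The minimax problems have solutions: the inner maximum is a continuous function of `x` on a
compact simplex. -/
theorem nonempty_innerStrategy [Nonempty I] : Nonempty (A.InnerStrategy C) := by
  have h : ∀ z : EuclideanSpace ℝ (A.A × D.B), ∃ x ∈ stdSimplex ℝ A.A,
      IsMinOn (fun x : A.A → ℝ => ⨆ y : stdSimplex ℝ D.B, inner ℝ z (tensor x y.1))
        (stdSimplex ℝ A.A) x := by
    intro z
    refine (isCompact_stdSimplex ℝ A.A).exists_isMinOn A.nonempty_A (Continuous.continuousOn ?_)
    have h1 := (isCompact_stdSimplex ℝ D.B).continuous_sSup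
      (f := fun (x : A.A → ℝ) (y : D.B → ℝ) => inner ℝ z (tensor x y)) (by
        simp only [inner_tensor]
        unfold Function.HasUncurry.uncurry
        simp only [Function.hasUncurryInduction]
        fun_prop)
    simpa only [sSup_image'] using h1
  choose f hf hmin using h
  exact ⟨⟨fun h => f (polyAverage h - proj (A.liftTarget C) (polyAverage h)), fun h => hf _,
    fun h _ _ => hmin _⟩⟩

/-- The choice of the inner strategy satisfies Blackwell's condition. -/
theorem InnerStrategy.inner_tensor_le [Nonempty I] [Nonempty J] {A : D.ActionLift} (hC : IsClosed C)
    (hc : Convex ℝ C) (hAPM : G.APM C) (Ψ : A.InnerStrategy C) {h : List ((A.A → ℝ) × (D.B → ℝ))}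
    (hne : h ≠ []) (hmem : ∀ z ∈ h, z.1 ∈ stdSimplex ℝ A.A ∧ z.2 ∈ stdSimplex ℝ D.B)
    {y : D.B → ℝ} (hy : y ∈ stdSimplex ℝ D.B) :
    inner ℝ (polyAverage h - proj (A.liftTarget C) (polyAverage h)) (tensor (Ψ.next h) y) ≤
      inner ℝ (polyAverage h - proj (A.liftTarget C) (polyAverage h))
        (proj (A.liftTarget C) (polyAverage h)) := by
  set c := proj (A.liftTarget C) (polyAverage h)
  set z := polyAverage h - c with hz
  obtain ⟨x, hx, hxy⟩ := exists_forall_le_of_forall_exists_le A.nonempty_A z (inner ℝ z c) fun y hy => by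
    obtain ⟨x, hx, hxy⟩ := A.exists_tensor_mem_liftTarget hAPM hy
    refine ⟨x, hx, ?_⟩
    rw [← inner_tensor]
    exact inner_proj_le (A.isClosed_liftTarget hC) (A.liftTarget_nonempty hAPM)
      (A.convex_liftTarget hc) _ hxy
  have hne' : Nonempty (stdSimplex ℝ D.B) := ⟨⟨y, hy⟩⟩
  have h1 : (⨆ y : stdSimplex ℝ D.B, inner ℝ z (tensor x y.1)) ≤ inner ℝ z c :=
    ciSup_le fun y => by
      rw [inner_tensor]
      exact hxy y y.2
  have h2 := Ψ.minimax h hne hmem hx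
  simp only [mem_ofPred_eq] at h2
  have hbdd : BddAbove (range fun y : stdSimplex ℝ D.B => inner ℝ z (tensor (Ψ.next h) y.1)) := by
    have h3 := ((isCompact_stdSimplex ℝ D.B).image
      (f := fun y => (inner ℝ z (tensor (Ψ.next h) y) : ℝ)) (by
        simp only [inner_tensor]
        fun_prop)).bddAbove
    rwa [image_eq_range] at h3
  exact (le_ciSup hbdd ⟨y, hy⟩).trans (h2.trans h1)

end Game.SignalLift.ActionLift

/-- The weight of the `k`-th stage. -/
def weight (k : ℕ) : ℝ := ((k : ℝ) + 1) ^ alpha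

/-- The total weight of the first `n` stages. -/
def totalWeight (n : ℕ) : ℝ := ∑ k ∈ Finset.range n, weight k

theorem weight_pos (k : ℕ) : 0 < weight k := Real.rpow_pos_of_pos (by positivity) _

theorem totalWeight_pos {n : ℕ} (hn : n ≠ 0) : 0 < totalWeight n :=
  Finset.sum_pos (fun k _ => weight_pos k) (Finset.nonempty_range_iff.2 hn)

/-- The weighted average as a sum over `ℕ`; this remains true for the empty history, whose average is
`0`. -/
theorem totalWeight_smul_polyAverage {A B : Type*} [Fintype A] [Fintype B]
    (h : List ((A → ℝ) × (B → ℝ))) :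
    totalWeight h.length • polyAverage h =
      ∑ k ∈ Finset.range h.length, weight k • tensor (h.getD k 0).1 (h.getD k 0).2 := by
  have h1 : ∑ k : Fin h.length, ((k : ℕ) + 1 : ℝ) ^ alpha = totalWeight h.length := by
    rw [totalWeight, Finset.sum_range]
    rfl
  have h2 : ∑ k : Fin h.length, ((k : ℕ) + 1 : ℝ) ^ alpha • tensor (h.get k).1 (h.get k).2 =
      ∑ k ∈ Finset.range h.length, weight k • tensor (h.getD k 0).1 (h.getD k 0).2 := by
    rw [Finset.sum_range]
    refine Finset.sum_congr rfl fun k _ => ?_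
    rw [List.getD_eq_getElem _ _ k.2]
    rfl
  rw [polyAverage, h1, h2, smul_smul]
  rcases eq_or_ne h.length 0 with h0 | h0
  · simp [h0]
  · rw [mul_inv_cancel₀ (totalWeight_pos h0).ne', one_smul]

theorem totalWeight_smul_polyAverage_append {A B : Type*} [Fintype A] [Fintype B]
    (h : List ((A → ℝ) × (B → ℝ))) (z : (A → ℝ) × (B → ℝ)) :
    totalWeight (h.length + 1) • polyAverage (h ++ [z]) =
      totalWeight h.length • polyAverage h + weight h.length • tensor z.1 z.2 := by
  have h1 := totalWeight_smul_polyAverage (h ++ [z])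
  rw [List.length_append, List.length_singleton] at h1
  rw [h1, totalWeight_smul_polyAverage, Finset.sum_range_succ]
  congr 1
  · refine Finset.sum_congr rfl fun k hk => ?_
    rw [List.getD_append _ _ _ _ (Finset.mem_range.1 hk)]
  · rw [List.getD_append_right _ _ _ _ le_rfl]
    simp

namespace Game.SignalLift.ActionLift.InnerStrategy

variable {I J S : Type*} [Fintype I] [Fintype J] [Fintype S] {d : ℕ} {G : Game I J S d}
  {D : G.SignalLift} {A : D.ActionLift} {C : Set (EuclideanSpace ℝ (Fin d))}

/-- Blackwell's argument, with weights: the inner strategy approaches the lifted target set. -/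
theorem sq_totalWeight_mul_infDist_le [Nonempty I] [Nonempty J] (hC : IsClosed C)
    (hc : Convex ℝ C) (hAPM : G.APM C) (Ψ : A.InnerStrategy C) {y : ℕ → D.B → ℝ}
    (hy : ∀ n, y n ∈ stdSimplex ℝ D.B) {h : ℕ → List ((A.A → ℝ) × (D.B → ℝ))} (h0 : h 0 = [])
    (hsucc : ∀ n, h (n + 1) = h n ++ [(Ψ.next (h n), y n)]) (n : ℕ) :
    (totalWeight n * Metric.infDist (polyAverage (h n)) (A.liftTarget C)) ^ 2 ≤
      4 * ∑ k ∈ Finset.range n, weight k ^ 2 := by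
  have hlen : ∀ n, (h n).length = n := by
    intro n
    induction n with
    | zero => simp [h0]
    | succ n ih => simp [hsucc, ih]
  have hmem : ∀ n, ∀ z ∈ h n, z.1 ∈ stdSimplex ℝ A.A ∧ z.2 ∈ stdSimplex ℝ D.B := by
    intro n
    induction n with
    | zero => simp [h0]
    | succ n ih =>
      intro z hz
      rw [hsucc, List.mem_append, List.mem_singleton] at hz
      rcases hz with hz | rfl
      exacts [ih z hz, ⟨Ψ.next_mem _, hy n⟩]
  induction n with
  | zero => simp [totalWeight]
  | succ n ih =>
    obtain ⟨hcm, hcd⟩ := proj_spec (A.isClosed_liftTarget hC) (A.liftTarget_nonempty hAPM)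
      (polyAverage (h n))
    set c := proj (A.liftTarget C) (polyAverage (h n)) with hcdef
    set m := polyAverage (h n) with hm
    set z := tensor (Ψ.next (h n)) (y n) with hz
    have hW : 0 ≤ totalWeight n := Finset.sum_nonneg fun k _ => (weight_pos k).le
    have hW1 : totalWeight (n + 1) = totalWeight n + weight n := Finset.sum_range_succ _ _
    have hrec : totalWeight (n + 1) • polyAverage (h (n + 1)) = totalWeight n • m + weight n • z := by
      have := totalWeight_smul_polyAverage_append (h n) (Ψ.next (h n), y n)
      rwa [hlen, ← hsucc] at this
    have hdist : totalWeight (n + 1) * Metric.infDist (polyAverage (h (n + 1))) (A.liftTarget C) ≤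
        ‖totalWeight n • (m - c) + weight n • (z - c)‖ := by
      have h1 : totalWeight n • (m - c) + weight n • (z - c) =
          totalWeight (n + 1) • (polyAverage (h (n + 1)) - c) := by
        rw [smul_sub (totalWeight (n + 1)), hrec, hW1]
        module
      rw [h1, norm_smul, Real.norm_eq_abs, abs_of_pos (totalWeight_pos n.succ_ne_zero)]
      refine mul_le_mul_of_nonneg_left ?_ (totalWeight_pos n.succ_ne_zero).le
      rw [← dist_eq_norm]
      exact Metric.infDist_le_dist_of_mem hcm
    have hinner : totalWeight n * inner ℝ (m - c) (z - c) ≤ 0 := by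
      rcases eq_or_ne n 0 with rfl | hn
      · simp [totalWeight]
      · have hne : h n ≠ [] := fun h' => hn (by rw [← hlen n, h', List.length_nil])
        have h1 := Ψ.inner_tensor_le hC hc hAPM hne (hmem n) (hy n)
        rw [inner_sub_right]
        exact mul_nonpos_of_nonneg_of_nonpos hW (sub_nonpos.2 h1)
    have hzc : ‖z - c‖ ≤ 2 := norm_sub_le_two_of_mem_stdSimplex
      (tensor_mem_stdSimplex (Ψ.next_mem _) (hy n)) ((A.mem_liftTarget C).1 hcm).1
    have hmc : ‖m - c‖ = Metric.infDist m (A.liftTarget C) := by rw [← hcd, dist_eq_norm]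
    calc (totalWeight (n + 1) * Metric.infDist (polyAverage (h (n + 1))) (A.liftTarget C)) ^ 2
        ≤ ‖totalWeight n • (m - c) + weight n • (z - c)‖ ^ 2 :=
          pow_le_pow_left₀ (mul_nonneg (totalWeight_pos n.succ_ne_zero).le Metric.infDist_nonneg)
            hdist 2
      _ = (totalWeight n * ‖m - c‖) ^ 2 + 2 * weight n * (totalWeight n * inner ℝ (m - c) (z - c)) +
            weight n ^ 2 * ‖z - c‖ ^ 2 := by
          rw [norm_add_sq_real, norm_smul, norm_smul, inner_smul_left, inner_smul_right,
            Real.norm_eq_abs, Real.norm_eq_abs, abs_of_nonneg hW, abs_of_pos (weight_pos n)]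
          simp only [conj_trivial]
          ring
      _ ≤ (totalWeight n * ‖m - c‖) ^ 2 + 0 + weight n ^ 2 * 2 ^ 2 := by
          gcongr
          exact mul_nonpos_of_nonneg_of_nonpos (mul_nonneg zero_le_two (weight_pos n).le) hinner
      _ ≤ 4 * ∑ k ∈ Finset.range (n + 1), weight k ^ 2 := by
          rw [hmc, Finset.sum_range_succ]
          linarith

end Game.SignalLift.ActionLift.InnerStrategy

end Approachability

/-! ### Concentration along a play -/

section Concentration

open Set MeasureTheory

theorem integral_comp_finite {Ω K : Type*} [MeasurableSpace Ω] {μ : Measure Ω}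
    [IsProbabilityMeasure μ] [Fintype K] {k : Ω → K} (hk : ∀ c, MeasurableSet {ω | k ω = c})
    (g : K → ℝ) : Integrable (fun ω => g (k ω)) μ ∧
      ∫ ω, g (k ω) ∂μ = ∑ c, μ.real {ω | k ω = c} * g c := by
  classical
  have h1 : (fun ω => g (k ω)) = fun ω => ∑ c, {ω | k ω = c}.indicator (fun _ => g c) ω := by
    ext ω
    simp [Set.indicator_apply]
  have h2 : ∀ c ∈ Finset.univ, Integrable ({ω | k ω = c}.indicator (fun _ => g c)) μ := fun c _ =>
    (integrable_const _).indicator (hk c)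
  rw [h1]
  refine ⟨integrable_finsetSum _ h2, ?_⟩
  rw [integral_finsetSum _ h2]
  exact Finset.sum_congr rfl fun c _ => by rw [integral_indicator_const _ (hk c), smul_eq_mul]

/-- A bounded centred variable with small variance has a subgaussian moment generating function at
small arguments. -/
theorem sum_mul_exp_le {K : Type*} [Fintype K] {w ξ : K → ℝ} (hw : ∀ c, 0 ≤ w c)
    (h1 : ∑ c, w c = 1) (h0 : ∑ c, w c * ξ c = 0) {b v l : ℝ} (hb : ∀ c, |ξ c| ≤ b)
    (hv : ∑ c, w c * ξ c ^ 2 ≤ v) (hl : 0 ≤ l) (hlb : l * b ≤ 1) :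
    ∑ c, w c * Real.exp (l * ξ c) ≤ Real.exp (l ^ 2 * v) := by
  have h2 : ∀ c, Real.exp (l * ξ c) ≤ 1 + l * ξ c + (l * ξ c) ^ 2 := by
    intro c
    have h3 : |l * ξ c| ≤ 1 := by
      rw [abs_mul, abs_of_nonneg hl]
      exact (mul_le_mul_of_nonneg_left (hb c) hl).trans hlb
    have := (abs_le.1 (Real.abs_exp_sub_one_sub_id_le h3)).2
    linarith
  calc ∑ c, w c * Real.exp (l * ξ c) ≤ ∑ c, w c * (1 + l * ξ c + (l * ξ c) ^ 2) :=
        Finset.sum_le_sum fun c _ => mul_le_mul_of_nonneg_left (h2 c) (hw c)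
    _ = ∑ c, w c + l * ∑ c, w c * ξ c + l ^ 2 * ∑ c, w c * ξ c ^ 2 := by
        rw [Finset.mul_sum, Finset.mul_sum, ← Finset.sum_add_distrib, ← Finset.sum_add_distrib]
        exact Finset.sum_congr rfl fun c _ => by ring
    _ ≤ 1 + l ^ 2 * v := by
        rw [h1, h0, mul_zero, add_zero]
        gcongr
    _ ≤ Real.exp (l ^ 2 * v) := by
        have := Real.add_one_le_exp (l ^ 2 * v)
        linarith

variable {I J S : Type*}

/-- The observations of the first player along a path. -/
def observations (x : ℕ → I × J × S) : ℕ → I × S := fun u => ((x u).1, (x u).2.2)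

/-- The function `F` of the path depends only on the rounds before `t`. -/
def DependsBefore {α : Type*} {X : Type*} (t : ℕ) (F : (ℕ → X) → α) : Prop :=
  ∀ x y, (∀ u < t, x u = y u) → F x = F y

theorem DependsBefore.update {α X : Type*} {t : ℕ} {F : (ℕ → X) → α} (hF : DependsBefore t F)
    (x : ℕ → X) (c : X) : F (Function.update x t c) = F x :=
  hF _ _ fun _ hu => Function.update_of_ne hu.ne _ _

/-- The path of a play. -/
def path {Ω : Type*} (act : ℕ → Ω → I) (opp : ℕ → Ω → J) (sig : ℕ → Ω → S) (ω : Ω) :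
    ℕ → I × J × S := fun u => (act u ω, opp u ω, sig u ω)

variable [Fintype I] [Fintype J] [Fintype S] {d : ℕ} {G : Game I J S d}
  {p : ℕ → (ℕ → I × S) → I → ℝ} {Ω : Type*} [MeasurableSpace Ω] {μ : Measure Ω}
  {act : ℕ → Ω → I} {opp : ℕ → Ω → J} {sig : ℕ → Ω → S}

/-- The path made of a finite history, continued by a constant. -/
def extend {X : Type*} (x₀ : X) (t : ℕ) (y : Fin t → X) : ℕ → X :=
  fun u => if h : u < t then y ⟨u, h⟩ else x₀

theorem extend_apply {X : Type*} (x₀ : X) {t : ℕ} (y : Fin t → X) {u : ℕ} (h : u < t) :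
    extend x₀ t y u = y ⟨u, h⟩ := dif_pos h

omit [Fintype I] [Fintype J] in
theorem IsPlay.measurableSet_path (h : IsPlay μ G p act opp sig) (u : ℕ) (c : I × J × S) :
    MeasurableSet {ω | path act opp sig ω u = c} := by
  have : {ω | path act opp sig ω u = c} =
      {ω | act u ω = c.1} ∩ ({ω | opp u ω = c.2.1} ∩ {ω | sig u ω = c.2.2}) := by
    ext ω
    simp [path, Prod.ext_iff]
  rw [this]
  exact (h.measurable_act u _).inter ((h.measurable_opp u _).inter (h.measurable_sig u _))

omit [Fintype I] [Fintype J] in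
theorem IsPlay.measurableSet_history (h : IsPlay μ G p act opp sig) (t : ℕ)
    (y : Fin t → I × J × S) :
    MeasurableSet {ω | (fun u : Fin t => path act opp sig ω u) = y} := by
  have : {ω | (fun u : Fin t => path act opp sig ω u) = y} =
      ⋂ u : Fin t, {ω | path act opp sig ω u = y u} := by
    ext ω
    simp [funext_iff]
  rw [this]
  exact MeasurableSet.iInter fun u => h.measurableSet_path u _

theorem IsPlay.integrable [IsProbabilityMeasure μ] (h : IsPlay μ G p act opp sig)
    (x₀ : I × J × S) {t : ℕ} {F : (ℕ → I × J × S) → ℝ} (hF : DependsBefore t F) :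
    Integrable (fun ω => F (path act opp sig ω)) μ := by
  have h1 := (integral_comp_finite (μ := μ) (h.measurableSet_history t)
    fun y => F (extend x₀ t y)).1
  convert h1 using 2 with ω
  exact hF _ _ fun u hu => (extend_apply x₀ (fun u : Fin t => path act opp sig ω u) hu).symm

/-- One step of the play: if `F` bounds from above the conditional expectation of `F'` given the
past, whatever the action of the second player, then its expectation bounds that of `F'`. -/
theorem IsPlay.integral_succ_le [IsProbabilityMeasure μ] (h : IsPlay μ G p act opp sig)
    (x₀ : I × J × S) {t : ℕ} (hp : DependsBefore t (p t)) {F F' : (ℕ → I × J × S) → ℝ}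
    (hF : DependsBefore t F) (hF' : DependsBefore (t + 1) F')
    (hstep : ∀ x j, ∑ i, ∑ s, p t (observations x) i * G.H i j s *
      F' (Function.update x t (i, j, s)) ≤ F x) :
    ∫ ω, F' (path act opp sig ω) ∂μ ≤ ∫ ω, F (path act opp sig ω) ∂μ := by
  set hist : Ω → Fin t → I × J × S := fun ω u => path act opp sig ω u with hhist
  have hm := h.measurableSet_history t
  have hm1 : ∀ c : (Fin t → I × J × S) × (I × J × S),
      MeasurableSet {ω | (hist ω, path act opp sig ω t) = c} := by
    intro c
    have : {ω | (hist ω, path act opp sig ω t) = c} =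
        {ω | hist ω = c.1} ∩ {ω | path act opp sig ω t = c.2} := by
      ext ω; simp [Prod.ext_iff]
    rw [this]
    exact (hm _).inter (h.measurableSet_path t _)
  have hm2 : ∀ c : (Fin t → I × J × S) × J, MeasurableSet {ω | (hist ω, opp t ω) = c} := by
    intro c
    have : {ω | (hist ω, opp t ω) = c} = {ω | hist ω = c.1} ∩ {ω | opp t ω = c.2} := by
      ext ω; simp [Prod.ext_iff]
    rw [this]
    exact (hm _).inter (h.measurable_opp t _)
  have e1 : ∫ ω, F' (path act opp sig ω) ∂μ = ∑ c : (Fin t → I × J × S) × (I × J × S),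
      μ.real {ω | (hist ω, path act opp sig ω t) = c} *
        F' (Function.update (extend x₀ t c.1) t c.2) := by
    rw [← (integral_comp_finite hm1 fun c => F' (Function.update (extend x₀ t c.1) t c.2)).2]
    refine integral_congr_ae (Filter.Eventually.of_forall fun ω => hF' _ _ fun u hu => ?_)
    rcases Nat.lt_succ_iff_lt_or_eq.1 hu with hu | rfl
    · rw [Function.update_of_ne hu.ne, extend_apply x₀ _ hu]
    · rw [Function.update_self]
  have e2 : ∫ ω, F (path act opp sig ω) ∂μ = ∑ c : (Fin t → I × J × S) × J,
      μ.real {ω | (hist ω, opp t ω) = c} * F (extend x₀ t c.1) := by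
    rw [← (integral_comp_finite hm2 fun c => F (extend x₀ t c.1)).2]
    refine integral_congr_ae (Filter.Eventually.of_forall fun ω => hF _ _ fun u hu => ?_)
    rw [extend_apply x₀ _ hu]
  have hlaw : ∀ (y : Fin t → I × J × S) (i : I) (j : J) (s : S),
      μ.real {ω | (hist ω, path act opp sig ω t) = (y, (i, j, s))} =
        μ.real {ω | (hist ω, opp t ω) = (y, j)} * p t (observations (extend x₀ t y)) i *
          G.H i j s := by
    intro y i j s
    set x := Function.update (extend x₀ t y) t (i, j, s) with hx
    have hxt : x t = (i, j, s) := Function.update_self _ _ _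
    have hxu : ∀ u (hu : u < t), x u = y ⟨u, hu⟩ := fun u hu => by
      rw [hx, Function.update_of_ne hu.ne, extend_apply x₀ y hu]
    have hl := h.law t (fun u => (x u).1) (fun u => (x u).2.1) (fun u => (x u).2.2)
    simp only [hxt] at hl
    have hpp : p t (fun u => ((x u).1, (x u).2.2)) = p t (observations (extend x₀ t y)) :=
      hp _ _ fun u hu => by
        simp only [observations, hxu u hu, extend_apply x₀ y hu]
    have hpast : ∀ ω, (∀ u < t, act u ω = (x u).1 ∧ opp u ω = (x u).2.1 ∧ sig u ω = (x u).2.2) ↔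
        hist ω = y := by
      intro ω
      rw [funext_iff]
      constructor
      · intro hu u
        have := hu u u.2
        rw [hxu u u.2] at this
        simp [hhist, path, this]
      · intro hu u hut
        rw [hxu u hut, ← hu ⟨u, hut⟩]
        simp [hhist, path]
    rw [hpp] at hl
    have s1 : {ω | (hist ω, path act opp sig ω t) = (y, (i, j, s))} =
        {ω | ∀ u ≤ t, act u ω = (x u).1 ∧ opp u ω = (x u).2.1 ∧ sig u ω = (x u).2.2} := by
      ext ω
      simp only [mem_ofPred_eq, Prod.mk.injEq, ← hpast, path]
      constructor
      · rintro ⟨h1, h2⟩ u hu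
        rcases hu.lt_or_eq with hu | rfl
        · exact h1 u hu
        · rw [hxt]; exact h2
      · intro h1
        refine ⟨fun u hu => h1 u hu.le, ?_⟩
        have := h1 t le_rfl
        rwa [hxt] at this
    have s2 : {ω | (hist ω, opp t ω) = (y, j)} =
        {ω | (∀ u < t, act u ω = (x u).1 ∧ opp u ω = (x u).2.1 ∧ sig u ω = (x u).2.2) ∧
          opp t ω = j} := by
      ext ω
      simp only [mem_ofPred_eq, Prod.mk.injEq, ← hpast]
    rw [s1, s2]
    exact hl
  rw [e1, e2, Fintype.sum_prod_type, Fintype.sum_prod_type]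
  refine Finset.sum_le_sum fun y _ => ?_
  have hre : ∀ f : I × J × S → ℝ, ∑ c, f c = ∑ j, ∑ i, ∑ s, f (i, j, s) := by
    intro f
    simp only [Fintype.sum_prod_type]
    exact Finset.sum_comm
  rw [hre]
  refine Finset.sum_le_sum fun j _ => ?_
  refine le_trans (le_of_eq ?_) (mul_le_mul_of_nonneg_left (hstep (extend x₀ t y) j)
    measureReal_nonneg)
  rw [Finset.mul_sum]
  refine Finset.sum_congr rfl fun i _ => ?_
  rw [Finset.mul_sum]
  refine Finset.sum_congr rfl fun s _ => ?_
  rw [hlaw]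
  ring

/-- The conditions under which the variables `X t`, `t ∈ R`, form a martingale difference sequence
with increments bounded by `b` and conditional variances bounded by `v`, whatever the strategy of
the second player. -/
structure IsMartingaleDifference (G : Game I J S d) (p : ℕ → (ℕ → I × S) → I → ℝ)
    (X : ℕ → (ℕ → I × J × S) → ℝ) (R : Finset ℕ) (b v : ℝ) : Prop where
  dependsBefore : ∀ t ∈ R, DependsBefore (t + 1) (X t)
  mean : ∀ t ∈ R, ∀ x j, ∑ i, ∑ s, p t (observations x) i * G.H i j s *
    X t (Function.update x t (i, j, s)) = 0
  abs_le : ∀ t ∈ R, ∀ x, |X t x| ≤ b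
  variance : ∀ t ∈ R, ∀ x j, ∑ i, ∑ s, p t (observations x) i * G.H i j s *
    X t (Function.update x t (i, j, s)) ^ 2 ≤ v

/-- Bernstein's inequality with a free parameter `l`. -/
theorem IsMartingaleDifference.measureReal_le_exp [IsProbabilityMeasure μ]
    {X : ℕ → (ℕ → I × J × S) → ℝ} {R : Finset ℕ} {b v : ℝ}
    (hX : IsMartingaleDifference G p X R b v) (h : IsPlay μ G p act opp sig) (x₀ : I × J × S)
    (hp : ∀ t, DependsBefore t (p t)) (hp' : ∀ t o, p t o ∈ stdSimplex ℝ I) {l : ℝ} (hl : 0 < l)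
    (hlb : l * b ≤ 1) (ε : ℝ) :
    μ.real {ω | R.card * (l * v) + ε / l ≤ ∑ t ∈ R, X t (path act opp sig ω)} ≤ Real.exp (-ε) := by
  let F : ℕ → (ℕ → I × J × S) → ℝ := fun t x =>
    Real.exp (∑ u ∈ R with u < t, (l * X u x - l ^ 2 * v))
  have hF : ∀ t, DependsBefore t (F t) := by
    intro t x y hxy
    have : ∑ u ∈ R with u < t, (l * X u x - l ^ 2 * v) =
        ∑ u ∈ R with u < t, (l * X u y - l ^ 2 * v) := by
      refine Finset.sum_congr rfl fun u hu => ?_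
      obtain ⟨huR, hut⟩ := Finset.mem_filter.1 hu
      rw [hX.dependsBefore u huR x y fun w hw => hxy w (by omega)]
    simp only [F, this]
  have hstep : ∀ t x j, ∑ i, ∑ s, p t (observations x) i * G.H i j s *
      F (t + 1) (Function.update x t (i, j, s)) ≤ F t x := by
    intro t x j
    have hw0 : ∀ c : I × S, 0 ≤ p t (observations x) c.1 * G.H c.1 j c.2 := fun c =>
      mul_nonneg ((hp' t _).1 _) ((G.H_mem _ _).1 _)
    have hw1 : ∑ c : I × S, p t (observations x) c.1 * G.H c.1 j c.2 = 1 := by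
      rw [Fintype.sum_prod_type]
      simp only [← Finset.mul_sum, (G.H_mem _ _).2, mul_one, (hp' t _).2]
    by_cases ht : t ∈ R
    · have hfil : R.filter (· < t + 1) = insert t (R.filter (· < t)) := by
        ext u
        simp only [Finset.mem_filter, Finset.mem_insert]
        constructor
        · rintro ⟨h1, h2⟩
          rcases Nat.lt_succ_iff_lt_or_eq.1 h2 with h2 | h2
          exacts [Or.inr ⟨h1, h2⟩, Or.inl h2]
        · rintro (rfl | ⟨h1, h2⟩)
          exacts [⟨ht, Nat.lt_succ_self _⟩, ⟨h1, by omega⟩]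
      have hFs : ∀ c, F (t + 1) (Function.update x t c) =
          F t x * Real.exp (-(l ^ 2 * v)) * Real.exp (l * X t (Function.update x t c)) := by
        intro c
        have := (hF t).update x c
        rw [← this]
        simp only [F]
        rw [hfil, Finset.sum_insert (by simp), ← Real.exp_add, ← Real.exp_add]
        ring_nf
      have hmgf := sum_mul_exp_le (ξ := fun c : I × S => X t (Function.update x t (c.1, j, c.2)))
        (v := v) hw0 hw1 (by rw [Fintype.sum_prod_type]; exact hX.mean t ht x j) (fun c => hX.abs_le t ht _)
        (by rw [Fintype.sum_prod_type]; exact hX.variance t ht x j) hl.le hlb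
      rw [Fintype.sum_prod_type] at hmgf
      simp only [hFs]
      calc ∑ i, ∑ s, p t (observations x) i * G.H i j s * (F t x * Real.exp (-(l ^ 2 * v)) *
            Real.exp (l * X t (Function.update x t (i, j, s))))
          = F t x * Real.exp (-(l ^ 2 * v)) * ∑ i, ∑ s, p t (observations x) i * G.H i j s *
            Real.exp (l * X t (Function.update x t (i, j, s))) := by
            rw [Finset.mul_sum]
            refine Finset.sum_congr rfl fun i _ => ?_
            rw [Finset.mul_sum]
            exact Finset.sum_congr rfl fun s _ => by ring
        _ ≤ F t x * Real.exp (-(l ^ 2 * v)) * Real.exp (l ^ 2 * v) := by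
            refine mul_le_mul_of_nonneg_left hmgf ?_
            exact mul_nonneg (Real.exp_pos _).le (Real.exp_pos _).le
        _ = F t x := by rw [mul_assoc, ← Real.exp_add, neg_add_cancel, Real.exp_zero, mul_one]
    · have hfil : R.filter (· < t + 1) = R.filter (· < t) := by
        ext u
        simp only [Finset.mem_filter]
        refine and_congr_right fun hu => ?_
        have : u ≠ t := fun h => ht (h ▸ hu)
        omega
      have hFs : ∀ c, F (t + 1) (Function.update x t c) = F t x := by
        intro c
        rw [← (hF t).update x c]
        simp only [F, hfil]
      simp only [hFs]
      rw [Fintype.sum_prod_type] at hw1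
      simp only [← Finset.sum_mul, hw1, one_mul, le_refl]
  have hint : ∀ t, ∫ ω, F t (path act opp sig ω) ∂μ ≤ 1 := by
    intro t
    induction t with
    | zero => simp [F]
    | succ t ih => exact (h.integral_succ_le x₀ (hp t) (hF t) (hF (t + 1)) (hstep t)).trans ih
  obtain ⟨t, ht⟩ : ∃ t, R.filter (· < t) = R :=
    ⟨R.sup id + 1, Finset.filter_true_of_mem fun u hu =>
      Nat.lt_succ_of_le (Finset.le_sup (f := id) hu)⟩
  have hmarkov := mul_meas_ge_le_integral_of_nonneg
    (Filter.Eventually.of_forall fun ω => (Real.exp_pos _).le) (h.integrable x₀ (hF t))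
    (Real.exp ε)
  have hset : {ω | R.card * (l * v) + ε / l ≤ ∑ t ∈ R, X t (path act opp sig ω)} ⊆
      {ω | Real.exp ε ≤ F t (path act opp sig ω)} := by
    intro ω hω
    simp only [mem_ofPred_eq, F, ht, Real.exp_le_exp, Finset.sum_sub_distrib, ← Finset.mul_sum,
      Finset.sum_const, nsmul_eq_mul] at hω ⊢
    have := mul_le_mul_of_nonneg_left hω hl.le
    have h2 : l * (R.card * (l * v) + ε / l) = R.card * (l ^ 2 * v) + ε := by
      field_simp
    linarith
  have hle := (measureReal_mono (μ := μ) hset)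
  have h3 : Real.exp ε * μ.real {ω | Real.exp ε ≤ F t (path act opp sig ω)} ≤ 1 :=
    hmarkov.trans (hint t)
  rw [Real.exp_neg]
  refine hle.trans ?_
  rwa [← one_div, le_div_iff₀' (Real.exp_pos _)]

/-- Bernstein's inequality for the adaptive sums that arise along a play, with deviation probability
`exp (-ε)`. -/
theorem IsMartingaleDifference.bernstein [IsProbabilityMeasure μ]
    {X : ℕ → (ℕ → I × J × S) → ℝ} {R : Finset ℕ} {b v : ℝ}
    (hX : IsMartingaleDifference G p X R b v) (h : IsPlay μ G p act opp sig) (x₀ : I × J × S)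
    (hp : ∀ t, DependsBefore t (p t)) (hp' : ∀ t o, p t o ∈ stdSimplex ℝ I) (hb : 0 < b)
    (hv : 0 < v) (hR : R.Nonempty) {ε : ℝ} (hε : 0 < ε) :
    μ.real {ω | 2 * √(R.card * v * ε) + b * ε ≤ ∑ t ∈ R, X t (path act opp sig ω)} ≤
      Real.exp (-ε) := by
  have hn : 0 < (R.card : ℝ) := by exact_mod_cast hR.card_pos
  set n : ℝ := (R.card : ℝ)
  set q := √(n * v * ε) with hq
  have hq0 : 0 < q := Real.sqrt_pos.2 (by positivity)
  have hqq : q * q = n * v * ε := Real.mul_self_sqrt (by positivity)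
  -- the parameter that balances the two error terms, unless it violates `l * b ≤ 1`
  set l := min (1 / b) (ε / q) with hl
  have hl0 : 0 < l := lt_min (by positivity) (by positivity)
  have hlb : l * b ≤ 1 := by
    calc l * b ≤ 1 / b * b := by gcongr; exact min_le_left _ _
      _ = 1 := by field_simp
  refine le_trans (measureReal_mono ?_) (hX.measureReal_le_exp h x₀ hp hp' hl0 hlb ε)
  intro ω hω
  simp only [mem_ofPred_eq] at hω ⊢
  refine le_trans ?_ hω
  have h1 : n * (l * v) ≤ q := by
    calc n * (l * v) ≤ n * (ε / q * v) := by gcongr; exact min_le_right _ _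
      _ = q * q / q := by rw [hqq]; ring
      _ = q := by field_simp
  have h2 : ε / l ≤ b * ε + q := by
    rcases min_choice (1 / b) (ε / q) with h | h
    · rw [hl, h]
      have : ε / (1 / b) = b * ε := by field_simp
      linarith
    · rw [hl, h]
      have : ε / (ε / q) = q := by field_simp
      have := mul_pos hb hε
      linarith
  linarith

end Concentration

/-! ### Piecewise linear maps are Lipschitz -/

section Lipschitz

open Set Filter Topology

/-- On a polytope, a map that commutes with convex combinations is the restriction of an affine
map. -/
theorem IsLinearOn.exists_eq_linearMap {E W : Type*} [AddCommGroup E] [Module ℝ E]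
    [AddCommGroup W] [Module ℝ W] {f : E → W} {P : Set E} (hf : IsLinearOn f P)
    (hP : IsPolytope P) : ∃ g : E × ℝ →ₗ[ℝ] W, ∀ x ∈ P, f x = g (x, 1) := by
  have hconv := hP.convex
  obtain ⟨V, hV⟩ := hP
  let M : (V → ℝ) →ₗ[ℝ] E := Fintype.linearCombination ℝ (fun v : V => (v : E))
  let M' : (V → ℝ) →ₗ[ℝ] E × ℝ := M.prod (∑ v, LinearMap.proj v)
  have hM' : ∀ q, M' q = (M q, ∑ v, q v) := fun q => by simp [M']
  let g : (V → ℝ) →ₗ[ℝ] W := Fintype.linearCombination ℝ (fun v : V => f v)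
  have hfg : ∀ q ∈ stdSimplex ℝ V, f (M q) = g q := fun q hq =>
    hf.map_sum_of_mem_stdSimplex hconv hq (fun v : V => (v : E))
      (fun v _ => hV ▸ subset_convexHull ℝ _ v.2) fun v => zero_smul ℝ _
  have hker : ∀ v, M' v = 0 → g v = 0 := by
    intro v hv
    rw [hM', Prod.mk_eq_zero] at hv
    obtain ⟨h1, h2⟩ := hv
    have hdec : v = v⁺ - v⁻ := (posPart_sub_negPart v).symm
    have hp : ∀ i, 0 ≤ v⁺ i := fun i => by rw [Pi.posPart_apply]; exact posPart_nonneg _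
    have hn : ∀ i, 0 ≤ v⁻ i := fun i => by rw [Pi.negPart_apply]; exact negPart_nonneg _
    have hsum : ∑ i, v⁺ i = ∑ i, v⁻ i := by
      rw [hdec] at h2
      simp only [Pi.sub_apply, Finset.sum_sub_distrib] at h2
      linarith
    rcases (Finset.sum_nonneg fun i _ => hp i).eq_or_lt with h0 | h0
    · have hp0 : v⁺ = 0 := by
        ext i
        exact (Finset.sum_eq_zero_iff_of_nonneg fun i _ => hp i).1 h0.symm i (Finset.mem_univ i)
      have hn0 : v⁻ = 0 := by
        ext i
        exact (Finset.sum_eq_zero_iff_of_nonneg fun i _ => hn i).1 (h0.trans hsum).symm i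
          (Finset.mem_univ i)
      rw [hdec, hp0, hn0, sub_zero, map_zero]
    · set s := ∑ i, v⁺ i with hs
      have hmem : ∀ u : V → ℝ, (∀ i, 0 ≤ u i) → ∑ i, u i = s → s⁻¹ • u ∈ stdSimplex ℝ V := by
        intro u hu hus
        refine ⟨fun i => mul_nonneg (inv_nonneg.2 h0.le) (hu i), ?_⟩
        simp only [Pi.smul_apply, smul_eq_mul, ← Finset.mul_sum, hus]
        exact inv_mul_cancel₀ h0.ne'
      have e1 := hfg _ (hmem _ hp rfl)
      have e2 := hfg _ (hmem _ hn hsum.symm)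
      have hMeq : M v⁺ = M v⁻ := by
        rw [hdec, map_sub] at h1
        exact sub_eq_zero.1 h1
      rw [map_smul, map_smul] at e1 e2
      rw [hMeq, e2] at e1
      have e3 := smul_right_injective W (inv_ne_zero h0.ne') e1
      rw [hdec, map_sub, e3, sub_self]
  obtain ⟨L, hL, -⟩ := exists_generalizedInverse M' ⊥
  refine ⟨g ∘ₗ L, fun x hx => ?_⟩
  rw [hV, convexHull_eq_image_stdSimplex] at hx
  obtain ⟨q, hq, rfl⟩ := hx
  have h1 : M' q = (M q, 1) := by rw [hM', hq.2]
  have h2 : M' (L (M' q) - q) = 0 := by rw [map_sub, hL, sub_self]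
  have h3 := hker _ h2
  rw [map_sub, sub_eq_zero, h1] at h3
  rw [LinearMap.comp_apply]
  exact (hfg q hq).trans h3.symm

/-- A piecewise linear map on a convex set is Lipschitz: this holds on each piece, and a segment is
a finite union of closed parts that lie in a piece. -/
theorem PiecewiseLinearOn.exists_norm_sub_le {E W : Type*} [NormedAddCommGroup E] [NormedSpace ℝ E]
    [FiniteDimensional ℝ E] [NormedAddCommGroup W] [NormedSpace ℝ W] {f : E → W} {X : Set E}
    (hf : PiecewiseLinearOn f X) (hX : Convex ℝ X) :
    ∃ K : ℝ, 0 ≤ K ∧ ∀ x ∈ X, ∀ y ∈ X, ‖f x - f y‖ ≤ K * ‖x - y‖ := by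
  obtain ⟨Ps, hfin, hpoly, hcov, hlin⟩ := hf
  choose! g hg using fun P (hP : P ∈ Ps) => (hlin P hP).exists_eq_linearMap (hpoly P hP)
  let c : Set E → E × ℝ →L[ℝ] W := fun P => LinearMap.toContinuousLinearMap (g P)
  obtain ⟨K, hK⟩ := (hfin.image fun P => ‖c P‖).bddAbove
  have hpiece : ∀ P ∈ Ps, ∀ x ∈ P, ∀ y ∈ P, ‖f x - f y‖ ≤ |K| * ‖x - y‖ := by
    intro P hP x hx y hy
    have h1 : f x - f y = c P (x - y, 0) := by
      rw [hg P hP x hx, hg P hP y hy, ← map_sub]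
      simp [c]
    rw [h1]
    refine ((c P).le_opNorm _).trans ?_
    have h2 : ‖((x - y, 0) : E × ℝ)‖ = ‖x - y‖ := by simp
    rw [h2]
    gcongr
    exact (hK ⟨P, hP, rfl⟩).trans (le_abs_self K)
  refine ⟨|K|, abs_nonneg K, fun x hx y hy => ?_⟩
  let z : ℝ → E := fun t => x + t • (y - x)
  have hz : Continuous z := by fun_prop
  have hzX : ∀ t ∈ Icc (0 : ℝ) 1, z t ∈ X := fun t ht => by
    have := hX hx hy (sub_nonneg.2 ht.2) ht.1 (by ring)
    convert this using 1
    simp only [z]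
    module
  have hzz : ∀ t u : ℝ, t ≤ u → ‖z u - z t‖ = (u - t) * ‖y - x‖ := by
    intro t u htu
    have : z u - z t = (u - t) • (y - x) := by simp only [z]; module
    rw [this, norm_smul, Real.norm_eq_abs, abs_of_nonneg (sub_nonneg.2 htu)]
  let s : Set ℝ := {t | ‖f (z t) - f x‖ ≤ |K| * (t * ‖y - x‖)}
  have hclosed : IsClosed (s ∩ Icc 0 1) := by
    have : s ∩ Icc 0 1 = ⋃ P ∈ Ps, ((z ⁻¹' P ∩ {t | ‖c P (z t, 1) - f x‖ ≤ |K| * (t * ‖y - x‖)}) ∩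
        Icc 0 1) := by
      ext t
      simp only [mem_iUnion, exists_prop, mem_inter_iff, mem_preimage]
      constructor
      · rintro ⟨h1, h2⟩
        obtain ⟨P, hP, hzP⟩ : z t ∈ ⋃₀ Ps := hcov ▸ hzX t h2
        refine ⟨P, hP, ⟨hzP, ?_⟩, h2⟩
        have := hg P hP _ hzP
        simp only [mem_ofPred_eq, s] at h1 ⊢
        rwa [this] at h1
      · rintro ⟨P, hP, ⟨hzP, h1⟩, h2⟩
        refine ⟨?_, h2⟩
        have := hg P hP _ hzP
        simp only [mem_ofPred_eq, s] at h1 ⊢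
        rwa [this]
    rw [this]
    refine hfin.isClosed_biUnion fun P hP => IsClosed.inter (IsClosed.inter ?_ ?_) isClosed_Icc
    · exact (hpoly P hP).isCompact.isClosed.preimage hz
    · exact isClosed_le (by fun_prop) (by fun_prop)
  have hsub : Icc (0 : ℝ) 1 ⊆ s := by
    refine hclosed.Icc_subset_of_forall_exists_gt ?_ ?_
    · simp [s, z]
    · intro t ht u hu
      have hev : ∀ᶠ r in 𝓝[>] t, ∀ P ∈ Ps, z t ∉ P → z r ∉ P := by
        rw [hfin.eventually_all]
        intro P hP
        by_cases htP : z t ∈ P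
        · exact Eventually.of_forall fun r h => absurd htP h
        · have hopen : IsOpen (z ⁻¹' Pᶜ) :=
            (hpoly P hP).isCompact.isClosed.isOpen_compl.preimage hz
          filter_upwards [nhdsWithin_le_nhds (hopen.mem_nhds htP)] with r hr _
          exact hr
      have hev2 : ∀ᶠ r in 𝓝[>] t, r ∈ Ioc t (min u 1) :=
        Ioc_mem_nhdsGT (lt_min hu ht.2.2)
      obtain ⟨r, hr1, hr2⟩ := (hev.and hev2).exists
      refine ⟨r, ?_, hr2.1, hr2.2.trans (min_le_left _ _)⟩
      obtain ⟨P, hP, hrP⟩ : z r ∈ ⋃₀ Ps :=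
        hcov ▸ hzX r ⟨ht.2.1.trans hr2.1.le, hr2.2.trans (min_le_right _ _)⟩
      have htP : z t ∈ P := by_contra fun h => hr1 P hP h hrP
      have h1 := hpiece P hP _ hrP _ htP
      rw [hzz t r hr2.1.le] at h1
      have h2 : ‖f (z t) - f x‖ ≤ |K| * (t * ‖y - x‖) := ht.1
      have h3 := norm_sub_le_norm_sub_add_norm_sub (f (z r)) (f (z t)) (f x)
      change ‖f (z r) - f x‖ ≤ |K| * (r * ‖y - x‖)
      linarith
  have h1 : ‖f (z 1) - f x‖ ≤ |K| * (1 * ‖y - x‖) := hsub (right_mem_Icc.2 zero_le_one)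
  have hz1 : z 1 = y := by simp [z]
  rw [hz1, one_mul] at h1
  rwa [norm_sub_rev, norm_sub_rev x y]

end Lipschitz

/-! ### Block lengths, exploration rates and weights -/

section Blocks

theorem weight_eq (k : ℕ) : weight k = (k + 1) * √(k + 1) := by
  have h : (0 : ℝ) < k + 1 := by positivity
  rw [weight, alpha, show (3 / 2 : ℝ) = 1 + 1 / 2 by norm_num, Real.rpow_add h, Real.rpow_one,
    Real.sqrt_eq_rpow]

theorem explore_eq (k : ℕ) : explore k = (√(k + 1))⁻¹ := by
  have h : (0 : ℝ) ≤ k + 1 := by positivity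
  rw [explore, alpha, show (-(3 / 2 / 3) : ℝ) = -(1 / 2) by norm_num, Real.rpow_neg h,
    Real.sqrt_eq_rpow]

theorem one_le_sqrt_succ (k : ℕ) : 1 ≤ √((k : ℝ) + 1) := by
  rw [Real.one_le_sqrt]
  have : (0 : ℝ) ≤ k := k.cast_nonneg
  linarith

theorem explore_pos (k : ℕ) : 0 < explore k := by
  rw [explore_eq]
  have := one_le_sqrt_succ k
  positivity

theorem explore_le_one (k : ℕ) : explore k ≤ 1 := by
  rw [explore_eq]
  exact inv_le_one_of_one_le₀ (one_le_sqrt_succ k)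

theorem one_le_weight (k : ℕ) : 1 ≤ weight k := by
  rw [weight_eq]
  have h : (0 : ℝ) ≤ k := k.cast_nonneg
  nlinarith [one_le_sqrt_succ k]

theorem weight_le_blockLen (k : ℕ) : weight k ≤ blockLen k := Nat.le_ceil _

theorem blockLen_le (k : ℕ) : (blockLen k : ℝ) ≤ weight k + 1 :=
  (Nat.ceil_lt_add_one (weight_pos k).le).le

theorem blockLen_pos (k : ℕ) : 0 < blockLen k := Nat.ceil_pos.2 (weight_pos k)

theorem blockStart_succ (n : ℕ) : blockStart (n + 1) = blockStart n + blockLen n :=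
  Finset.sum_range_succ _ _

theorem strictMono_blockStart : StrictMono blockStart :=
  strictMono_nat_of_lt_succ fun n => by
    rw [blockStart_succ]
    have := blockLen_pos n
    omega

theorem totalWeight_le_blockStart (n : ℕ) : totalWeight n ≤ blockStart n := by
  rw [blockStart, Nat.cast_sum]
  exact Finset.sum_le_sum fun k _ => weight_le_blockLen k

theorem blockStart_le (n : ℕ) : (blockStart n : ℝ) ≤ totalWeight n + n := by
  have h : totalWeight n + n = ∑ k ∈ Finset.range n, (weight k + 1) := by
    rw [Finset.sum_add_distrib]
    simp [totalWeight]
  rw [h, blockStart, Nat.cast_sum]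
  exact Finset.sum_le_sum fun k _ => blockLen_le k

theorem weight_le_of_lt {k n : ℕ} (h : k < n) : weight k ≤ n * √n := by
  rw [weight_eq]
  have h1 : (k : ℝ) + 1 ≤ n := by exact_mod_cast h
  gcongr

theorem totalWeight_le (n : ℕ) : totalWeight n ≤ n ^ 2 * √n := by
  have := Finset.sum_le_card_nsmul (Finset.range n) weight (n * √n)
    fun k hk => weight_le_of_lt (Finset.mem_range.1 hk)
  rw [Finset.card_range, nsmul_eq_mul] at this
  refine this.trans (le_of_eq (by ring))

theorem sum_sq_weight_le (n : ℕ) : ∑ k ∈ Finset.range n, weight k ^ 2 ≤ ((n : ℝ) ^ 2) ^ 2 := by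
  have h : ∀ k ∈ Finset.range n, weight k ^ 2 ≤ (n : ℝ) ^ 3 := by
    intro k hk
    have h1 := pow_le_pow_left₀ (weight_pos k).le (weight_le_of_lt (Finset.mem_range.1 hk)) 2
    rw [mul_pow, Real.sq_sqrt n.cast_nonneg] at h1
    linarith
  have := Finset.sum_le_card_nsmul (Finset.range n) (fun k => weight k ^ 2) _ h
  rw [Finset.card_range, nsmul_eq_mul] at this
  refine this.trans (le_of_eq (by ring))

/-- Lower bound on the total weight, by comparison of `x ^ (3/2)` with the increments of
`x ^ (5/2)`. -/
theorem le_totalWeight (n : ℕ) : 2 / 5 * (n ^ 2 * √n) ≤ totalWeight n := by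
  induction n with
  | zero => simp [totalWeight]
  | succ n ih =>
    have hsucc : totalWeight (n + 1) = totalWeight n + weight n := Finset.sum_range_succ _ _
    rw [hsucc, weight_eq]
    push_cast
    set a := √(n : ℝ) with ha
    set b := √((n : ℝ) + 1) with hb
    have ha0 : 0 ≤ a := Real.sqrt_nonneg _
    have hb1 : 1 ≤ b := one_le_sqrt_succ n
    have ha2 : a ^ 2 = n := Real.sq_sqrt n.cast_nonneg
    have hb2 : b ^ 2 = n + 1 := Real.sq_sqrt (by positivity)
    have hab : a ≤ b := Real.sqrt_le_sqrt (by linarith)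
    -- `b - a = 1 / (a + b)`, so that `b ^ 5 - a ^ 5 ≤ 5 / 2 * b ^ 3`
    have h1 : b ^ 5 - a ^ 5 ≤ 5 / 2 * b ^ 3 := by
      have h2 : b ^ 2 - a ^ 2 = 1 := by rw [ha2, hb2]; ring
      have h3 : (b - a) * (a + b) = 1 := by linarith
      have h4 : 0 < a + b := by linarith
      have h6 : 5 / 2 * b ^ 3 * (a + b) - (b ^ 4 + b ^ 3 * a + b ^ 2 * a ^ 2 + b * a ^ 3 + a ^ 4) =
          (b - a) * (3 / 2 * b ^ 3 + 3 * b ^ 2 * a + 2 * b * a ^ 2 + a ^ 3) := by ring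
      have h7 : 0 ≤ (b - a) * (3 / 2 * b ^ 3 + 3 * b ^ 2 * a + 2 * b * a ^ 2 + a ^ 3) :=
        mul_nonneg (by linarith) (by positivity)
      have h8 : b ^ 5 - a ^ 5 = (b - a) * (b ^ 4 + b ^ 3 * a + b ^ 2 * a ^ 2 + b * a ^ 3 + a ^ 4) := by
        ring
      calc b ^ 5 - a ^ 5 = (b - a) * (b ^ 4 + b ^ 3 * a + b ^ 2 * a ^ 2 + b * a ^ 3 + a ^ 4) := h8
        _ ≤ (b - a) * (5 / 2 * b ^ 3 * (a + b)) :=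
          mul_le_mul_of_nonneg_left (by linarith) (by linarith)
        _ = 5 / 2 * b ^ 3 * ((b - a) * (a + b)) := by ring
        _ = 5 / 2 * b ^ 3 := by rw [h3, mul_one]
    rw [← ha2] at ih
    rw [← hb2]
    nlinarith

theorem blockIndex_eq {n t : ℕ} (h1 : blockStart n ≤ t) (h2 : t < blockStart (n + 1)) :
    blockIndex t = n := by
  rw [blockIndex, Nat.findGreatest_eq_iff]
  refine ⟨(strictMono_blockStart.id_le n).trans h1, fun _ => h1, fun k hk _ hk' => ?_⟩
  have : blockStart (n + 1) ≤ blockStart k := strictMono_blockStart.monotone hk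
  omega

theorem blockStart_blockIndex_le (t : ℕ) : blockStart (blockIndex t) ≤ t :=
  Nat.findGreatest_spec (P := fun n => blockStart n ≤ t) (Nat.zero_le t) (by simp [blockStart])

theorem lt_blockStart_blockIndex_succ (t : ℕ) : t < blockStart (blockIndex t + 1) := by
  by_contra! h
  have h1 : blockIndex t + 1 ≤ t := (strictMono_blockStart.id_le _).trans h
  exact Nat.findGreatest_is_greatest (P := fun n => blockStart n ≤ t) (Nat.lt_succ_self _) h1 h

theorem blockIndex_pos {t : ℕ} (ht : 1 ≤ t) : 1 ≤ blockIndex t := by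
  refine Nat.le_findGreatest ht ?_
  have : blockStart 1 = 1 := by
    simp [blockStart, blockLen]
  simp [this, ht]

theorem blockIndex_le (t : ℕ) : blockIndex t ≤ t := Nat.findGreatest_le t

theorem sum_range_blockStart {M : Type*} [AddCommMonoid M] (g : ℕ → M) (N : ℕ) :
    ∑ t ∈ Finset.range (blockStart N), g t =
      ∑ n ∈ Finset.range N, ∑ t ∈ Finset.Ico (blockStart n) (blockStart (n + 1)), g t := by
  induction N with
  | zero => simp [blockStart]
  | succ N ih =>
    rw [Finset.sum_range_succ, ← ih, Finset.range_eq_Ico, Finset.range_eq_Ico,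
      Finset.sum_Ico_consecutive _ (Nat.zero_le _) (strictMono_blockStart.monotone N.le_succ)]

theorem sqrt_succ_le {N : ℕ} (hN : 1 ≤ N) : √((N : ℝ) + 1) ≤ 3 / 2 * √N := by
  have h : (1 : ℝ) ≤ N := by exact_mod_cast hN
  rw [show (3 / 2 : ℝ) = √((3 / 2) ^ 2) by rw [Real.sqrt_sq (by norm_num)],
    ← Real.sqrt_mul (by positivity)]
  exact Real.sqrt_le_sqrt (by linarith)

/-- The length of the incomplete block is negligible. -/
theorem blockLen_le_of_one_le {N : ℕ} (hN : 1 ≤ N) : (blockLen N : ℝ) ≤ 6 * (N * √N) := by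
  have h : (1 : ℝ) ≤ N := by exact_mod_cast hN
  have h1 := blockLen_le N
  have h2 := one_le_weight N
  have h3 : weight N ≤ 2 * N * (3 / 2 * √N) := by
    rw [weight_eq]
    exact mul_le_mul (by linarith) (sqrt_succ_le hN) (Real.sqrt_nonneg _) (by linarith)
  linarith

theorem le_of_blockIndex {T : ℕ} (hT : 1 ≤ T) :
    2 / 5 * ((blockIndex T : ℝ) ^ 2 * √(blockIndex T)) ≤ T ∧
      (T : ℝ) ≤ 12 * ((blockIndex T : ℝ) ^ 2 * √(blockIndex T)) := by
  set N := blockIndex T with hNdef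
  have hN : 1 ≤ N := blockIndex_pos hT
  have hN1 : (1 : ℝ) ≤ N := by exact_mod_cast hN
  have hsq : 1 ≤ √(N : ℝ) := Real.one_le_sqrt.2 hN1
  constructor
  · refine (le_totalWeight N).trans ((totalWeight_le_blockStart N).trans ?_)
    exact_mod_cast blockStart_blockIndex_le T
  · have h1 : (T : ℝ) ≤ blockStart (N + 1) := by
      exact_mod_cast (lt_blockStart_blockIndex_succ T).le
    rw [blockStart_succ, Nat.cast_add] at h1
    have h2 := blockStart_le N
    have h3 := blockLen_le_of_one_le hN
    have h4 := totalWeight_le N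
    have h5 : (N : ℝ) * √N ≤ (N : ℝ) ^ 2 * √N := by
      gcongr
      nlinarith
    have h6 : (N : ℝ) ≤ N * √N := by nlinarith
    have h7 : (0 : ℝ) ≤ N * √N := by positivity
    linarith

/-- The bounds in terms of the number of blocks, converted into bounds in terms of the number of
rounds. -/
theorem blockIndex_bounds {T : ℕ} (hT : 1 ≤ T) :
    (blockIndex T : ℝ) ^ 2 ≤ 5 * (T * (T : ℝ) ^ (-(1 / 5) : ℝ)) ∧
      (blockIndex T : ℝ) * √(blockIndex T) ≤ 10 * (T * (T : ℝ) ^ (-(2 / 5) : ℝ)) ∧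
      √(T : ℝ) ≤ 4 * (blockIndex T : ℝ) ^ 2 := by
  obtain ⟨h1, h2⟩ := le_of_blockIndex hT
  have hN : (1 : ℝ) ≤ blockIndex T := by exact_mod_cast blockIndex_pos hT
  have hT0 : (0 : ℝ) < T := by exact_mod_cast hT
  set N : ℝ := (blockIndex T : ℝ)
  set a := √N with ha
  have ha1 : 1 ≤ a := Real.one_le_sqrt.2 hN
  have ha2 : a ^ 2 = N := Real.sq_sqrt (by linarith)
  set x := (T : ℝ) ^ (-(1 / 5) : ℝ) with hx
  have hx0 : 0 < x := Real.rpow_pos_of_pos hT0 _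
  have hx2 : (T : ℝ) ^ (-(2 / 5) : ℝ) = x ^ 2 := by
    rw [hx, ← Real.rpow_natCast, ← Real.rpow_mul hT0.le]
    norm_num
  have hx5 : x ^ 5 * T = 1 := by
    rw [hx, ← Real.rpow_natCast, ← Real.rpow_mul hT0.le]
    norm_num
    rw [Real.rpow_neg_one, inv_mul_cancel₀ hT0.ne']
  have h2x : 1 ≤ 2 * x * a := by
    by_contra! h
    have h3 := pow_lt_one₀ (by positivity) h (n := 5) (by norm_num)
    have h4 : (2 * x * a) ^ 5 = 32 * (x ^ 5 * (N ^ 2 * a)) := by rw [← ha2]; ring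
    have h5 : x ^ 5 * T ≤ x ^ 5 * (12 * (N ^ 2 * a)) := by gcongr
    linarith
  have hb1 : N ^ 2 ≤ 5 * (T * x) := by
    calc N ^ 2 = N ^ 2 * 1 := by ring
      _ ≤ N ^ 2 * (2 * x * a) := by gcongr
      _ = 5 * x * (2 / 5 * (N ^ 2 * a)) := by ring
      _ ≤ 5 * x * T := by gcongr
      _ = _ := by ring
  refine ⟨hb1, ?_, ?_⟩
  · rw [hx2]
    calc N * a = N * a * 1 := by ring
      _ ≤ N * a * (2 * x * a) := by gcongr
      _ = 2 * x * N ^ 2 := by rw [← ha2]; ring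
      _ ≤ 2 * x * (5 * (T * x)) := by gcongr
      _ = _ := by ring
  · refine Real.sqrt_le_iff.2 ⟨by positivity, h2.trans ?_⟩
    have : a ≤ N := by nlinarith
    calc 12 * (N ^ 2 * a) ≤ 12 * (N ^ 2 * N ^ 2) := by
          gcongr
          nlinarith
      _ ≤ (4 * N ^ 2) ^ 2 := by nlinarith [sq_nonneg (N ^ 2)]

end Blocks

/-! ### The block strategy -/

section BlockStrategy

variable {I J S : Type*} [Fintype I] [Fintype J] [Fintype S] {d : ℕ} {G : Game I J S d}
  {D : G.SignalLift} {A : D.ActionLift} {C : Set (EuclideanSpace ℝ (Fin d))}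

omit [Fintype I] [Fintype S] in
theorem estimate_congr {n : ℕ} (p : I → ℝ) {o o' : ℕ → I × S}
    (h : ∀ t < blockStart (n + 1), o t = o' t) : estimate n p o = estimate n p o' := by
  unfold estimate
  congr 1
  ext c
  congr 1
  refine Finset.sum_congr rfl fun t ht => ?_
  rw [h t (Finset.mem_Ico.1 ht).2]

namespace Game.SignalLift.ActionLift

/-- The mixed action `∑ a, θ a • a` that underlies a mixture of lifted actions. -/
def barycenter (A : D.ActionLift) (θ : A.A → ℝ) : I → ℝ := ∑ a : A.A, θ a • (a : I → ℝ)

theorem barycenter_mem (A : D.ActionLift) {θ : A.A → ℝ} (hθ : θ ∈ stdSimplex ℝ A.A) :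
    A.barycenter θ ∈ stdSimplex ℝ I :=
  (convex_stdSimplex ℝ I).sum_mem (fun a _ => hθ.1 a) hθ.2 fun a _ => A.A_subset a a.2

/-- The uniform mixed action. -/
def uniform (I : Type*) [Fintype I] : I → ℝ := fun _ => 1 / (Fintype.card I : ℝ)

theorem uniform_mem [Nonempty I] : uniform I ∈ stdSimplex ℝ I := by
  refine ⟨fun i => by unfold uniform; positivity, ?_⟩
  simp [uniform]

theorem blockAction_eq (A : D.ActionLift) (n : ℕ) (θ : A.A → ℝ) :
    A.blockAction n θ = (1 - explore n) • A.barycenter θ + explore n • uniform I := by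
  ext i
  simp [blockAction, barycenter, uniform, Finset.sum_apply]

theorem blockAction_mem [Nonempty I] (A : D.ActionLift) (n : ℕ) {θ : A.A → ℝ}
    (hθ : θ ∈ stdSimplex ℝ A.A) : A.blockAction n θ ∈ stdSimplex ℝ I := by
  rw [blockAction_eq]
  exact convex_stdSimplex ℝ I (A.barycenter_mem hθ) uniform_mem
    (sub_nonneg.2 (explore_le_one n)) (explore_pos n).le (by ring)

/-- Every action is played with a probability bounded from below by the exploration rate. -/
theorem one_div_blockAction_le [Nonempty I] (A : D.ActionLift) (n : ℕ) {θ : A.A → ℝ}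
    (hθ : θ ∈ stdSimplex ℝ A.A) (i : I) :
    0 < A.blockAction n θ i ∧ 1 / A.blockAction n θ i ≤ Fintype.card I * √(n + 1) := by
  have hI : 0 < (Fintype.card I : ℝ) := by exact_mod_cast Fintype.card_pos
  have h1 : explore n * (1 / (Fintype.card I : ℝ)) ≤ A.blockAction n θ i := by
    rw [blockAction_eq]
    have := mul_nonneg (sub_nonneg.2 (explore_le_one n)) ((A.barycenter_mem hθ).1 i)
    simp only [Pi.add_apply, Pi.smul_apply, smul_eq_mul, uniform]
    linarith
  have h2 : 0 < explore n * (1 / (Fintype.card I : ℝ)) := mul_pos (explore_pos n) (by positivity)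
  refine ⟨h2.trans_le h1, ?_⟩
  refine (one_div_le_one_div_of_le h2 h1).trans (le_of_eq ?_)
  rw [explore_eq]
  have := one_le_sqrt_succ n
  field_simp

namespace InnerStrategy

theorem blockHistory_congr (Ψ : A.InnerStrategy C) {n : ℕ} {o o' : ℕ → I × S}
    (h : ∀ t < blockStart n, o t = o' t) : Ψ.blockHistory o n = Ψ.blockHistory o' n := by
  induction n with
  | zero => rfl
  | succ n ih =>
    have h1 := ih fun t ht => h t (ht.trans (strictMono_blockStart n.lt_succ_self))
    simp only [blockHistory, h1, estimate_congr _ h]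

theorem dependsBefore_play (Ψ : A.InnerStrategy C) (t : ℕ) : DependsBefore t (Ψ.play t) := by
  intro o o' h
  unfold play
  rw [Ψ.blockHistory_congr fun u hu => h u (hu.trans_le (blockStart_blockIndex_le t))]

theorem play_mem [Nonempty I] (Ψ : A.InnerStrategy C) (t : ℕ) (o : ℕ → I × S) :
    Ψ.play t o ∈ stdSimplex ℝ I :=
  A.blockAction_mem _ (Ψ.next_mem _)

theorem play_eq (Ψ : A.InnerStrategy C) {n t : ℕ}
    (ht : t ∈ Finset.Ico (blockStart n) (blockStart (n + 1))) (o : ℕ → I × S) :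
    Ψ.play t o = A.blockAction n (Ψ.next (Ψ.blockHistory o n)) := by
  rw [Finset.mem_Ico] at ht
  rw [play, blockIndex_eq ht.1 ht.2]

end InnerStrategy

end Game.SignalLift.ActionLift

end BlockStrategy

/-! ### The distance to the target set along a path -/

section Pathwise

variable {I J S : Type*} [Fintype I] [Fintype J] [Fintype S] {d : ℕ} {G : Game I J S d}
  {D : G.SignalLift} {A : D.ActionLift} {C : Set (EuclideanSpace ℝ (Fin d))}

theorem norm_le_sum_abs {ι : Type*} [Fintype ι] (v : EuclideanSpace ℝ ι) : ‖v‖ ≤ ∑ i, |v i| := by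
  rw [EuclideanSpace.norm_eq, Real.sqrt_le_iff]
  refine ⟨Finset.sum_nonneg fun i _ => abs_nonneg _, ?_⟩
  exact Finset.sum_sq_le_sq_sum_of_nonneg fun i _ => abs_nonneg _

theorem abs_apply_le_norm {ι : Type*} [Fintype ι] (v : EuclideanSpace ℝ ι) (i : ι) : |v i| ≤ ‖v‖ :=
  PiLp.norm_apply_le v i

theorem Game.norm_payoff_le (G : Game I J S d) {R : ℝ} (hR : ∀ i j, ‖G.r i j‖ ≤ R) {p : I → ℝ}
    {q : J → ℝ} (hp : p ∈ stdSimplex ℝ I) (hq : q ∈ stdSimplex ℝ J) : ‖G.payoff p q‖ ≤ R := by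
  calc ‖G.payoff p q‖ ≤ ∑ i, ∑ j, p i * q j * R := by
        refine (norm_sum_le _ _).trans (Finset.sum_le_sum fun i _ => ?_)
        refine (norm_sum_le _ _).trans (Finset.sum_le_sum fun j _ => ?_)
        rw [norm_smul, Real.norm_eq_abs, abs_of_nonneg (mul_nonneg (hp.1 i) (hq.1 j))]
        exact mul_le_mul_of_nonneg_left (hR i j) (mul_nonneg (hp.1 i) (hq.1 j))
    _ = R := by simp only [← Finset.sum_mul, ← Finset.mul_sum, hq.2, hp.2, mul_one, one_mul]

theorem Game.norm_le_of_mem_mbar (G : Game I J S d) {R : ℝ} (hR : ∀ i j, ‖G.r i j‖ ≤ R) {p : I → ℝ}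
    (hp : p ∈ stdSimplex ℝ I) {σ : EuclideanSpace ℝ (I × S)} {v : EuclideanSpace ℝ (Fin d)}
    (hv : v ∈ G.mbar p σ) : ‖v‖ ≤ R := by
  obtain ⟨q, hq, -, rfl⟩ := hv
  exact G.norm_payoff_le hR hp hq

/-- A weighted sum of elements of a convex set is a multiple of an element of this set. -/
theorem exists_sum_smul_eq {E : Type*} [AddCommGroup E] [Module ℝ E] {m : Set E}
    (hm : Convex ℝ m) (hne : m.Nonempty) {ι : Type*} (s : Finset ι) {w : ι → ℝ}
    (hw : ∀ n ∈ s, 0 ≤ w n) {v : ι → E} (hv : ∀ n ∈ s, v n ∈ m) :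
    ∃ u ∈ m, ∑ n ∈ s, w n • v n = (∑ n ∈ s, w n) • u := by
  rcases (Finset.sum_nonneg hw).eq_or_lt with h | h
  · obtain ⟨u, hu⟩ := hne
    refine ⟨u, hu, ?_⟩
    rw [← h, zero_smul]
    refine Finset.sum_eq_zero fun n hn => ?_
    rw [(Finset.sum_eq_zero_iff_of_nonneg hw).1 h.symm n hn, zero_smul]
  · refine ⟨s.centerMass w v, hm.centerMass_mem hw h hv, ?_⟩
    rw [Finset.centerMass, smul_smul, mul_inv_cancel₀ h.ne', one_smul]

open Classical in
/-- The pure action `j`, as a mixed action. -/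
def pureAction (j : J) : J → ℝ := Pi.single j 1

theorem pureAction_mem (j : J) : pureAction j ∈ stdSimplex ℝ J := by
  classical
  unfold pureAction
  convert single_mem_stdSimplex ℝ j

theorem Game.payoff_pureAction (G : Game I J S d) (p : I → ℝ) (j : J) :
    G.payoff p (pureAction j) = ∑ i, p i • G.r i j := by
  classical
  refine Finset.sum_congr rfl fun i _ => ?_
  rw [Finset.sum_eq_single j]
  · simp [pureAction]
  · intro j' _ hj
    simp [pureAction, hj]
  · simp

omit [Fintype I] in
theorem Game.signal_pureAction (G : Game I J S d) (j : J) (c : I × S) :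
    G.signal (pureAction j) c = G.H c.1 j c.2 := by
  classical
  simp only [signal]
  rw [Finset.sum_eq_single j]
  · simp [pureAction]
  · intro j' _ hj
    simp [pureAction, hj]
  · simp

namespace Game.SignalLift.ActionLift

/-- The payoff of a mixture of lifted actions is compatible with the lift of the signals. -/
theorem exists_payoff_barycenter_eq (A : D.ActionLift) {θ : A.A → ℝ} (hθ : θ ∈ stdSimplex ℝ A.A)
    {q : J → ℝ} (hq : q ∈ stdSimplex ℝ J) :
    ∃ v : A.A × D.B → EuclideanSpace ℝ (Fin d), (∀ c, v c ∈ G.mbar c.1 c.2) ∧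
      G.payoff (A.barycenter θ) q = ∑ c, tensor θ (D.Φ (G.signal q)) c • v c := by
  have hmem : G.payoff (A.barycenter θ) q ∈ G.mbar (A.barycenter θ) (G.signal q) :=
    ⟨q, hq, rfl, rfl⟩
  rw [D.mbar_eq _ ⟨q, hq, rfl⟩ _ (A.barycenter_mem hθ), Set.mem_fintype_sum] at hmem
  obtain ⟨g, hg, hsum⟩ := hmem
  choose u hu hug using hg
  choose q' hq' hqb hqu using hu
  refine ⟨fun c => G.payoff c.1 (q' c.2), fun c => ⟨q' c.2, hq' c.2, hqb c.2, rfl⟩, ?_⟩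
  rw [← hsum, Fintype.sum_prod_type_right]
  refine Finset.sum_congr rfl fun b _ => ?_
  rw [← hug, ← hqu]
  simp only [tensor, mul_comm (θ _), mul_smul, ← Finset.smul_sum]
  congr 1
  have := map_sum (G.payoffLinLeft (q' b)) (fun a : A.A => θ a • (a : I → ℝ)) Finset.univ
  simp only [map_smul, payoffLinLeft_apply] at this
  exact this

namespace InnerStrategy

variable (Ψ : A.InnerStrategy C)

/-- The mixture of lifted actions chosen for block `n`. -/
def choice (o : ℕ → I × S) (n : ℕ) : A.A → ℝ := Ψ.next (Ψ.blockHistory o n)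

/-- The mixed action of block `n`. -/
def blockPlay (o : ℕ → I × S) (n : ℕ) : I → ℝ := A.blockAction n (Ψ.choice o n)

/-- The projected estimate of the signals of block `n`. -/
def projEstimate (o : ℕ → I × S) (n : ℕ) : EuclideanSpace ℝ (I × S) :=
  proj G.feasible (estimate n (Ψ.blockPlay o n) o)

open Classical in
/-- The deviation, in round `t`, between the importance-weighted observation and the law of the
signals. -/
def signalDeviation (c : I × S) (t : ℕ) (x : ℕ → I × J × S) : ℝ :=
  (if observations x t = c then 1 / Ψ.play t (observations x) c.1 else 0) - G.H c.1 (x t).2.1 c.2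

/-- The deviation, in round `t`, between the payoff and its conditional expectation. -/
def payoffDeviation (k : Fin d) (t : ℕ) (x : ℕ → I × J × S) : ℝ :=
  G.r (x t).1 (x t).2.1 k - G.payoff (Ψ.play t (observations x)) (pureAction (x t).2.1) k

theorem choice_mem (o : ℕ → I × S) (n : ℕ) : Ψ.choice o n ∈ stdSimplex ℝ A.A := Ψ.next_mem _

end InnerStrategy

end Game.SignalLift.ActionLift

/-- The empirical distribution of the actions of the second player in block `n`. -/
def empirical (x : ℕ → I × J × S) (n : ℕ) : J → ℝ :=
  (1 / (blockLen n : ℝ)) • ∑ t ∈ Finset.Ico (blockStart n) (blockStart (n + 1)),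
    pureAction (x t).2.1

theorem card_block (n : ℕ) :
    (Finset.Ico (blockStart n) (blockStart (n + 1))).card = blockLen n := by
  rw [Nat.card_Ico, blockStart_succ]
  omega

omit [Fintype I] [Fintype J] [Fintype S] in
theorem blockLen_smul_empirical (x : ℕ → I × J × S) (n : ℕ) : (blockLen n : ℝ) • empirical x n =
    ∑ t ∈ Finset.Ico (blockStart n) (blockStart (n + 1)), pureAction (x t).2.1 := by
  have : (blockLen n : ℝ) ≠ 0 := by exact_mod_cast (blockLen_pos n).ne'
  rw [empirical, smul_smul, mul_one_div_cancel this, one_smul]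

omit [Fintype I] [Fintype S] in
theorem empirical_mem (x : ℕ → I × J × S) (n : ℕ) : empirical x n ∈ stdSimplex ℝ J := by
  rw [empirical, Finset.smul_sum]
  refine (convex_stdSimplex ℝ J).sum_mem (fun t _ => by positivity) ?_
    fun t _ => pureAction_mem _
  rw [Finset.sum_const, card_block, nsmul_eq_mul, mul_one_div_cancel]
  exact_mod_cast (blockLen_pos n).ne'

namespace Game.SignalLift.ActionLift.InnerStrategy

variable (Ψ : A.InnerStrategy C)

open Finset in
theorem blockLen_mul_estimate_sub (x : ℕ → I × J × S) (n : ℕ) (c : I × S) :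
    (blockLen n : ℝ) * (estimate n (Ψ.blockPlay (observations x) n) (observations x) c -
      G.signal (empirical x n) c) =
      ∑ t ∈ Ico (blockStart n) (blockStart (n + 1)), Ψ.signalDeviation c t x := by
  classical
  have hL : (blockLen n : ℝ) ≠ 0 := by exact_mod_cast (blockLen_pos n).ne'
  have h1 : (blockLen n : ℝ) * G.signal (empirical x n) c =
      ∑ t ∈ Ico (blockStart n) (blockStart (n + 1)), G.H c.1 (x t).2.1 c.2 := by
    have h2 := congrArg (fun σ => G.signalLin σ c) (blockLen_smul_empirical x n)
    simp only [map_smul, map_sum, signalLin_apply, PiLp.smul_apply, smul_eq_mul] at h2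
    rw [h2, WithLp.ofLp_sum, Finset.sum_apply]
    refine sum_congr rfl fun t _ => ?_
    exact G.signal_pureAction _ c
  have h3 : (blockLen n : ℝ) * estimate n (Ψ.blockPlay (observations x) n) (observations x) c =
      ∑ t ∈ Ico (blockStart n) (blockStart (n + 1)),
        if observations x t = c then 1 / Ψ.play t (observations x) c.1 else 0 := by
    simp only [estimate]
    rw [← mul_assoc, mul_one_div_cancel hL, one_mul]
    refine sum_congr rfl fun t ht => ?_
    rw [Ψ.play_eq ht]
    rfl
  rw [mul_sub, h1, h3, ← sum_sub_distrib]
  rfl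

/-- The error on the signals of a block, in terms of the deviations. -/
theorem blockLen_mul_norm_sub_le (x : ℕ → I × J × S) (n : ℕ) {β : ℝ}
    (hβ : ∀ c, |∑ t ∈ Finset.Ico (blockStart n) (blockStart (n + 1)),
      Ψ.signalDeviation c t x| ≤ β) :
    (blockLen n : ℝ) * ‖G.signal (empirical x n) - Ψ.projEstimate (observations x) n‖ ≤
      2 * (Fintype.card (I × S) * β) := by
  set σ := G.signal (empirical x n)
  set τ := estimate n (Ψ.blockPlay (observations x) n) (observations x) with hτ
  have hσ : σ ∈ G.feasible := ⟨_, empirical_mem x n, rfl⟩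
  obtain ⟨-, h2⟩ := proj_spec G.isPolytope_feasible.isCompact.isClosed ⟨σ, hσ⟩ τ
  have h3 : dist τ (Ψ.projEstimate (observations x) n) ≤ dist τ σ := by
    rw [projEstimate, ← hτ, h2]
    exact Metric.infDist_le_dist_of_mem hσ
  have h4 : ‖σ - Ψ.projEstimate (observations x) n‖ ≤ 2 * ‖τ - σ‖ := by
    rw [dist_eq_norm, dist_eq_norm] at h3
    have := norm_sub_le_norm_sub_add_norm_sub σ τ (Ψ.projEstimate (observations x) n)
    rw [norm_sub_rev σ τ] at this
    linarith
  have hL : (0 : ℝ) ≤ blockLen n := Nat.cast_nonneg _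
  have h5 : (blockLen n : ℝ) * ‖τ - σ‖ ≤ Fintype.card (I × S) * β := by
    calc (blockLen n : ℝ) * ‖τ - σ‖ ≤ blockLen n * ∑ c, |(τ - σ) c| :=
          mul_le_mul_of_nonneg_left (norm_le_sum_abs _) hL
      _ = ∑ c, |∑ t ∈ Finset.Ico (blockStart n) (blockStart (n + 1)), Ψ.signalDeviation c t x| := by
          rw [Finset.mul_sum]
          refine Finset.sum_congr rfl fun c _ => ?_
          rw [← Ψ.blockLen_mul_estimate_sub x n c, abs_mul, abs_of_nonneg hL]
          rfl
      _ ≤ ∑ _c : I × S, β := Finset.sum_le_sum fun c _ => hβ c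
      _ = Fintype.card (I × S) * β := by rw [Finset.sum_const, Finset.card_univ, nsmul_eq_mul]
  have := mul_le_mul_of_nonneg_left h4 hL
  linarith

/-- The expected payoffs of a block are close to those of its underlying mixture of lifted
actions. -/
theorem norm_sum_payoff_sub_le [Nonempty I] {R : ℝ} (hR : ∀ i j, ‖G.r i j‖ ≤ R)
    (x : ℕ → I × J × S) (n : ℕ) :
    ‖∑ t ∈ Finset.Ico (blockStart n) (blockStart (n + 1)),
        G.payoff (Ψ.play t (observations x)) (pureAction (x t).2.1) -
      (blockLen n : ℝ) • G.payoff (A.barycenter (Ψ.choice (observations x) n)) (empirical x n)‖ ≤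
      2 * R * (blockLen n * explore n) := by
  set o := observations x
  have h1 : ∑ t ∈ Finset.Ico (blockStart n) (blockStart (n + 1)),
      G.payoff (Ψ.play t o) (pureAction (x t).2.1) =
      (blockLen n : ℝ) • G.payoff (Ψ.blockPlay o n) (empirical x n) := by
    have h2 := congrArg (G.payoffLin (Ψ.blockPlay o n)) (blockLen_smul_empirical x n)
    simp only [map_smul, map_sum, payoffLin_apply] at h2
    rw [h2]
    refine Finset.sum_congr rfl fun t ht => ?_
    rw [Ψ.play_eq ht]
    rfl
  have h2 : G.payoff (Ψ.blockPlay o n) (empirical x n) =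
      (1 - explore n) • G.payoff (A.barycenter (Ψ.choice o n)) (empirical x n) +
        explore n • G.payoff (uniform I) (empirical x n) := by
    have := map_add (G.payoffLinLeft (empirical x n)) ((1 - explore n) • A.barycenter (Ψ.choice o n))
      (explore n • uniform I)
    rw [← blockAction_eq, map_smul, map_smul] at this
    exact this
  have hq := empirical_mem x n
  have h3 := G.norm_payoff_le hR (A.barycenter_mem (Ψ.choice_mem o n)) hq
  have h4 := G.norm_payoff_le hR (uniform_mem (I := I)) hq
  rw [h1, h2, ← smul_sub]
  have h5 : (1 - explore n) • G.payoff (A.barycenter (Ψ.choice o n)) (empirical x n) +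
        explore n • G.payoff (uniform I) (empirical x n) -
        G.payoff (A.barycenter (Ψ.choice o n)) (empirical x n) =
      explore n • (G.payoff (uniform I) (empirical x n) -
        G.payoff (A.barycenter (Ψ.choice o n)) (empirical x n)) := by module
  rw [h5, smul_smul, norm_smul, Real.norm_eq_abs,
    abs_of_nonneg (mul_nonneg (Nat.cast_nonneg _) (explore_pos n).le), mul_comm]
  refine mul_le_mul_of_nonneg_right ?_ (mul_nonneg (Nat.cast_nonneg _) (explore_pos n).le)
  have := norm_sub_le (G.payoff (uniform I) (empirical x n))
    (G.payoff (A.barycenter (Ψ.choice o n)) (empirical x n))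
  linarith

end Game.SignalLift.ActionLift.InnerStrategy

end Pathwise

section PathwiseBound

variable {I J S : Type*} [Fintype I] [Fintype J] [Fintype S] {d : ℕ} {G : Game I J S d}
  {D : G.SignalLift} {A : D.ActionLift} {C : Set (EuclideanSpace ℝ (Fin d))}

/-- Two sums of product distributions with close weights and close second factors are close. -/
theorem sum_abs_sub_tensor_le {A B : Type*} [Fintype A] [Fintype B] (s : Finset ℕ) {L w : ℕ → ℝ}
    (hw : ∀ n, 0 ≤ w n) (hL : ∀ n, w n ≤ L n) (hL1 : ∀ n, L n ≤ w n + 1) {x : ℕ → A → ℝ}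
    (hx : ∀ n, x n ∈ stdSimplex ℝ A) {y y' : ℕ → B → ℝ} (hy : ∀ n, y n ∈ stdSimplex ℝ B) :
    ∑ c, |∑ n ∈ s, L n * tensor (x n) (y n) c - ∑ n ∈ s, w n * tensor (x n) (y' n) c| ≤
      s.card + ∑ n ∈ s, w n * ∑ b, |y n b - y' n b| := by
  have h1 : ∀ n (c : A × B), |L n * tensor (x n) (y n) c - w n * tensor (x n) (y' n) c| ≤
      tensor (x n) (y n) c + w n * (x n c.1 * |y n c.2 - y' n c.2|) := by
    intro n c
    have h2 : L n * tensor (x n) (y n) c - w n * tensor (x n) (y' n) c =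
        (L n - w n) * tensor (x n) (y n) c + w n * (x n c.1 * (y n c.2 - y' n c.2)) := by
      simp only [tensor]
      ring
    have h3 := (tensor_mem_stdSimplex (hx n) (hy n)).1 c
    rw [h2]
    refine (abs_add_le _ _).trans (add_le_add ?_ (le_of_eq ?_))
    · rw [abs_mul, abs_of_nonneg h3, abs_of_nonneg (sub_nonneg.2 (hL n))]
      exact mul_le_of_le_one_left h3 (by linarith [hL1 n])
    · rw [abs_mul, abs_mul, abs_of_nonneg (hw n), abs_of_nonneg ((hx n).1 _)]
  calc ∑ c, |∑ n ∈ s, L n * tensor (x n) (y n) c - ∑ n ∈ s, w n * tensor (x n) (y' n) c|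
      ≤ ∑ c : A × B, ∑ n ∈ s, (tensor (x n) (y n) c + w n * (x n c.1 * |y n c.2 - y' n c.2|)) := by
        refine Finset.sum_le_sum fun c _ => ?_
        rw [← Finset.sum_sub_distrib]
        exact (Finset.abs_sum_le_sum_abs _ _).trans (Finset.sum_le_sum fun n _ => h1 n c)
    _ = ∑ n ∈ s, (∑ c : A × B, tensor (x n) (y n) c +
          w n * ∑ c : A × B, x n c.1 * |y n c.2 - y' n c.2|) := by
        rw [Finset.sum_comm]
        refine Finset.sum_congr rfl fun n _ => ?_
        rw [Finset.sum_add_distrib, Finset.mul_sum]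
    _ = ∑ n ∈ s, (1 + w n * ∑ b, |y n b - y' n b|) := by
        refine Finset.sum_congr rfl fun n _ => ?_
        have h4 := (tensor_mem_stdSimplex (hx n) (hy n)).2
        rw [h4, Fintype.sum_prod_type]
        simp only [← Finset.mul_sum]
        rw [← Finset.sum_mul, (hx n).2, one_mul]
    _ = s.card + ∑ n ∈ s, w n * ∑ b, |y n b - y' n b| := by
        rw [Finset.sum_add_distrib]
        simp

namespace Game.SignalLift.ActionLift.InnerStrategy

variable (Ψ : A.InnerStrategy C)

theorem blockHistory_succ (o : ℕ → I × S) (n : ℕ) : Ψ.blockHistory o (n + 1) =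
    Ψ.blockHistory o n ++ [(Ψ.next (Ψ.blockHistory o n), D.Φ (Ψ.projEstimate o n))] := rfl

theorem length_blockHistory (o : ℕ → I × S) (n : ℕ) : (Ψ.blockHistory o n).length = n := by
  induction n with
  | zero => rfl
  | succ n ih => rw [blockHistory_succ, List.length_append, ih, List.length_singleton]

theorem totalWeight_smul_polyAverage_blockHistory (o : ℕ → I × S) (n : ℕ) :
    totalWeight n • polyAverage (Ψ.blockHistory o n) =
      ∑ k ∈ Finset.range n, weight k • tensor (Ψ.choice o k) (D.Φ (Ψ.projEstimate o k)) := by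
  induction n with
  | zero => simp [totalWeight]
  | succ n ih =>
    have h := totalWeight_smul_polyAverage_append (Ψ.blockHistory o n)
      (Ψ.next (Ψ.blockHistory o n), D.Φ (Ψ.projEstimate o n))
    rw [length_blockHistory, ← blockHistory_succ] at h
    rw [h, ih, Finset.sum_range_succ]
    rfl

theorem projEstimate_mem [Nonempty J] (o : ℕ → I × S) (n : ℕ) :
    Ψ.projEstimate o n ∈ G.feasible := by
  obtain ⟨j⟩ := ‹Nonempty J›
  exact (proj_spec G.isPolytope_feasible.isCompact.isClosed
    ⟨_, pureAction j, pureAction_mem j, rfl⟩ _).1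

/-- The weighted average of the lifted actions is close to the lifted target set. -/
theorem totalWeight_mul_infDist_le [Nonempty I] [Nonempty J] (hC : IsClosed C) (hc : Convex ℝ C)
    (hAPM : G.APM C) (o : ℕ → I × S) (n : ℕ) :
    totalWeight n * Metric.infDist (polyAverage (Ψ.blockHistory o n)) (A.liftTarget C) ≤
      2 * (n : ℝ) ^ 2 := by
  have h := Ψ.sq_totalWeight_mul_infDist_le hC hc hAPM
    (fun n => D.Φ_mem _ (Ψ.projEstimate_mem o n)) (h := Ψ.blockHistory o) rfl
    (Ψ.blockHistory_succ o) n
  refine le_of_sq_le_sq ?_ (by positivity)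
  have := sum_sq_weight_le n
  nlinarith

variable (A C) in
/-- The distance of the average payoff to the target set along a path, in terms of the deviations
along this path. -/
theorem exists_mul_infDist_le [Nonempty I] [Nonempty J] (hC : IsClosed C) (hc : Convex ℝ C)
    (hAPM : G.APM C) : ∃ K : ℝ, 0 ≤ K ∧ ∀ (Ψ : A.InnerStrategy C) (x : ℕ → I × J × S) (T : ℕ)
      (β : ℝ) (β' : ℕ → ℝ), 1 ≤ T → 0 ≤ β → (∀ n, 0 ≤ β' n) →
      (∀ k, |∑ t ∈ Finset.range (blockStart (blockIndex T)), Ψ.payoffDeviation k t x| ≤ β) →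
      (∀ n < blockIndex T, ∀ c, |∑ t ∈ Finset.Ico (blockStart n) (blockStart (n + 1)),
        Ψ.signalDeviation c t x| ≤ β' n) →
      T * Metric.infDist ((1 / (T : ℝ)) • ∑ t ∈ Finset.range T, G.r (x t).1 (x t).2.1) C ≤
        K * ((blockIndex T : ℝ) ^ 2 + β + ∑ n ∈ Finset.range (blockIndex T), β' n) := by
  obtain ⟨R, hR0, hR⟩ : ∃ R : ℝ, 0 ≤ R ∧ ∀ i j, ‖G.r i j‖ ≤ R :=
    ⟨∑ i, ∑ j, ‖G.r i j‖, by positivity, fun i j =>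
      (Finset.single_le_sum (f := fun j => ‖G.r i j‖) (fun _ _ => norm_nonneg _)
        (Finset.mem_univ j)).trans (Finset.single_le_sum (f := fun i => ∑ j, ‖G.r i j‖)
          (fun _ _ => by positivity) (Finset.mem_univ i))⟩
  obtain ⟨Λ, hΛ0, hΛ⟩ := D.Φ_piecewiseLinear.exists_norm_sub_le G.isPolytope_feasible.convex
  set κ : ℝ := (Fintype.card (A.A × D.B) : ℝ)
  set ν : ℝ := (Fintype.card D.B : ℝ)
  set ι : ℝ := (Fintype.card (I × S) : ℝ)
  have hκ : 0 ≤ κ := Nat.cast_nonneg _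
  have hν : 0 ≤ ν := Nat.cast_nonneg _
  have hι : 0 ≤ ι := Nat.cast_nonneg _
  refine ⟨R * (18 + 2 * κ) + d + R * (ν * Λ * (2 * ι)), by positivity, ?_⟩
  intro Ψ x T β β' hT hβ hβ' hpay hsig
  set N := blockIndex T with hN
  have hN1 : 1 ≤ N := blockIndex_pos hT
  have hN1' : (1 : ℝ) ≤ N := by exact_mod_cast hN1
  have hT0 : (0 : ℝ) < T := by exact_mod_cast hT
  set o := observations x with ho
  set s := blockStart N with hs
  have hsT : s ≤ T := blockStart_blockIndex_le T
  -- the rounds of the incomplete block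
  have hTs : (T : ℝ) - s ≤ 6 * (N : ℝ) ^ 2 := by
    have h1 : (T : ℝ) ≤ s + blockLen N := by
      have := lt_blockStart_blockIndex_succ T
      rw [blockStart_succ] at this
      exact_mod_cast this.le
    have h2 := blockLen_le_of_one_le hN1
    have h3 : (N : ℝ) * √N ≤ (N : ℝ) ^ 2 := by
      rw [sq]
      refine mul_le_mul_of_nonneg_left ?_ (by positivity)
      exact Real.sqrt_le_iff.2 ⟨by positivity, by nlinarith⟩
    linarith
  have hNN : (N : ℝ) ≤ (N : ℝ) ^ 2 := by nlinarith
  set W := totalWeight N with hW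
  have hWs : W ≤ s := totalWeight_le_blockStart N
  have hsW : (s : ℝ) ≤ W + N := blockStart_le N
  have hW0 : 0 < W := totalWeight_pos (by omega)
  have hsT' : (s : ℝ) ≤ T := by exact_mod_cast hsT
  -- the mixtures played in the lifted game
  let θ := fun n => Ψ.choice o n
  let σ := fun n => G.signal (empirical x n)
  let y := fun n => D.Φ (Ψ.projEstimate o n)
  have hσ : ∀ n, σ n ∈ G.feasible := fun n => ⟨_, empirical_mem x n, rfl⟩
  have hθ : ∀ n, θ n ∈ stdSimplex ℝ A.A := fun n => Ψ.choice_mem o n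
  have hΦσ : ∀ n, D.Φ (σ n) ∈ stdSimplex ℝ D.B := fun n => D.Φ_mem _ (hσ n)
  choose v hv hveq using fun n => A.exists_payoff_barycenter_eq (hθ n) (empirical_mem x n)
  have hVex : ∀ c : A.A × D.B, ∃ u ∈ G.mbar c.1 c.2,
      ∑ n ∈ Finset.range N, ((blockLen n : ℝ) * tensor (θ n) (D.Φ (σ n)) c) • v n c =
        (∑ n ∈ Finset.range N, (blockLen n : ℝ) * tensor (θ n) (D.Φ (σ n)) c) • u := fun c =>
    exists_sum_smul_eq (G.convex_mbar _ _) (G.mbar_nonempty _ (D.B_subset _ c.2.2)) _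
      (fun n _ => mul_nonneg (Nat.cast_nonneg _) ((tensor_mem_stdSimplex (hθ n) (hΦσ n)).1 c))
      fun n _ => hv n c
  choose V hV hVeq using hVex
  have hVR : ∀ c, ‖V c‖ ≤ R := fun c => G.norm_le_of_mem_mbar hR (A.A_subset _ c.1.2) (hV c)
  set M : A.A × D.B → ℝ := fun c =>
    ∑ n ∈ Finset.range N, (blockLen n : ℝ) * tensor (θ n) (D.Φ (σ n)) c with hM
  set P := ∑ n ∈ Finset.range N, (blockLen n : ℝ) • G.payoff (A.barycenter (θ n)) (empirical x n)
    with hP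
  have hPM : P = ∑ c, M c • V c := by
    simp only [hP, hveq, Finset.smul_sum, smul_smul]
    rw [Finset.sum_comm]
    exact Finset.sum_congr rfl fun c _ => hVeq c
  -- the projection of the weighted average on the lifted target set
  set m := polyAverage (Ψ.blockHistory o N) with hm
  obtain ⟨hzmem, hzd⟩ := proj_spec (A.isClosed_liftTarget hC) (A.liftTarget_nonempty hAPM) m
  set z := proj (A.liftTarget C) m with hz
  obtain ⟨hz1, hz2⟩ := (A.mem_liftTarget C).1 hzmem
  have hzC : ∑ c, z c • V c ∈ C := hz2 V hV
  have hWm : ∀ c, W * m c = ∑ n ∈ Finset.range N, weight n * tensor (θ n) (y n) c := by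
    intro c
    have h1 := congrArg (fun u => u c) (Ψ.totalWeight_smul_polyAverage_blockHistory o N)
    simp only [PiLp.smul_apply, smul_eq_mul, WithLp.ofLp_sum, Finset.sum_apply] at h1
    exact h1
  have hlift : ∑ c, |M c - T * z c| ≤ N ^ 2 + ν * Λ * (2 * ι) * ∑ n ∈ Finset.range N, β' n +
      2 * κ * N ^ 2 + (6 * N ^ 2 + N ^ 2) := by
    have h1 : ∑ c, |M c - W * m c| ≤
        N ^ 2 + ν * Λ * (2 * ι) * ∑ n ∈ Finset.range N, β' n := by
      simp only [hM, hWm]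
      refine (sum_abs_sub_tensor_le (Finset.range N) (fun n => (weight_pos n).le)
        weight_le_blockLen blockLen_le hθ hΦσ).trans ?_
      rw [Finset.card_range, Finset.mul_sum]
      refine add_le_add hNN (Finset.sum_le_sum fun n hn => ?_)
      have h2 : ∑ b, |D.Φ (σ n) b - y n b| ≤ ν * (Λ * ‖σ n - Ψ.projEstimate o n‖) := by
        have h3 : ∀ b ∈ Finset.univ, |D.Φ (σ n) b - y n b| ≤ Λ * ‖σ n - Ψ.projEstimate o n‖ :=
          fun b _ => (norm_le_pi_norm (D.Φ (σ n) - y n) b).trans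
            (hΛ _ (hσ n) _ (Ψ.projEstimate_mem o n))
        have := Finset.sum_le_card_nsmul _ _ _ h3
        rwa [Finset.card_univ, nsmul_eq_mul] at this
      have h4 := Ψ.blockLen_mul_norm_sub_le x n (hsig n (Finset.mem_range.1 hn))
      calc weight n * ∑ b, |D.Φ (σ n) b - y n b|
          ≤ blockLen n * (ν * (Λ * ‖σ n - Ψ.projEstimate o n‖)) :=
            mul_le_mul (weight_le_blockLen n) h2 (Finset.sum_nonneg fun _ _ => abs_nonneg _)
              (Nat.cast_nonneg _)
        _ = ν * Λ * (blockLen n * ‖σ n - Ψ.projEstimate o n‖) := by ring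
        _ ≤ ν * Λ * (2 * (ι * β' n)) := mul_le_mul_of_nonneg_left h4 (mul_nonneg hν hΛ0)
        _ = ν * Λ * (2 * ι) * β' n := by ring
    have h2 : ∑ c, |W * m c - W * z c| ≤ 2 * κ * N ^ 2 := by
      have h3 : ∀ c ∈ Finset.univ, |W * m c - W * z c| ≤ 2 * (N : ℝ) ^ 2 := by
        intro c _
        rw [← mul_sub, abs_mul, abs_of_pos hW0]
        refine le_trans (mul_le_mul_of_nonneg_left ?_ hW0.le)
          (Ψ.totalWeight_mul_infDist_le hC hc hAPM o N)
        rw [← hm, ← hzd, dist_eq_norm]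
        exact abs_apply_le_norm (m - z) c
      have := Finset.sum_le_card_nsmul _ _ _ h3
      rw [Finset.card_univ, nsmul_eq_mul] at this
      linarith
    have h3 : ∑ c, |W * z c - T * z c| ≤ 6 * N ^ 2 + N ^ 2 := by
      have h4 : ∀ c, |W * z c - T * z c| = (T - W) * z c := by
        intro c
        rw [← sub_mul, abs_mul, abs_of_nonneg (hz1.1 c), abs_sub_comm, abs_of_nonneg]
        linarith
      simp only [h4, ← Finset.mul_sum]
      rw [hz1.2]
      linarith
    calc ∑ c, |M c - T * z c|
        ≤ ∑ c, (|M c - W * m c| + |W * m c - W * z c| + |W * z c - T * z c|) := by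
          refine Finset.sum_le_sum fun c _ => ?_
          have e1 := abs_sub_le (M c) (W * m c) (T * z c)
          have e2 := abs_sub_le (W * m c) (W * z c) (T * z c)
          linarith
      _ = ∑ c, |M c - W * m c| + ∑ c, |W * m c - W * z c| + ∑ c, |W * z c - T * z c| := by
          rw [Finset.sum_add_distrib, Finset.sum_add_distrib]
      _ ≤ _ := by linarith
  -- the successive approximations of the sum of the payoffs
  set Q := ∑ t ∈ Finset.range s, G.payoff (Ψ.play t o) (pureAction (x t).2.1) with hQ
  set U := ∑ t ∈ Finset.range s, G.r (x t).1 (x t).2.1 with hU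
  have e1 : ‖∑ t ∈ Finset.range T, G.r (x t).1 (x t).2.1 - U‖ ≤ R * (6 * N ^ 2) := by
    rw [← Finset.sum_range_add_sum_Ico _ hsT, ← hU, add_sub_cancel_left]
    refine (norm_sum_le _ _).trans ?_
    have := Finset.sum_le_card_nsmul (Finset.Ico s T) (fun t => ‖G.r (x t).1 (x t).2.1‖) R
      fun t _ => hR _ _
    rw [Nat.card_Ico, nsmul_eq_mul, Nat.cast_sub hsT, mul_comm] at this
    exact this.trans (mul_le_mul_of_nonneg_left hTs hR0)
  have e2 : ‖U - Q‖ ≤ d * β := by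
    refine (norm_le_sum_abs _).trans ?_
    have h1 : ∀ k ∈ Finset.univ, |(U - Q) k| ≤ β := by
      intro k _
      have h2 : (U - Q) k = ∑ t ∈ Finset.range s, Ψ.payoffDeviation k t x := by
        simp only [hU, hQ, payoffDeviation, PiLp.sub_apply, WithLp.ofLp_sum, Finset.sum_apply,
          Finset.sum_sub_distrib]
        rfl
      rw [h2]
      exact hpay k
    have := Finset.sum_le_card_nsmul _ _ _ h1
    rwa [Finset.card_univ, Fintype.card_fin, nsmul_eq_mul] at this
  have e3 : ‖Q - P‖ ≤ 2 * R * (2 * N ^ 2) := by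
    rw [hQ, hs, sum_range_blockStart, hP, ← Finset.sum_sub_distrib]
    refine (norm_sum_le _ _).trans ?_
    have h1 : ∀ n ∈ Finset.range N, ‖∑ t ∈ Finset.Ico (blockStart n) (blockStart (n + 1)),
        G.payoff (Ψ.play t o) (pureAction (x t).2.1) -
        (blockLen n : ℝ) • G.payoff (A.barycenter (θ n)) (empirical x n)‖ ≤ 2 * R * (2 * N) := by
      intro n hn
      refine (Ψ.norm_sum_payoff_sub_le hR x n).trans ?_
      refine mul_le_mul_of_nonneg_left ?_ (by positivity)
      have h2 : (blockLen n : ℝ) ≤ 2 * weight n := by linarith [blockLen_le n, one_le_weight n]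
      have h3 : weight n * explore n = n + 1 := by
        rw [weight_eq, explore_eq]
        have := one_le_sqrt_succ n
        field_simp
      have h4 : (n : ℝ) + 1 ≤ N := by exact_mod_cast Finset.mem_range.1 hn
      have := mul_le_mul_of_nonneg_right h2 (explore_pos n).le
      linarith
    have := Finset.sum_le_card_nsmul _ _ _ h1
    rw [Finset.card_range, nsmul_eq_mul] at this
    exact this.trans (le_of_eq (by ring))
  have e4 : ‖P - (T : ℝ) • ∑ c, z c • V c‖ ≤ R * ∑ c, |M c - T * z c| := by
    rw [hPM, Finset.smul_sum, ← Finset.sum_sub_distrib, Finset.mul_sum]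
    refine (norm_sum_le _ _).trans (Finset.sum_le_sum fun c _ => ?_)
    rw [smul_smul, ← sub_smul, norm_smul, Real.norm_eq_abs, mul_comm]
    exact mul_le_mul_of_nonneg_right (hVR c) (abs_nonneg _)
  have e5 : T * Metric.infDist ((1 / (T : ℝ)) • ∑ t ∈ Finset.range T, G.r (x t).1 (x t).2.1) C ≤
      ‖∑ t ∈ Finset.range T, G.r (x t).1 (x t).2.1 - (T : ℝ) • ∑ c, z c • V c‖ := by
    have h1 : ∑ t ∈ Finset.range T, G.r (x t).1 (x t).2.1 - (T : ℝ) • ∑ c, z c • V c =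
        (T : ℝ) • ((1 / (T : ℝ)) • ∑ t ∈ Finset.range T, G.r (x t).1 (x t).2.1 -
          ∑ c, z c • V c) := by
      rw [smul_sub, smul_smul, mul_one_div_cancel hT0.ne', one_smul]
    rw [h1, norm_smul, Real.norm_eq_abs, abs_of_pos hT0, ← dist_eq_norm]
    exact mul_le_mul_of_nonneg_left (Metric.infDist_le_dist_of_mem hzC) hT0.le
  have e6 : ‖∑ t ∈ Finset.range T, G.r (x t).1 (x t).2.1 - (T : ℝ) • ∑ c, z c • V c‖ ≤
      R * (6 * N ^ 2) + d * β + 2 * R * (2 * N ^ 2) + R * ∑ c, |M c - T * z c| := by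
    have f1 := norm_sub_le_norm_sub_add_norm_sub (∑ t ∈ Finset.range T, G.r (x t).1 (x t).2.1) U
      ((T : ℝ) • ∑ c, z c • V c)
    have f2 := norm_sub_le_norm_sub_add_norm_sub U Q ((T : ℝ) • ∑ c, z c • V c)
    have f3 := norm_sub_le_norm_sub_add_norm_sub Q P ((T : ℝ) • ∑ c, z c • V c)
    linarith
  have e7 := mul_le_mul_of_nonneg_left hlift hR0
  set b := ∑ n ∈ Finset.range N, β' n
  have hb : 0 ≤ b := Finset.sum_nonneg fun n _ => hβ' n
  have hd : (0 : ℝ) ≤ d := Nat.cast_nonneg _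
  calc T * Metric.infDist ((1 / (T : ℝ)) • ∑ t ∈ Finset.range T, G.r (x t).1 (x t).2.1) C
      ≤ R * (18 + 2 * κ) * N ^ 2 + d * β + R * (ν * Λ * (2 * ι)) * b := by linarith
    _ ≤ (R * (18 + 2 * κ) + d + R * (ν * Λ * (2 * ι))) * N ^ 2 +
        (R * (18 + 2 * κ) + d + R * (ν * Λ * (2 * ι))) * β +
        (R * (18 + 2 * κ) + d + R * (ν * Λ * (2 * ι))) * b := by
      have g1 : 0 ≤ R * (18 + 2 * κ) := by positivity
      have g2 : 0 ≤ R * (ν * Λ * (2 * ι)) := by positivity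
      gcongr <;> linarith
    _ = _ := by ring

end Game.SignalLift.ActionLift.InnerStrategy

end PathwiseBound

/-! ### The probability of large deviations -/

section Probability

open MeasureTheory

variable {I J S : Type*} [Fintype I] [Fintype J] [Fintype S] {d : ℕ} {G : Game I J S d}
  {D : G.SignalLift} {A : D.ActionLift} {C : Set (EuclideanSpace ℝ (Fin d))}

omit [Fintype J] in
theorem IsMartingaleDifference.neg {p : ℕ → (ℕ → I × S) → I → ℝ} {X : ℕ → (ℕ → I × J × S) → ℝ}
    {R : Finset ℕ} {b v : ℝ} (hX : IsMartingaleDifference G p X R b v) :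
    IsMartingaleDifference G p (fun t x => -X t x) R b v where
  dependsBefore t ht x y hxy := by
    show -X t x = -X t y
    rw [hX.dependsBefore t ht x y hxy]
  mean t ht x j := by
    simp only [mul_neg, Finset.sum_neg_distrib, hX.mean t ht x j, neg_zero]
  abs_le t ht x := by rw [abs_neg]; exact hX.abs_le t ht x
  variance t ht x j := by
    simp only [neg_sq]
    exact hX.variance t ht x j

theorem IsMartingaleDifference.bernstein_abs {p : ℕ → (ℕ → I × S) → I → ℝ} {Ω : Type*}
    [MeasurableSpace Ω] {μ : Measure Ω} {act : ℕ → Ω → I} {opp : ℕ → Ω → J} {sig : ℕ → Ω → S}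
    [IsProbabilityMeasure μ] {X : ℕ → (ℕ → I × J × S) → ℝ} {R : Finset ℕ} {b v : ℝ}
    (hX : IsMartingaleDifference G p X R b v) (h : IsPlay μ G p act opp sig) (x₀ : I × J × S)
    (hp : ∀ t, DependsBefore t (p t)) (hp' : ∀ t o, p t o ∈ stdSimplex ℝ I) (hb : 0 < b)
    (hv : 0 < v) (hR : R.Nonempty) {ε : ℝ} (hε : 0 < ε) :
    μ.real {ω | 2 * √(R.card * v * ε) + b * ε < |∑ t ∈ R, X t (path act opp sig ω)|} ≤
      2 * Real.exp (-ε) := by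
  have h1 := hX.bernstein h x₀ hp hp' hb hv hR hε
  have h2 := hX.neg.bernstein h x₀ hp hp' hb hv hR hε
  refine (measureReal_mono ?_).trans ((measureReal_union_le
    {ω | 2 * √(R.card * v * ε) + b * ε ≤ ∑ t ∈ R, X t (path act opp sig ω)}
    {ω | 2 * √(R.card * v * ε) + b * ε ≤ ∑ t ∈ R, -X t (path act opp sig ω)}).trans
    ((add_le_add h1 h2).trans (le_of_eq (two_mul _).symm)))
  intro ω hω
  simp only [Set.mem_union, Set.mem_ofPred_eq, Finset.sum_neg_distrib] at hω ⊢
  exact (lt_abs.1 hω).imp le_of_lt le_of_lt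

omit [Fintype I] [Fintype J] [Fintype S] in
theorem observations_update_before (x : ℕ → I × J × S) (t : ℕ) (c : I × J × S) {u : ℕ}
    (hu : u < t) : observations (Function.update x t c) u = observations x u := by
  simp [observations, Function.update_of_ne hu.ne]

namespace Game.SignalLift.ActionLift.InnerStrategy

variable (Ψ : A.InnerStrategy C)

theorem play_update (x : ℕ → I × J × S) (t : ℕ) (c : I × J × S) :
    Ψ.play t (observations (Function.update x t c)) = Ψ.play t (observations x) :=
  Ψ.dependsBefore_play t _ _ fun _ hu => observations_update_before x t c hu

theorem play_congr {t : ℕ} {x y : ℕ → I × J × S} (h : ∀ u < t, x u = y u) :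
    Ψ.play t (observations x) = Ψ.play t (observations y) :=
  Ψ.dependsBefore_play t _ _ fun u hu => by simp [observations, h u hu]

theorem sum_play_mul_H [Nonempty I] (t : ℕ) (x : ℕ → I × J × S) (j : J) :
    ∑ i, ∑ s, Ψ.play t (observations x) i * G.H i j s = 1 := by
  simp only [← Finset.mul_sum, (G.H_mem _ _).2, mul_one, (Ψ.play_mem t _).2]

open Classical in
/-- The importance-weighted observations are unbiased. Exploration bounds both their size and their
conditional variance in block `n` by `|I| √(n + 1)`. -/
theorem isMartingaleDifference_signalDeviation [Nonempty I] (c : I × S) (n : ℕ) :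
    IsMartingaleDifference G Ψ.play (Ψ.signalDeviation c)
      (Finset.Ico (blockStart n) (blockStart (n + 1))) (Fintype.card I * √(n + 1))
      (Fintype.card I * √(n + 1)) := by
  set b := (Fintype.card I : ℝ) * √(n + 1) with hb
  have hp : ∀ t ∈ Finset.Ico (blockStart n) (blockStart (n + 1)), ∀ o,
      0 < Ψ.play t o c.1 ∧ 1 / Ψ.play t o c.1 ≤ b := fun t ht o => by
    rw [Ψ.play_eq ht]
    exact A.one_div_blockAction_le n (Ψ.choice_mem o n) c.1
  have hb1 : 1 ≤ b := by
    have : (1 : ℝ) ≤ Fintype.card I := by exact_mod_cast Fintype.card_pos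
    nlinarith [one_le_sqrt_succ n]
  have hH : ∀ j, G.H c.1 j c.2 ∈ Set.Icc (0 : ℝ) 1 := fun j =>
    mem_Icc_of_mem_stdSimplex (G.H_mem c.1 j) c.2
  have hval : ∀ t x i j s, Ψ.signalDeviation c t (Function.update x t (i, j, s)) =
      (if (i, s) = c then 1 / Ψ.play t (observations x) c.1 else 0) - G.H c.1 j c.2 := by
    intro t x i j s
    simp only [signalDeviation, play_update]
    simp only [observations, Function.update_self]
  have hsum : ∀ t (x : ℕ → I × J × S) j (f : ℝ), ∑ i, ∑ s, Ψ.play t (observations x) i * G.H i j s *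
      (if (i, s) = c then f else 0) = Ψ.play t (observations x) c.1 * G.H c.1 j c.2 * f := by
    intro t x j f
    rw [← Fintype.sum_prod_type' (f := fun i s => Ψ.play t (observations x) i * G.H i j s *
      (if (i, s) = c then f else 0))]
    rw [Finset.sum_eq_single c]
    · simp
    · intro c' _ hc'
      simp [hc']
    · simp
  constructor
  · intro t ht x y hxy
    have h0 : observations x t = observations y t := by
      simp only [observations, hxy t t.lt_succ_self]
    rw [signalDeviation, signalDeviation, h0, hxy t t.lt_succ_self,
      Ψ.play_congr fun u hu => hxy u (hu.trans t.lt_succ_self)]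
  · intro t ht x j
    simp only [hval, mul_sub, Finset.sum_sub_distrib, hsum, ← Finset.sum_mul, Ψ.sum_play_mul_H]
    have := (hp t ht (observations x)).1
    field_simp
    ring
  · intro t ht x
    have h1 := hH (x t).2.1
    have h2 := hp t ht (observations x)
    have h3 : 0 ≤ 1 / Ψ.play t (observations x) c.1 := one_div_nonneg.2 h2.1.le
    rw [signalDeviation, abs_le]
    split_ifs
    · exact ⟨by linarith [h1.2], by linarith [h1.1, h2.2]⟩
    · exact ⟨by linarith [h1.2], by linarith [h1.1]⟩
  · intro t ht x j
    have h1 := hH j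
    have h2 := hp t ht (observations x)
    set π := Ψ.play t (observations x) with hπ
    set η := G.H c.1 j c.2 with hη
    -- the weights `π i * H i j s` concentrate the indicator at `c`, which leaves `η / π - η ^ 2`
    have hsq : ∀ i s, π i * G.H i j s * ((if (i, s) = c then 1 / π c.1 else 0) - η) ^ 2 =
        π i * G.H i j s * (if (i, s) = c then (1 / π c.1) ^ 2 - 2 * η * (1 / π c.1) else 0) +
        π i * G.H i j s * η ^ 2 := by
      intro i s
      split_ifs <;> ring
    have h5 : ∑ i, ∑ s, π i * G.H i j s = 1 := Ψ.sum_play_mul_H t x j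
    have h6 := hsum t x j ((1 / π c.1) ^ 2 - 2 * η * (1 / π c.1))
    simp only [← hπ, ← hη] at h6
    have h7 : ∑ i, ∑ s, π i * G.H i j s *
        Ψ.signalDeviation c t (Function.update x t (i, j, s)) ^ 2 =
        π c.1 * η * ((1 / π c.1) ^ 2 - 2 * η * (1 / π c.1)) + 1 * η ^ 2 := by
      simp only [hval, ← hπ, ← hη, hsq, Finset.sum_add_distrib, ← Finset.sum_mul, h5, h6]
    have h3 : π c.1 * η * ((1 / π c.1) ^ 2 - 2 * η * (1 / π c.1)) + 1 * η ^ 2 =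
        η * (1 / π c.1) - η ^ 2 := by
      have := h2.1
      field_simp
      ring
    have h4 : η * (1 / π c.1) ≤ 1 / π c.1 :=
      mul_le_of_le_one_left (one_div_nonneg.2 h2.1.le) h1.2
    rw [h7, h3]
    linarith [h2.2, sq_nonneg η]

theorem isMartingaleDifference_payoffDeviation [Nonempty I] {b : ℝ}
    (hb : ∀ i j, ‖G.r i j‖ ≤ b) (k : Fin d) (R : Finset ℕ) :
    IsMartingaleDifference G Ψ.play (Ψ.payoffDeviation k) R (2 * b) ((2 * b) ^ 2) := by
  have habs : ∀ t x, |Ψ.payoffDeviation k t x| ≤ 2 * b := by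
    intro t x
    have h1 := (abs_apply_le_norm (G.r (x t).1 (x t).2.1) k).trans (hb _ _)
    have h2 := (abs_apply_le_norm (G.payoff (Ψ.play t (observations x)) (pureAction (x t).2.1)) k).trans
      (G.norm_payoff_le hb (Ψ.play_mem t _) (pureAction_mem _))
    exact (abs_sub _ _).trans (by linarith)
  constructor
  · intro t ht x y hxy
    simp only [payoffDeviation, Ψ.play_congr fun u hu => hxy u (hu.trans t.lt_succ_self),
      hxy t t.lt_succ_self]
  · intro t ht x j
    simp only [payoffDeviation, play_update, Function.update_self, mul_sub, Finset.sum_sub_distrib,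
      ← Finset.sum_mul, Ψ.sum_play_mul_H]
    simp only [← Finset.mul_sum, (G.H_mem _ _).2, mul_one, one_mul, G.payoff_pureAction,
      WithLp.ofLp_sum, Finset.sum_apply, PiLp.smul_apply, smul_eq_mul, sub_self]
  · exact fun t _ x => habs t x
  · intro t ht x j
    have h1 : ∀ i s, Ψ.play t (observations x) i * G.H i j s *
        Ψ.payoffDeviation k t (Function.update x t (i, j, s)) ^ 2 ≤
        Ψ.play t (observations x) i * G.H i j s * (2 * b) ^ 2 := fun i s =>
      mul_le_mul_of_nonneg_left (sq_le_sq' (abs_le.1 (habs _ _)).1 (abs_le.1 (habs _ _)).2)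
        (mul_nonneg ((Ψ.play_mem t _).1 _) ((G.H_mem _ _).1 _))
    refine (Finset.sum_le_sum fun i _ => Finset.sum_le_sum fun s _ => h1 i s).trans (le_of_eq ?_)
    simp only [← Finset.sum_mul, Ψ.sum_play_mul_H, one_mul]

/-- With high probability, all deviations over the first `N` blocks are small: a union bound over the
coordinates of the payoff, and over the blocks and the pairs of an action and a signal. -/
theorem measureReal_deviations_le [Nonempty I] {b : ℝ} (hb0 : 0 < b) (hb : ∀ i j, ‖G.r i j‖ ≤ b)
    {Ω : Type*} [MeasurableSpace Ω] {μ : Measure Ω} [IsProbabilityMeasure μ] {act : ℕ → Ω → I}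
    {opp : ℕ → Ω → J} {sig : ℕ → Ω → S} (h : IsPlay μ G Ψ.play act opp sig) (x₀ : I × J × S)
    {N : ℕ} (hN : 1 ≤ N) {ε : ℝ} (hε : 0 < ε) :
    μ.real {ω | ¬ ((∀ k, |∑ t ∈ Finset.range (blockStart N),
        Ψ.payoffDeviation k t (path act opp sig ω)| ≤
          2 * √(blockStart N * (2 * b) ^ 2 * ε) + 2 * b * ε) ∧
      ∀ n < N, ∀ c, |∑ t ∈ Finset.Ico (blockStart n) (blockStart (n + 1)),
        Ψ.signalDeviation c t (path act opp sig ω)| ≤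
          2 * √(blockLen n * (Fintype.card I * √(n + 1)) * ε) + Fintype.card I * √(n + 1) * ε)} ≤
      (2 * d + N * (2 * Fintype.card (I × S))) * Real.exp (-ε) := by
  have hs : (Finset.range (blockStart N)).Nonempty := by
    rw [Finset.nonempty_range_iff]
    have : N ≤ blockStart N := strictMono_blockStart.id_le N
    omega
  have hI : (0 : ℝ) < Fintype.card I := by exact_mod_cast Fintype.card_pos
  set E : Fin d → Set Ω := fun k => {ω | 2 * √(blockStart N * (2 * b) ^ 2 * ε) + 2 * b * ε <
    |∑ t ∈ Finset.range (blockStart N), Ψ.payoffDeviation k t (path act opp sig ω)|} with hE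
  set E' : ℕ → I × S → Set Ω := fun n c =>
    {ω | 2 * √(blockLen n * (Fintype.card I * √(n + 1)) * ε) + Fintype.card I * √(n + 1) * ε <
      |∑ t ∈ Finset.Ico (blockStart n) (blockStart (n + 1)),
        Ψ.signalDeviation c t (path act opp sig ω)|} with hE'
  have h1 : ∀ k, μ.real (E k) ≤ 2 * Real.exp (-ε) := by
    intro k
    have := (Ψ.isMartingaleDifference_payoffDeviation hb k
      (Finset.range (blockStart N))).bernstein_abs h x₀ Ψ.dependsBefore_play Ψ.play_mem
      (by positivity) (by positivity) hs hε
    rwa [Finset.card_range] at this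
  have h2 : ∀ n c, μ.real (E' n c) ≤ 2 * Real.exp (-ε) := by
    intro n c
    have hpos : 0 < (Fintype.card I : ℝ) * √(n + 1) :=
      mul_pos hI (zero_lt_one.trans_le (one_le_sqrt_succ n))
    have := (Ψ.isMartingaleDifference_signalDeviation c n).bernstein_abs h x₀ Ψ.dependsBefore_play
      Ψ.play_mem hpos hpos
      (Finset.nonempty_Ico.2 (strictMono_blockStart n.lt_succ_self)) hε
    rwa [card_block] at this
  have hsub : {ω | ¬ ((∀ k, |∑ t ∈ Finset.range (blockStart N),
        Ψ.payoffDeviation k t (path act opp sig ω)| ≤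
          2 * √(blockStart N * (2 * b) ^ 2 * ε) + 2 * b * ε) ∧
      ∀ n < N, ∀ c, |∑ t ∈ Finset.Ico (blockStart n) (blockStart (n + 1)),
        Ψ.signalDeviation c t (path act opp sig ω)| ≤
          2 * √(blockLen n * (Fintype.card I * √(n + 1)) * ε) + Fintype.card I * √(n + 1) * ε)} ⊆
      (⋃ k, E k) ∪ ⋃ n ∈ Finset.range N, ⋃ c, E' n c := by
    intro ω hω
    simp only [Set.mem_ofPred_eq, not_and_or, not_forall, not_le] at hω
    rcases hω with ⟨k, hk⟩ | ⟨n, hn, c, hc⟩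
    · exact Or.inl (Set.mem_iUnion.2 ⟨k, hk⟩)
    · exact Or.inr (Set.mem_biUnion (Finset.mem_range.2 hn) (Set.mem_iUnion.2 ⟨c, hc⟩))
  refine (measureReal_mono hsub).trans ((measureReal_union_le _ _).trans ?_)
  rw [add_mul]
  refine add_le_add ?_ ?_
  · refine (measureReal_iUnion_fintype_le _).trans ?_
    refine (Finset.sum_le_sum fun k _ => h1 k).trans (le_of_eq ?_)
    rw [Finset.sum_const, Finset.card_univ, Fintype.card_fin, nsmul_eq_mul]
    ring
  · refine (measureReal_biUnion_finset_le _ _).trans ?_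
    have h3 : ∀ n ∈ Finset.range N, μ.real (⋃ c, E' n c) ≤
        2 * Fintype.card (I × S) * Real.exp (-ε) := fun n _ => by
      refine (measureReal_iUnion_fintype_le _).trans ?_
      refine (Finset.sum_le_sum fun c _ => h2 n c).trans (le_of_eq ?_)
      rw [Finset.sum_const, Finset.card_univ, nsmul_eq_mul]
      ring
    refine (Finset.sum_le_sum h3).trans (le_of_eq ?_)
    rw [Finset.sum_const, Finset.card_range, nsmul_eq_mul]
    ring

end Game.SignalLift.ActionLift.InnerStrategy

end Probability

/-! ### The rate of convergence -/

section Rate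

open MeasureTheory

/-- The payoff deviations, of order `√T`, are of lower order than the square of the number `N` of
blocks, which is of order `T ^ (4 / 5)`. -/
theorem payoffDeviation_bound_le {N : ℕ} (hN : 1 ≤ N) {s b ε : ℝ} (hs : √s ≤ 4 * (N : ℝ) ^ 2)
    (hb : 0 ≤ b) (hε : 0 ≤ ε) :
    2 * √(s * b ^ 2 * ε) + b * ε ≤ 8 * b * (N ^ 2 * √ε) + b * (N * √N * ε) := by
  have hN' : (1 : ℝ) ≤ N := by exact_mod_cast hN
  have h1 : √(s * b ^ 2 * ε) = √s * b * √ε := by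
    rw [Real.sqrt_mul' _ hε, Real.sqrt_mul' _ (sq_nonneg b), Real.sqrt_sq hb]
  have h2 : √s * b * √ε ≤ 4 * (N : ℝ) ^ 2 * b * √ε := by gcongr
  have h3 : (1 : ℝ) ≤ N * √N := one_le_mul_of_one_le_of_one_le hN' (Real.one_le_sqrt.2 hN')
  have h4 : b * ε * 1 ≤ b * ε * (N * √N) := mul_le_mul_of_nonneg_left h3 (mul_nonneg hb hε)
  rw [h1]
  linarith

/-- In block `n` both the length and the variance bound balance to a deviation of order `n √ε`, so
that the `N` blocks contribute `N ^ 2 √ε`. -/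
theorem sum_signalDeviation_bound_le (N : ℕ) {c ε : ℝ} (hc : 1 ≤ c) (hε : 0 ≤ ε) :
    ∑ n ∈ Finset.range N, (2 * √(blockLen n * (c * √(n + 1)) * ε) + c * √(n + 1) * ε) ≤
      4 * c * (N ^ 2 * √ε) + c * (N * √N * ε) := by
  have h : ∀ n ∈ Finset.range N, 2 * √(blockLen n * (c * √(n + 1)) * ε) + c * √(n + 1) * ε ≤
      4 * c * (N * √ε) + c * (√N * ε) := by
    intro n hn
    have hn' : (n : ℝ) + 1 ≤ N := by exact_mod_cast Finset.mem_range.1 hn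
    have hn0 : (0 : ℝ) ≤ n := n.cast_nonneg
    have h1 : (blockLen n : ℝ) ≤ 2 * ((n + 1) * √(n + 1)) := by
      have := blockLen_le n
      have := one_le_weight n
      rw [← weight_eq]
      linarith
    have h2 : (blockLen n : ℝ) * (c * √(n + 1)) ≤ (2 * c * N) ^ 2 := by
      calc (blockLen n : ℝ) * (c * √(n + 1)) ≤ 2 * ((n + 1) * √(n + 1)) * (c * √(n + 1)) := by
            gcongr
        _ = 2 * c * (n + 1) * (√(n + 1)) ^ 2 := by ring
        _ = 2 * c * (n + 1) ^ 2 := by rw [Real.sq_sqrt (by linarith)]; ring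
        _ ≤ 2 * c * N ^ 2 * (2 * c) := by
            have h3 : ((n : ℝ) + 1) ^ 2 ≤ N ^ 2 := by gcongr
            have h4 : 2 * c * ((n : ℝ) + 1) ^ 2 ≤ 2 * c * N ^ 2 := by gcongr
            refine h4.trans (le_mul_of_one_le_right (by positivity) (by linarith))
        _ = (2 * c * N) ^ 2 := by ring
    have h3 : √(blockLen n * (c * √(n + 1)) * ε) ≤ 2 * c * N * √ε := by
      rw [Real.sqrt_mul' _ hε]
      gcongr
      exact (Real.sqrt_le_sqrt h2).trans (le_of_eq (Real.sqrt_sq (by positivity)))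
    have h4 : c * √(n + 1) * ε ≤ c * √N * ε := by gcongr
    linarith
  refine (Finset.sum_le_sum h).trans (le_of_eq ?_)
  rw [Finset.sum_const, Finset.card_range, nsmul_eq_mul]
  ring

/-- A multiplicative constant inside the logarithm only costs a constant factor, as long as the
argument stays away from `1`. -/
theorem log_mul_le {c x : ℝ} (hc : 1 ≤ c) (hx : 2 ≤ x) :
    Real.log (c * x) ≤ (1 + Real.log c / Real.log 2) * Real.log x := by
  have h2 : 0 < Real.log 2 := Real.log_pos one_lt_two
  have h3 : Real.log 2 ≤ Real.log x := Real.log_le_log two_pos hx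
  rw [Real.log_mul (by linarith) (by linarith), add_mul, one_mul, add_comm, div_mul_eq_mul_div,
    add_le_add_iff_left, le_div_iff₀ h2]
  exact mul_le_mul_of_nonneg_left h3 (Real.log_nonneg hc)

variable {I J S : Type*} [Fintype I] [Fintype J] [Fintype S] {d : ℕ} {G : Game I J S d}
  {D : G.SignalLift} {C : Set (EuclideanSpace ℝ (Fin d))}

/-- The average payoff approaches the target set at the rate `T ^ (-1 / 5)`: the bound along a path,
applied on the event that all deviations are small. -/
theorem Game.SignalLift.ActionLift.exists_measureReal_infDist_le [Nonempty I] [Nonempty J]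
    (A : D.ActionLift) (hC : IsClosed C) (hc : Convex ℝ C) (hAPM : G.APM C) :
    ∃ K : ℝ, ∀ (Ψ : A.InnerStrategy C) (Ω : Type*) [MeasurableSpace Ω] (μ : Measure Ω)
      [IsProbabilityMeasure μ] (act : ℕ → Ω → I) (opp : ℕ → Ω → J) (sig : ℕ → Ω → S),
      IsPlay μ G Ψ.play act opp sig → ∀ (T : ℕ) (δ : ℝ), 1 ≤ T → 0 < δ → 2 * δ ≤ T →
      1 - δ ≤ μ.real {ω |
        Metric.infDist ((1 / (T : ℝ)) • ∑ t ∈ Finset.range T, G.r (act t ω) (opp t ω)) C ≤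
          K * ((T : ℝ) ^ (-(1 / 5) : ℝ) * √(Real.log (T / δ)) +
            (T : ℝ) ^ (-(2 / 5) : ℝ) * Real.log (T / δ))} := by
  obtain ⟨b, hb0, hb⟩ : ∃ b : ℝ, 0 < b ∧ ∀ i j, ‖G.r i j‖ ≤ b :=
    ⟨∑ i, ∑ j, ‖G.r i j‖ + 1, by positivity, fun i j => by
      have h1 := Finset.single_le_sum (f := fun j => ‖G.r i j‖) (fun _ _ => norm_nonneg _)
        (Finset.mem_univ j)
      have h2 := Finset.single_le_sum (f := fun i => ∑ j, ‖G.r i j‖)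
        (fun _ _ => by positivity) (Finset.mem_univ i)
      exact (h1.trans h2).trans (by linarith)⟩
  obtain ⟨K₀, hK₀, hK⟩ := InnerStrategy.exists_mul_infDist_le A C hC hc hAPM
  obtain ⟨i₀⟩ := ‹Nonempty I›
  obtain ⟨j₀⟩ := ‹Nonempty J›
  -- The signal set is nonempty, since it carries a probability distribution.
  obtain ⟨s₀⟩ : Nonempty S := by
    by_contra h
    rw [not_nonempty_iff] at h
    have := (G.H_mem i₀ j₀).2
    simp at this
  have : Nonempty I := ⟨i₀⟩
  have : Nonempty S := ⟨s₀⟩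
  have hI : (1 : ℝ) ≤ Fintype.card I := by exact_mod_cast Fintype.card_pos
  have hIS : (1 : ℝ) ≤ Fintype.card (I × S) := by exact_mod_cast Fintype.card_pos
  set c₀ : ℝ := 2 * d + 2 * Fintype.card (I × S) with hc₀
  have hc₀2 : 2 ≤ c₀ := by
    have : (0 : ℝ) ≤ d := d.cast_nonneg
    linarith
  set κ : ℝ := 1 + Real.log c₀ / Real.log 2 with hκ
  have hκ1 : 1 ≤ κ := by
    have : 0 ≤ Real.log c₀ / Real.log 2 :=
      div_nonneg (Real.log_nonneg (by linarith)) (Real.log_nonneg one_le_two)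
    linarith
  set M : ℝ := 1 + 16 * b + 4 * Fintype.card I with hM
  refine ⟨K₀ * (10 * (M * κ)), ?_⟩
  intro Ψ Ω _ μ _ act opp sig hplay T δ hT hδ hδT
  have hT1 : (1 : ℝ) ≤ T := by exact_mod_cast hT
  have hT0 : (0 : ℝ) < T := zero_lt_one.trans_le hT1
  have hx : 2 ≤ T / δ := (le_div_iff₀ hδ).2 hδT
  set N := blockIndex T with hN
  have hN1 : 1 ≤ N := blockIndex_pos hT
  set ε : ℝ := Real.log (c₀ * (T / δ)) with hε
  have hpos : 0 < c₀ * (T / δ) := by positivity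
  -- the factor `c₀ ≥ 2` pays for the union bound and keeps `ε` away from `0`
  have hε1 : 1 ≤ ε := by
    rw [hε, Real.le_log_iff_exp_le hpos]
    have := Real.exp_one_lt_d9
    nlinarith
  have hεκ : ε ≤ κ * Real.log (T / δ) := log_mul_le (by linarith) hx
  set ℓ := Real.log (T / δ) with hℓ
  have hℓ0 : 0 ≤ ℓ := Real.log_nonneg (by linarith)
  have hsqrt : √ε ≤ κ * √ℓ := by
    refine Real.sqrt_le_iff.2 ⟨by positivity, ?_⟩
    rw [mul_pow, Real.sq_sqrt hℓ0]
    refine hεκ.trans (mul_le_mul_of_nonneg_right ?_ hℓ0)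
    nlinarith
  have hbad := Ψ.measureReal_deviations_le hb0 hb hplay (i₀, j₀, s₀) hN1 (zero_lt_one.trans_le hε1)
  have hbad' : (2 * d + N * (2 * Fintype.card (I × S))) * Real.exp (-ε) ≤ δ := by
    have h1 : (N : ℝ) ≤ T := by exact_mod_cast blockIndex_le T
    have h2 : (2 * d + N * (2 * Fintype.card (I × S)) : ℝ) ≤ c₀ * T := by
      have h3 : (N : ℝ) * (2 * Fintype.card (I × S)) ≤ T * (2 * Fintype.card (I × S)) := by gcongr
      have h4 : (2 * d : ℝ) * 1 ≤ 2 * d * T := by gcongr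
      rw [hc₀]
      linarith
    rw [Real.exp_neg, hε, Real.exp_log hpos, ← div_eq_mul_inv, div_le_iff₀ hpos]
    refine h2.trans (le_of_eq ?_)
    field_simp
  set good : Set Ω := {ω |
        Metric.infDist ((1 / (T : ℝ)) • ∑ t ∈ Finset.range T, G.r (act t ω) (opp t ω)) C ≤
          K₀ * (10 * (M * κ)) * ((T : ℝ) ^ (-(1 / 5) : ℝ) * √ℓ + (T : ℝ) ^ (-(2 / 5) : ℝ) * ℓ)}
    with hgood
  suffices h : μ.real goodᶜ ≤ δ by
    have h1 : 1 ≤ μ.real good + μ.real goodᶜ := by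
      rw [← probReal_univ (μ := μ), ← Set.union_compl_self good]
      exact measureReal_union_le _ _
    linarith
  refine (measureReal_mono ?_).trans (hbad.trans hbad')
  rintro ω hω ⟨hdev, hdev'⟩
  refine hω ?_
  obtain ⟨hb1, hb2, hb3⟩ := blockIndex_bounds hT
  have hmain := hK Ψ (path act opp sig ω) T _ _ hT (by positivity) (fun n => by positivity)
    hdev hdev'
  have hs : √(blockStart N : ℝ) ≤ 4 * (N : ℝ) ^ 2 :=
    (Real.sqrt_le_sqrt (by exact_mod_cast blockStart_blockIndex_le T)).trans hb3
  have h1 := payoffDeviation_bound_le hN1 hs (b := 2 * b) (by positivity) (zero_le_one.trans hε1)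
  have h2 := sum_signalDeviation_bound_le N hI (zero_le_one.trans hε1)
  have h3 : (N : ℝ) ^ 2 ≤ N ^ 2 * √ε :=
    le_mul_of_one_le_right (by positivity) (Real.one_le_sqrt.2 hε1)
  set Z := (T : ℝ) ^ (-(1 / 5) : ℝ) * √ℓ + (T : ℝ) ^ (-(2 / 5) : ℝ) * ℓ with hZ
  have h4 : (N : ℝ) ^ 2 * √ε + N * √N * ε ≤ T * (10 * κ * Z) := by
    have h5 : (N : ℝ) ^ 2 * √ε ≤ 10 * (T * (T : ℝ) ^ (-(1 / 5) : ℝ)) * (κ * √ℓ) := by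
      refine mul_le_mul (hb1.trans ?_) hsqrt (Real.sqrt_nonneg _) (by positivity)
      have : 0 ≤ T * (T : ℝ) ^ (-(1 / 5) : ℝ) := by positivity
      linarith
    have h6 : (N : ℝ) * √N * ε ≤ 10 * (T * (T : ℝ) ^ (-(2 / 5) : ℝ)) * (κ * ℓ) :=
      mul_le_mul hb2 hεκ (by linarith) (by positivity)
    rw [hZ]
    linarith
  have h7 : (0 : ℝ) ≤ N ^ 2 * √ε := by positivity
  have h8 : (0 : ℝ) ≤ N * √N * ε := by positivity
  refine le_of_mul_le_mul_left (hmain.trans ?_) hT0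
  calc _ ≤ K₀ * (M * (T * (10 * κ * Z))) := by
        refine mul_le_mul_of_nonneg_left ?_ hK₀
        refine le_trans ?_ (mul_le_mul_of_nonneg_left h4 (by positivity))
        rw [hM]
        nlinarith
    _ = _ := by ring

end Rate

end PartialMonitoring

end

theorem mainTheorem3 {I J S : Type*} [Fintype I] [Fintype J] [Fintype S] [Nonempty I] [Nonempty J]
    {d : ℕ} (G : PartialMonitoring.Game I J S d) (C : Set (EuclideanSpace ℝ (Fin d)))
    (hC_closed : IsClosed C) (hC_convex : Convex ℝ C) (hAPM : G.APM C) :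
    Nonempty G.SignalLift ∧
    ∀ D : G.SignalLift, D.BiPiecewiseLinear →
      Nonempty D.ActionLift ∧
      ∀ A : D.ActionLift,
        Nonempty (A.InnerStrategy C) ∧
        ∃ K : ℝ, ∀ (Ψ : A.InnerStrategy C)
          (Ω : Type*) [MeasurableSpace Ω] (μ : MeasureTheory.Measure Ω)
          [MeasureTheory.IsProbabilityMeasure μ]
          (act : ℕ → Ω → I) (opp : ℕ → Ω → J) (sig : ℕ → Ω → S),
          PartialMonitoring.IsPlay μ G Ψ.play act opp sig →
          ∀ (T : ℕ) (δ : ℝ), 1 ≤ T → 0 < δ → δ < 1 → 2 * δ ≤ T →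
            1 - δ ≤ μ.real {ω |
              Metric.infDist ((1 / (T : ℝ)) • ∑ t ∈ Finset.range T, G.r (act t ω) (opp t ω)) C ≤
                K * ((T : ℝ) ^ (-(1 / 5) : ℝ) * Real.sqrt (Real.log (T / δ)) +
                  (T : ℝ) ^ (-(2 / 5) : ℝ) * Real.log (T / δ))} := by
  refine ⟨G.nonempty_signalLift, fun D hD => ⟨hD.nonempty_actionLift, fun A =>
    ⟨A.nonempty_innerStrategy, ?_⟩⟩⟩
  obtain ⟨K, hK⟩ := A.exists_measureReal_infDist_le hC_closed hC_convex hAPM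
  exact ⟨K, fun Ψ Ω _ μ _ act opp sig h T δ hT hδ _ hδT =>
    hK Ψ Ω μ act opp sig h T δ hT hδ hδT⟩
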